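/- All points, lines and polynomials are in the real plane $\mathbb{R}^2$. Let $\Pi_n$ be the space of real bivariate polynomials of total degree at most $n$. A finite set $\mathcal X\subset\mathbb{R}^2$ is called $n$-poised if for every choice of values $(c_A)_{A\in\mathcal X}$ there is a unique $p\in\Pi_n$ with $p(A)=c_A$ for all $A\in\mathcal X$; the fundamental polynomial $p_A^\star\in\Pi_n$ of a node $A\in\mathcal X$ is the one that equals $1$ at $A$ and $0$ at all other nodes. An $n$-poised set $\mathcal X$ is called a $GC_n$ set if the fundamental polynomial of each of its nodes is a product of $n$ polynomials of degree one. A node $A$ uses a line $\ell$ if $p_A^\star=\ell\,q$ with $q\in\Pi_{n-1}$, where $\ell$ also denotes a polynomial of degree one whose zero set is the line; $\mathcal X_\ell$ is the set of the nodes of $\mathcal X$ that use $\ell$. A $k$-node line is a line passing through exactly $k$ nodes of $\mathcal X$, and a maximal line of an $n$-poised set is an $(n+1)$-node line. **Proposition 4.1.** Let $\mathcal X$ be a $GC_4$ set and let $\ell$ be a $4$-node line of $\mathcal X$. Then $$|\mathcal X_\ell|=6\quad\text{or}\quad|\mathcal X_\ell|=3.$$ Moreover, the following hold: 1. $|\mathcal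 X_\ell|=6$ if and only if there is a maximal line $M_0$ of $\mathcal X$ such that $M_0\cap\ell\cap\mathcal X=\emptyset$. For every such $M_0$ we have $\mathcal X_\ell=\mathcal X\setminus(\ell\cup M_0)$, and $\mathcal X_\ell$ is a $GC_2$ set. 2. $|\mathcal X_\ell|=3$ if and only if there are two distinct maximal lines $M',M''$ of $\mathcal X$ such that $M'\cap M''\cap\ell$ consists of a single point, which is a node of $\mathcal X$. For all such $M',M''$ we have $\mathcal X_\ell=\mathcal X\setminus(\ell\cup M'\cup M'')$, and $\mathcal X_\ell$ is a $GC_1$ set. -/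

import Mathlib

namespace GCSets

/-- The real plane; a point `A` has coordinates `A 0` and `A 1`. -/
abbrev Plane : Type := Fin 2 → ℝ

/-- Bivariate real polynomials. -/
abbrev Poly : Type := MvPolynomial (Fin 2) ℝ

/-- The set of points of the plane at which `p` vanishes. -/
def zeroSet (p : Poly) : Set Plane := {A | MvPolynomial.eval A p = 0}

/-- A line is the zero set of a polynomial of degree exactly one. -/
def IsLine (l : Set Plane) : Prop :=
  ∃ L : Poly, L.totalDegree = 1 ∧ zeroSet L = l

/-- `X` is `n`-poised: interpolation of arbitrary values on the finite set `X` by polynomials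
of total degree at most `n` is uniquely solvable. (Only the values of `c` on `X` matter.) -/
def IsPoised (n : ℕ) (X : Set Plane) : Prop :=
  X.Finite ∧ ∀ c : Plane → ℝ,
    ∃! p : Poly, p.totalDegree ≤ n ∧ ∀ A ∈ X, MvPolynomial.eval A p = c A

/-- `p` is an `n`-fundamental polynomial of the node `A` of `X`. -/
def IsFundamental (n : ℕ) (X : Set Plane) (A : Plane) (p : Poly) : Prop :=
  A ∈ X ∧ p.totalDegree ≤ n ∧ MvPolynomial.eval A p = 1 ∧
    ∀ B ∈ X, B ≠ A → MvPolynomial.eval B p = 0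

/-- `X` is a `GC_n` set: it is `n`-poised, and the fundamental polynomial of each of its nodes is
a product of `n` factors of degree one. (That polynomial is unique, as `X` is poised.) -/
def IsGC (n : ℕ) (X : Set Plane) : Prop :=
  IsPoised n X ∧ ∀ A ∈ X, ∃ p : Poly, IsFundamental n X A p ∧
    ∃ L : Fin n → Poly, (∀ i, (L i).totalDegree = 1) ∧ p = ∏ i, L i

/-- The node `A` of the `n`-poised set `X` uses the line `l`: the fundamental polynomial of `A` is
`L * q`, where `L = 0` is an equation of `l` of degree one and `q` has degree at most `n - 1`. -/
def Uses (n : ℕ) (X : Set Plane) (A : Plane) (l : Set Plane) : Prop :=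
  ∃ p : Poly, IsFundamental n X A p ∧
    ∃ L q : Poly, L.totalDegree = 1 ∧ zeroSet L = l ∧ q.totalDegree + 1 ≤ n ∧ p = L * q

/-- The set `X_l` of the nodes of `X` which use the line `l`. -/
def usingNodes (n : ℕ) (X : Set Plane) (l : Set Plane) : Set Plane :=
  {A | A ∈ X ∧ Uses n X A l}

/-- `l` is a `k`-node line of `X`: a line passing through exactly `k` nodes of `X`. -/
def IsNodeLine (k : ℕ) (X : Set Plane) (l : Set Plane) : Prop :=
  IsLine l ∧ (X ∩ l).ncard = k

/-- `M` is a maximal line of the `n`-poised set `X`: a line through `n + 1` nodes of `X`. -/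
def IsMaximalLine (n : ℕ) (X : Set Plane) (M : Set Plane) : Prop :=
  IsNodeLine (n + 1) X M

end GCSets

/-! ### Lines in the plane and divisibility by their equations. -/

namespace GCSets

open MvPolynomial

/-! Apart from the translation to and from polynomials, the argument is almost entirely incidence
geometry. The fundamental polynomial of a node A is a product of linear factors, so A comes with a
cover (`IsCover`): at most n lines avoiding A whose union contains all other nodes. Together with
the number of nodes this is `LineGC`. A line with more nodes other than A than the cover may have
lines belongs to the cover. Hence a maximal line lies in the cover of every node off it, and
deleting its nodes lowers the degree by one (`LineGC.remove`).

Let l have four nodes. If a maximal line M shares no node with l, deleting M makes l maximal in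
degree three, so all nodes off both lines use l. A node of M cannot use l: the other three lines of
its cover would have to cover four nodes of M. This leaves 15 - 5 - 4 = 6 users. If two maximal
lines meet in a node of l, deleting one after the other leaves 15 - 5 - 4 - 3 = 3 users in the same
way. Since 6 ≠ 3, both equivalences follow once one of the two situations is known to occur, which
is `LineGC.exists_maximal_lines`.

For this a counterexample (`Generic`) has to be excluded. There is a maximal line
(`LineGC.exists_isMax_four`): without five-node lines, counting yields three nodes whose covers
share three disjoint four-node lines. These nodes are centres of perspectivities between two of the
lines and therefore collinear, although the line joining two of them contains no third node. There
are even three maximal lines: after deleting one, the remainder has three by the case of lower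
degree, and at most one of them misses the nodes of the deleted line
(`LineGC.not_two_disjoint_three`, `LineGC.not_two_disjoint_four`).

In a counterexample four maximal lines are impossible (`Generic.not_four`). With three, l has one
node on each of them and passes through one vertex E of the triangle EFG of remaining nodes.
Following the sides of the triangle through the covers forces l to be the side FG, which is absurd
(`Config.false`). -/

/-- The affine polynomial with the given coefficients. -/
noncomputable def affinePoly (a b c : ℝ) : Poly := C a * X 0 + C b * X 1 + C c

@[simp] theorem eval_affinePoly (a b c : ℝ) (A : Plane) :
    eval A (affinePoly a b c) = a * A 0 + b * A 1 + c := by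
  simp [affinePoly]

theorem totalDegree_affinePoly_le (a b c : ℝ) : (affinePoly a b c).totalDegree ≤ 1 := by
  unfold affinePoly
  refine (totalDegree_add _ _).trans (max_le ((totalDegree_add _ _).trans (max_le ?_ ?_)) ?_)
  · exact (totalDegree_mul _ _).trans (by simp)
  · exact (totalDegree_mul _ _).trans (by simp)
  · simp

theorem totalDegree_affinePoly {a b c : ℝ} (h : a ≠ 0 ∨ b ≠ 0) :
    (affinePoly a b c).totalDegree = 1 := by
  refine le_antisymm (totalDegree_affinePoly_le a b c) (Nat.one_le_iff_ne_zero.2 fun h0 => ?_)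
  rw [totalDegree_eq_zero_iff_eq_C] at h0
  have key : ∀ A : Plane, a * A 0 + b * A 1 + c = coeff 0 (affinePoly a b c) := fun A => by
    rw [← eval_affinePoly, h0]; simp
  have h1 := key ![0, 0]
  have h2 := key ![1, 0]
  have h3 := key ![0, 1]
  simp only [Matrix.cons_val_zero, Matrix.cons_val_one] at h1 h2 h3
  rcases h with h | h
  · exact h (by linarith)
  · exact h (by linarith)

theorem eq_affinePoly_of_totalDegree_le_one {p : Poly} (hp : p.totalDegree ≤ 1) :
    ∃ a b c, p = affinePoly a b c := by
  refine ⟨coeff (Finsupp.single 0 1) p, coeff (Finsupp.single 1 1) p, coeff 0 p, ?_⟩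
  ext m
  by_cases hm : m.degree ≤ 1
  · have : m = 0 ∨ m = Finsupp.single 0 1 ∨ m = Finsupp.single 1 1 := by
      rw [Finsupp.degree_eq_sum, Fin.sum_univ_two] at hm
      have h3 : (m 0 = 0 ∧ m 1 = 0) ∨ (m 0 = 1 ∧ m 1 = 0) ∨ (m 0 = 0 ∧ m 1 = 1) := by omega
      rcases h3 with h | h | h
      · left; ext i; fin_cases i <;> simp [h.1, h.2]
      · right; left; ext i; fin_cases i <;> simp [h.1, h.2]
      · right; right; ext i; fin_cases i <;> simp [h.1, h.2]
    have e01 : (Finsupp.single (0 : Fin 2) 1 : Fin 2 →₀ ℕ) ≠ Finsupp.single 1 1 := by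
      intro h; simpa using DFunLike.congr_fun h 0
    rcases this with rfl | rfl | rfl
    · simp [affinePoly, coeff_C_mul, coeff_X, coeff_C]
    · simp [affinePoly, coeff_C_mul, coeff_X, coeff_C, e01.symm, eq_comm (a := (0 : Fin 2 →₀ ℕ))]
    · simp [affinePoly, coeff_C_mul, coeff_X, coeff_C, e01, eq_comm (a := (0 : Fin 2 →₀ ℕ))]
  · have hm' : 1 < m.degree := by omega
    rw [coeff_eq_zero_of_totalDegree_lt (lt_of_le_of_lt hp hm'),
      coeff_eq_zero_of_totalDegree_lt (lt_of_le_of_lt (totalDegree_affinePoly_le _ _ _) hm')]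

theorem isLine_iff {h : Set Plane} :
    IsLine h ↔ ∃ a b c : ℝ, (a ≠ 0 ∨ b ≠ 0) ∧ ∀ A : Plane, A ∈ h ↔ a * A 0 + b * A 1 + c = 0 := by
  constructor
  · rintro ⟨L, hL, rfl⟩
    obtain ⟨a, b, c, rfl⟩ := eq_affinePoly_of_totalDegree_le_one hL.le
    refine ⟨a, b, c, ?_, fun A => by simp [zeroSet]⟩
    by_contra! hab
    have : affinePoly a b c = C c := by simp [affinePoly, hab.1, hab.2]
    rw [this] at hL
    simp at hL
  · rintro ⟨a, b, c, hab, hh⟩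
    exact ⟨affinePoly a b c, totalDegree_affinePoly hab, by ext A; simp [zeroSet, hh]⟩

theorem plane_ext {A B : Plane} (h0 : A 0 = B 0) (h1 : A 1 = B 1) : A = B := by
  ext i; fin_cases i <;> assumption

/-- The determinant whose vanishing expresses that three points are collinear. -/
def collinearDet (A B P : Plane) : ℝ :=
  (B 0 - A 0) * (P 1 - A 1) - (B 1 - A 1) * (P 0 - A 0)

theorem IsLine.collinearDet_eq_zero {h : Set Plane} (hh : IsLine h) {A B P : Plane}
    (hA : A ∈ h) (hB : B ∈ h) (hP : P ∈ h) : collinearDet A B P = 0 := by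
  obtain ⟨a, b, c, hab, H⟩ := isLine_iff.1 hh
  rw [H] at hA hB hP
  unfold collinearDet
  rcases hab with h | h
  · apply mul_left_cancel₀ h
    linear_combination (P 1 - A 1) * (hB - hA) - (B 1 - A 1) * (hP - hA)
  · apply mul_left_cancel₀ h
    linear_combination (B 0 - A 0) * (hP - hA) - (P 0 - A 0) * (hB - hA)

theorem IsLine.mem_of_collinearDet {h : Set Plane} (hh : IsLine h) {A B P : Plane} (hAB : A ≠ B)
    (hA : A ∈ h) (hB : B ∈ h) (hP : collinearDet A B P = 0) : P ∈ h := by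
  obtain ⟨a, b, c, hab, H⟩ := isLine_iff.1 hh
  rw [H] at *
  unfold collinearDet at hP
  by_cases h0 : B 0 - A 0 = 0
  · have h1 : B 1 - A 1 ≠ 0 := fun h1 => hAB (plane_ext (by linarith) (by linarith))
    apply mul_left_cancel₀ h1
    linear_combination (B 1 - A 1) * hA - a * hP + (P 1 - A 1) * (hB - hA)
  · apply mul_left_cancel₀ h0
    linear_combination (B 0 - A 0) * hA + b * hP + (P 0 - A 0) * (hB - hA)

theorem exists_line (A B : Plane) : ∃ h, IsLine h ∧ A ∈ h ∧ B ∈ h := by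
  by_cases hAB : A = B
  · subst hAB
    exact ⟨{P | P 0 = A 0}, isLine_iff.2 ⟨1, 0, -A 0, by simp, fun P => by
      simp only [Set.mem_ofPred_eq]; constructor <;> intro h <;> linarith⟩, rfl, rfl⟩
  · refine ⟨{P | collinearDet A B P = 0}, isLine_iff.2
      ⟨-(B 1 - A 1), B 0 - A 0, (B 1 - A 1) * A 0 - (B 0 - A 0) * A 1, ?_, fun P => ?_⟩, ?_, ?_⟩
    · by_contra! h
      exact hAB (plane_ext (by linarith [h.2]) (by linarith [h.1]))
    · simp only [Set.mem_ofPred_eq, collinearDet]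
      constructor <;> intro h <;> linarith
    · simp [collinearDet]
    · simp [collinearDet]; ring

theorem IsLine.eq_of_mem {h k : Set Plane} (hh : IsLine h) (hk : IsLine k) {A B : Plane}
    (hAB : A ≠ B) (hA : A ∈ h) (hB : B ∈ h) (hA' : A ∈ k) (hB' : B ∈ k) : h = k := by
  ext P
  exact ⟨fun hP => hk.mem_of_collinearDet hAB hA' hB' (hh.collinearDet_eq_zero hA hB hP),
    fun hP => hh.mem_of_collinearDet hAB hA hB (hk.collinearDet_eq_zero hA' hB' hP)⟩

theorem IsLine.point_eq {h k : Set Plane} (hh : IsLine h) (hk : IsLine k) (hhk : h ≠ k)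
    {A B : Plane} (hA : A ∈ h) (hB : B ∈ h) (hA' : A ∈ k) (hB' : B ∈ k) : A = B := by
  by_contra hAB
  exact hhk (hh.eq_of_mem hk hAB hA hB hA' hB')

theorem IsLine.infinite {h : Set Plane} (hh : IsLine h) : h.Infinite := by
  obtain ⟨a, b, c, hab, H⟩ := isLine_iff.1 hh
  have hs : a ^ 2 + b ^ 2 ≠ 0 := by
    rcases hab with h | h
    · have := sq_pos_of_ne_zero h; positivity
    · have := sq_pos_of_ne_zero h; positivity
  have hf : Function.Injective (fun t : ℝ =>
      (![-(a * c) / (a ^ 2 + b ^ 2) - b * t, -(b * c) / (a ^ 2 + b ^ 2) + a * t] : Plane)) := by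
    intro s t hst
    have h0 := congrFun hst 0
    have h1 := congrFun hst 1
    simp only [Matrix.cons_val_zero, Matrix.cons_val_one] at h0 h1
    rcases hab with h | h
    · exact mul_left_cancel₀ h (by linarith)
    · exact mul_left_cancel₀ h (by linarith)
  refine (Set.infinite_range_of_injective hf).mono ?_
  rintro _ ⟨t, rfl⟩
  rw [H]
  simp only [Matrix.cons_val_zero, Matrix.cons_val_one]
  field_simp
  ring

/-- A polynomial of degree at most `k` with more than `k` zeros on a line is divisible by the
equation of that line. -/
theorem exists_eq_mul_of_zeros {h : Set Plane} (hh : IsLine h) :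
    ∃ L : Poly, L.totalDegree = 1 ∧ zeroSet L = h ∧ ∀ (k : ℕ) (p : Poly) (T : Finset Plane),
      p.totalDegree ≤ k + 1 → (∀ A ∈ T, A ∈ h ∧ eval A p = 0) → k + 1 < T.card →
        ∃ q : Poly, p = L * q ∧ q.totalDegree ≤ k := by
  obtain ⟨a, b, c, hab, H⟩ := isLine_iff.1 hh
  have hs : a ^ 2 + b ^ 2 ≠ 0 := by
    rcases hab with h | h
    · have := sq_pos_of_ne_zero h; positivity
    · have := sq_pos_of_ne_zero h; positivity
  refine ⟨affinePoly a b c, totalDegree_affinePoly hab, by ext A; simp [zeroSet, H], ?_⟩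
  intro k p T hp hT hcard
  set L := affinePoly a b c with hL
  -- The parametrisation of the line whose parameter is the value of b x - a y.
  let ψ : Fin 2 → Polynomial ℝ :=
    ![Polynomial.C (-(a * c) / (a ^ 2 + b ^ 2)) + Polynomial.C (b / (a ^ 2 + b ^ 2)) * Polynomial.X,
      Polynomial.C (-(b * c) / (a ^ 2 + b ^ 2)) - Polynomial.C (a / (a ^ 2 + b ^ 2)) * Polynomial.X]
  have hψdeg : ∀ i, (ψ i).natDegree ≤ 1 := by
    intro i
    fin_cases i <;> simp only [ψ] <;> dsimp <;> compute_degree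
  have hPdeg : (aeval ψ p).natDegree ≤ k + 1 :=
    (aeval_natDegree_le p hp ψ hψdeg).trans (by simp)
  have hPzero : aeval ψ p = 0 := by
    have hinj : Set.InjOn (fun A : Plane => b * A 0 - a * A 1) T := by
      intro A hA B hB hAB
      have h1 := (H A).1 (hT A hA).1
      have h2 := (H B).1 (hT B hB).1
      simp only at hAB
      apply plane_ext <;> apply mul_left_cancel₀ hs
      · linear_combination a * (h1 - h2) + b * hAB
      · linear_combination b * (h1 - h2) - a * hAB
    by_contra hne
    have hsub : T.image (fun A : Plane => b * A 0 - a * A 1) ⊆ (aeval ψ p).roots.toFinset := by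
      intro t ht
      obtain ⟨A, hA, rfl⟩ := Finset.mem_image.1 ht
      rw [Multiset.mem_toFinset, Polynomial.mem_roots hne, Polynomial.IsRoot.def]
      have h1 := (H A).1 (hT A hA).1
      rw [← (hT A hA).2, ← Polynomial.coe_evalRingHom, aeval_def, hom_eval₂]
      have : ((Polynomial.evalRingHom (b * A 0 - a * A 1)).comp
          (algebraMap ℝ (Polynomial ℝ))) = RingHom.id ℝ := by ext; simp
      rw [this, eval₂_id]
      have hpt : (⇑(Polynomial.evalRingHom (b * A 0 - a * A 1)) ∘ ψ) = A := by
        apply plane_ext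
        · simp [ψ]
          field_simp
          linear_combination (-a) * h1
        · simp [ψ]
          field_simp
          linear_combination (-b) * h1
      simp only [Function.comp_def] at hpt ⊢
      rw [hpt]
    have h1 := Finset.card_le_card hsub
    rw [Finset.card_image_of_injOn hinj] at h1
    have h2 := (aeval ψ p).roots.toFinset_card_le
    have h3 := (aeval ψ p).card_roots'
    omega
  have hdvd : L ∣ p := by
    -- Modulo L each coordinate is its parametrisation evaluated at b x - a y, so p is congruent to
    -- its restriction to the line, which is zero.
    have key : ∀ i, (Ideal.Quotient.mk (Ideal.span {L})) (X i) =
        (Ideal.Quotient.mk (Ideal.span {L})) (Polynomial.aeval (C b * X 0 - C a * X 1 : Poly) (ψ i)) := by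
      intro i
      rw [Ideal.Quotient.eq, Ideal.mem_span_singleton]
      fin_cases i
      · refine ⟨C (a / (a ^ 2 + b ^ 2)), ?_⟩
        apply MvPolynomial.funext
        intro A
        simp [ψ, hL, algebraMap_eq]
        field_simp
        ring
      · refine ⟨C (b / (a ^ 2 + b ^ 2)), ?_⟩
        apply MvPolynomial.funext
        intro A
        simp [ψ, hL, algebraMap_eq]
        field_simp
        ring
    have h1 : ((Ideal.Quotient.mkₐ ℝ (Ideal.span {L})) : Poly →ₐ[ℝ] _) =
        (((Ideal.Quotient.mkₐ ℝ (Ideal.span {L})).comp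
          (Polynomial.aeval (C b * X 0 - C a * X 1 : Poly))).comp (aeval ψ)) := by
      apply algHom_ext
      intro i
      simpa using key i
    have h2 := DFunLike.congr_fun h1 p
    simp only [AlgHom.comp_apply, hPzero, map_zero] at h2
    rwa [Ideal.Quotient.mkₐ_eq_mk, Ideal.Quotient.eq_zero_iff_mem, Ideal.mem_span_singleton] at h2
  obtain ⟨q, hq⟩ := hdvd
  refine ⟨q, hq, ?_⟩
  by_cases hq0 : q = 0
  · simp [hq0]
  have hL0 : L ≠ 0 := fun h => by
    have := totalDegree_affinePoly (c := c) hab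
    rw [← hL, h] at this
    simp at this
  have := totalDegree_mul_of_isDomain hL0 hq0
  rw [← hq, hL, totalDegree_affinePoly hab] at this
  omega

end GCSets

/-! ### Covers by lines and the removal of maximal lines. -/

namespace GCSets

open scoped Classical

/-- The nodes of `X` on `h`. -/
noncomputable def nodesOn (X : Finset Plane) (h : Set Plane) : Finset Plane := X.filter (· ∈ h)

/-- The nodes of `X` off `h`. -/
noncomputable def nodesOff (X : Finset Plane) (h : Set Plane) : Finset Plane := X.filter (· ∉ h)

@[simp] theorem mem_nodesOn {X : Finset Plane} {h : Set Plane} {A : Plane} :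
    A ∈ nodesOn X h ↔ A ∈ X ∧ A ∈ h := by simp [nodesOn]

@[simp] theorem mem_nodesOff {X : Finset Plane} {h : Set Plane} {A : Plane} :
    A ∈ nodesOff X h ↔ A ∈ X ∧ A ∉ h := by simp [nodesOff]

theorem card_nodesOn_add_card_nodesOff (X : Finset Plane) (h : Set Plane) :
    (nodesOn X h).card + (nodesOff X h).card = X.card :=
  Finset.card_filter_add_card_filter_not _

/-- By pigeonhole two of the points share a line of the family, which is then h. -/
theorem mem_of_card_lt {S : Finset (Set Plane)} {T : Finset Plane} {h : Set Plane}
    (hS : ∀ k ∈ S, IsLine k) (hh : IsLine h) (hT : ∀ A ∈ T, A ∈ h)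
    (hc : ∀ A ∈ T, ∃ k ∈ S, A ∈ k) (hlt : S.card < T.card) : h ∈ S := by
  choose! g hg using hc
  obtain ⟨A, hA, B, hB, hAB, hgg⟩ :=
    Finset.exists_ne_map_eq_of_card_lt_of_maps_to hlt (fun A hA => (hg A hA).1)
  have := hh.eq_of_mem (hS _ (hg A hA).1) hAB (hT A hA) (hT B hB) (hg A hA).2
    (hgg ▸ (hg B hB).2)
  exact this ▸ (hg A hA).1

theorem card_inter_le_one {S : Finset Plane} {h k : Set Plane} (hh : IsLine h) (hk : IsLine k)
    (hhk : h ≠ k) (h1 : ∀ A ∈ S, A ∈ h) (h2 : ∀ A ∈ S, A ∈ k) : S.card ≤ 1 :=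
  Finset.card_le_one.2 fun A hA B hB => hh.point_eq hk hhk (h1 A hA) (h1 B hB) (h2 A hA) (h2 B hB)

/-- A family of lines that covers at least as many points of another line `m` meets these points
bijectively. -/
theorem exists_matching {S : Finset (Set Plane)} {T : Finset Plane} {m : Set Plane}
    (hS : ∀ k ∈ S, IsLine k) (hm : IsLine m) (hT : ∀ A ∈ T, A ∈ m) (hmS : m ∉ S)
    (hc : ∀ A ∈ T, ∃ k ∈ S, A ∈ k) (hcard : S.card ≤ T.card) :
    ∃ f : Set Plane → Plane, (∀ k ∈ S, f k ∈ T ∧ f k ∈ k) ∧ Set.InjOn f S ∧ S.image f = T ∧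
      ∀ k ∈ S, ∀ A ∈ T, A ∈ k → A = f k := by
  choose! g hg using hc
  have hginj : Set.InjOn g T := by
    intro A hA B hB hAB
    refine hm.point_eq (hS _ (hg A hA).1) ?_ (hT A hA) (hT B hB) (hg A hA).2 (hAB ▸ (hg B hB).2)
    rintro rfl
    exact hmS (hg A hA).1
  have himg : T.image g = S := by
    apply Finset.eq_of_subset_of_card_le
    · intro k hk
      obtain ⟨A, hA, rfl⟩ := Finset.mem_image.1 hk
      exact (hg A hA).1
    · rwa [Finset.card_image_of_injOn hginj]
  have hsurj : ∀ k ∈ S, ∃ A ∈ T, g A = k := fun k hk => by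
    rw [← himg] at hk
    simpa using hk
  choose! f hf using hsurj
  have hmem : ∀ k ∈ S, f k ∈ T ∧ f k ∈ k := fun k hk =>
    ⟨(hf k hk).1, by have := (hg _ (hf k hk).1).2; rwa [(hf k hk).2] at this⟩
  have huniq : ∀ k ∈ S, ∀ A ∈ T, A ∈ k → A = f k := fun k hk A hA hAk =>
    hm.point_eq (hS k hk) (fun h => hmS (h ▸ hk)) (hT A hA) (hT _ (hmem k hk).1) hAk (hmem k hk).2
  refine ⟨f, hmem, ?_, ?_, huniq⟩
  · intro k hk k' hk' hkk
    rw [← (hf k hk).2, ← (hf k' hk').2, hkk]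
  · ext A
    simp only [Finset.mem_image]
    constructor
    · rintro ⟨k, hk, rfl⟩
      exact (hmem k hk).1
    · intro hA
      exact ⟨g A, (hg A hA).1, (huniq _ (hg A hA).1 A hA (hg A hA).2).symm⟩

/-- `S` is a family of at most `n` lines, none through `A`, covering all other points of `X`. -/
structure IsCover (n : ℕ) (X : Finset Plane) (A : Plane) (S : Finset (Set Plane)) : Prop where
  card_le : S.card ≤ n
  isLine : ∀ h ∈ S, IsLine h
  notMem : ∀ h ∈ S, A ∉ h
  covers : ∀ B ∈ X, B ≠ A → ∃ h ∈ S, B ∈ h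

/-- The incidence-geometric content of the `GC_n` property. -/
structure LineGC (n : ℕ) (X : Finset Plane) : Prop where
  card_eq : 2 * X.card = (n + 1) * (n + 2)
  exists_cover : ∀ A ∈ X, ∃ S, IsCover n X A S

/-- A line through `n + 1` nodes. -/
def IsMax (n : ℕ) (X : Finset Plane) (h : Set Plane) : Prop :=
  IsLine h ∧ (nodesOn X h).card = n + 1

theorem IsCover.mem_of_lt {n : ℕ} {X : Finset Plane} {A : Plane} {S : Finset (Set Plane)}
    (hS : IsCover n X A S) {h : Set Plane} (hh : IsLine h)
    (hlt : n < ((nodesOn X h).erase A).card) : h ∈ S := by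
  refine mem_of_card_lt hS.isLine hh (T := (nodesOn X h).erase A) (fun B hB => ?_) (fun B hB => ?_)
    (lt_of_le_of_lt hS.card_le hlt)
  · simp at hB; exact hB.2.2
  · simp at hB; exact hS.covers B hB.2.1 hB.1

/-- A longer line would belong to the cover of each of its own nodes. -/
theorem LineGC.card_nodesOn_le {n : ℕ} {X : Finset Plane} (hX : LineGC n X) {h : Set Plane}
    (hh : IsLine h) : (nodesOn X h).card ≤ n + 1 := by
  by_contra! hc
  obtain ⟨A, hA⟩ : (nodesOn X h).Nonempty := Finset.card_pos.1 (by omega)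
  obtain ⟨S, hS⟩ := hX.exists_cover A (by simp at hA; exact hA.1)
  have hmem := hS.mem_of_lt hh (by rw [Finset.card_erase_of_mem hA]; omega)
  exact hS.notMem h hmem (by simp at hA; exact hA.2)

theorem IsMax.mem_cover {n : ℕ} {X : Finset Plane} {A : Plane} {S : Finset (Set Plane)}
    {M : Set Plane} (hM : IsMax n X M) (hS : IsCover n X A S) (hA : A ∉ M) : M ∈ S := by
  refine hS.mem_of_lt hM.1 ?_
  rw [Finset.erase_eq_of_notMem (by simp [hA]), hM.2]
  omega

theorem IsCover.remove {n : ℕ} {X : Finset Plane} {A : Plane} {S : Finset (Set Plane)}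
    (hS : IsCover (n + 1) X A S) {M : Set Plane} (hM : M ∈ S) :
    IsCover n (nodesOff X M) A (S.erase M) where
  card_le := by rw [Finset.card_erase_of_mem hM]; have := hS.card_le; omega
  isLine h hh := hS.isLine h (Finset.mem_of_mem_erase hh)
  notMem h hh := hS.notMem h (Finset.mem_of_mem_erase hh)
  covers B hB hBA := by
    simp only [mem_nodesOff] at hB
    obtain ⟨h, hh, hBh⟩ := hS.covers B hB.1 hBA
    exact ⟨h, Finset.mem_erase.2 ⟨fun e => hB.2 (e ▸ hBh), hh⟩, hBh⟩

/-- The cover of a node off M contains M, and dropping M from it covers what is left; n + 2 nodes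
disappear. -/
theorem LineGC.remove {n : ℕ} {X : Finset Plane} (hX : LineGC (n + 1) X) {M : Set Plane}
    (hM : IsMax (n + 1) X M) : LineGC n (nodesOff X M) where
  card_eq := by
    have h1 := card_nodesOn_add_card_nodesOff X M
    have h2 := hX.card_eq
    rw [hM.2] at h1
    nlinarith
  exists_cover A hA := by
    simp only [mem_nodesOff] at hA
    obtain ⟨S, hS⟩ := hX.exists_cover A hA.1
    exact ⟨_, hS.remove (hM.mem_cover hS hA.2)⟩

theorem nodesOn_nodesOff_of_disjoint {X : Finset Plane} {h k : Set Plane}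
    (hd : ∀ A ∈ X, A ∈ h → A ∉ k) : nodesOn (nodesOff X k) h = nodesOn X h := by
  ext A
  simp only [mem_nodesOn, mem_nodesOff]
  exact ⟨fun hA => ⟨hA.1.1, hA.2⟩, fun hA => ⟨⟨hA.1, hd A hA.1 hA.2⟩, hA.2⟩⟩

theorem nodesOn_nodesOff_of_mem {X : Finset Plane} {h k : Set Plane} (hh : IsLine h)
    (hk : IsLine k) (hhk : h ≠ k) {A : Plane} (hA : A ∈ h) (hAk : A ∈ k) :
    nodesOn (nodesOff X k) h = (nodesOn X h).erase A := by
  ext B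
  simp only [mem_nodesOn, mem_nodesOff, Finset.mem_erase]
  constructor
  · rintro ⟨⟨h1, h2⟩, h3⟩
    exact ⟨fun e => h2 (e ▸ hAk), h1, h3⟩
  · rintro ⟨h1, h2, h3⟩
    exact ⟨⟨h2, fun h4 => h1 (hh.point_eq hk hhk h3 hA h4 hAk)⟩, h3⟩

/-- Without a common node, h would keep its n + 2 nodes when k is deleted, one more than degree n
allows. -/
theorem LineGC.exists_mem_inter {n : ℕ} {X : Finset Plane} (hX : LineGC (n + 1) X)
    {h k : Set Plane} (hh : IsMax (n + 1) X h) (hk : IsMax (n + 1) X k) :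
    ∃ A ∈ X, A ∈ h ∧ A ∈ k := by
  by_contra! hd
  have h1 := (hX.remove hk).card_nodesOn_le hh.1
  rw [nodesOn_nodesOff_of_disjoint hd, hh.2] at h1
  omega

/-- Removing a maximal line turns another maximal line into a maximal line. -/
theorem LineGC.isMax_nodesOff {n : ℕ} {X : Finset Plane} (hX : LineGC (n + 1) X)
    {h k : Set Plane} (hh : IsMax (n + 1) X h) (hk : IsMax (n + 1) X k) (hhk : h ≠ k) :
    IsMax n (nodesOff X k) h := by
  obtain ⟨A, hA, hAh, hAk⟩ := hX.exists_mem_inter hh hk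
  refine ⟨hh.1, ?_⟩
  rw [nodesOn_nodesOff_of_mem hh.1 hk.1 hhk hAh hAk, Finset.card_erase_of_mem (by simp [hA, hAh]),
    hh.2]
  omega

/-- A maximal line of the remainder that meets the removed maximal line in a node is maximal. -/
theorem isMax_of_isMax_nodesOff {n : ℕ} {X : Finset Plane} {h k : Set Plane}
    (hk : IsLine k) (hh : IsMax n (nodesOff X k) h) (hhk : h ≠ k) {A : Plane} (hA : A ∈ X)
    (hAh : A ∈ h) (hAk : A ∈ k) : IsMax (n + 1) X h := by
  refine ⟨hh.1, ?_⟩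
  have := hh.2
  rw [nodesOn_nodesOff_of_mem hh.1 hk hhk hAh hAk,
    Finset.card_erase_of_mem (by simp [hA, hAh])] at this
  omega

theorem IsMax.ne_of_nodesOff {n : ℕ} {X : Finset Plane} {h k : Set Plane}
    (hh : IsMax n (nodesOff X k) h) : h ≠ k := by
  rintro rfl
  have := hh.2
  rw [show nodesOn (nodesOff X h) h = ∅ by ext; simp] at this
  simp at this

end GCSets

/-! ### Counting with covers; maximal lines in degrees two and three. -/

namespace GCSets

open scoped Classical

theorem IsCover.card_le_sum {n : ℕ} {X : Finset Plane} {A : Plane} {S : Finset (Set Plane)}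
    (hS : IsCover n X A S) : X.card ≤ ∑ h ∈ S, (nodesOn X h).card + 1 := by
  have hsub : X.erase A ⊆ S.biUnion (nodesOn X) := by
    intro B hB
    obtain ⟨hBA, hBX⟩ := Finset.mem_erase.1 hB
    obtain ⟨h, hh, hBh⟩ := hS.covers B hBX hBA
    exact Finset.mem_biUnion.2 ⟨h, hh, mem_nodesOn.2 ⟨hBX, hBh⟩⟩
  have h1 := (Finset.card_le_card hsub).trans Finset.card_biUnion_le
  have h2 := Finset.pred_card_le_card_erase (s := X) (a := A)
  omega

/-- Lines through A share no other point, so their further nodes are counted without repetition. -/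
theorem sum_card_pencil_le {X : Finset Plane} {A : Plane} {I : Finset (Set Plane)}
    (hI : ∀ h ∈ I, IsLine h ∧ A ∈ h) :
    ∑ h ∈ I, ((nodesOn X h).erase A).card = (I.biUnion fun h => (nodesOn X h).erase A).card ∧
    (I.biUnion fun h => (nodesOn X h).erase A) ⊆ X.erase A := by
  constructor
  · rw [Finset.card_biUnion]
    intro h hh k hk hhk
    rw [Function.onFun, Finset.disjoint_left]
    intro B hB hB'
    simp only [Finset.mem_erase, mem_nodesOn] at hB hB'
    exact hB.1 ((hI h hh).1.point_eq (hI k hk).1 hhk hB.2.2 (hI h hh).2 hB'.2.2 (hI k hk).2)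
  · intro B hB
    simp only [Finset.mem_biUnion, Finset.mem_erase, mem_nodesOn] at hB ⊢
    obtain ⟨h, -, h1, h2, -⟩ := hB
    exact ⟨h1, h2⟩

/-- A point off the common lines is determined by the two lines covering it, one from each family,
since distinct lines meet at most once. -/
theorem card_le_of_two_covers {S S' : Finset (Set Plane)} {T : Finset Plane}
    (hS : ∀ h ∈ S, IsLine h) (hS' : ∀ h ∈ S', IsLine h)
    (hc : ∀ A ∈ T, ∃ h ∈ S, A ∈ h) (hc' : ∀ A ∈ T, ∃ h ∈ S', A ∈ h) :
    T.card ≤ ((S ∩ S').biUnion (nodesOn T)).card + (S \ S').card * (S' \ S).card := by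
  set U := (S ∩ S').biUnion (nodesOn T) with hU
  have h2 : (T \ U).card ≤ (S \ S').card * (S' \ S).card := by
    rw [← Finset.card_product]
    choose! g hg using hc
    choose! g' hg' using hc'
    have hnot : ∀ A ∈ T \ U, ∀ h ∈ S, h ∈ S' → A ∉ h := by
      intro A hA h hh hh' hAh
      rw [Finset.mem_sdiff] at hA
      exact hA.2 (Finset.mem_biUnion.2 ⟨h, Finset.mem_inter.2 ⟨hh, hh'⟩, by simp [hA.1, hAh]⟩)
    refine Finset.card_le_card_of_injOn (fun A => (g A, g' A)) ?_ ?_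
    · intro A hA
      have hAT := (Finset.mem_sdiff.1 hA).1
      simp only [Finset.coe_product, Set.mem_prod, Finset.mem_coe, Finset.mem_sdiff]
      exact ⟨⟨(hg A hAT).1, fun h => hnot A hA _ (hg A hAT).1 h (hg A hAT).2⟩,
        (hg' A hAT).1, fun h => hnot A hA _ h (hg' A hAT).1 (hg' A hAT).2⟩
    · intro A hA B hB hAB
      have hAT := (Finset.mem_sdiff.1 hA).1
      have hBT := (Finset.mem_sdiff.1 hB).1
      simp only [Prod.mk.injEq] at hAB
      refine (hS _ (hg A hAT).1).point_eq (hS' _ (hg' A hAT).1) ?_ (hg A hAT).2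
        (hAB.1 ▸ (hg B hBT).2) (hg' A hAT).2 (hAB.2 ▸ (hg' B hBT).2)
      intro e
      exact hnot A hA _ (hg A hAT).1 (e ▸ (hg' A hAT).1) (hg A hAT).2
  have h3 : T.card ≤ U.card + (T \ U).card := by
    have := Finset.card_le_card (show T ⊆ U ∪ T \ U by intro A hA; by_cases A ∈ U <;> simp [*])
    exact this.trans (Finset.card_union_le _ _)
  omega

/-- Covers of two different nodes: the remaining nodes lie on the common lines, or are
intersection points of the other lines. -/
theorem IsCover.card_le_biUnion {n : ℕ} {X : Finset Plane} {A B : Plane}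
    {S S' : Finset (Set Plane)} (hS : IsCover n X A S) (hS' : IsCover n X B S') :
    X.card ≤ ((S ∩ S').biUnion (nodesOn X)).card +
      (n - (S ∩ S').card) * (n - (S ∩ S').card) + 2 := by
  have key := card_le_of_two_covers (T := (X.erase A).erase B) hS.isLine hS'.isLine
    (fun P hP => by simp at hP; exact hS.covers P hP.2.2 hP.2.1)
    (fun P hP => by simp at hP; exact hS'.covers P hP.2.2 hP.1)
  have h1 : ((S ∩ S').biUnion (nodesOn ((X.erase A).erase B))).card ≤
      ((S ∩ S').biUnion (nodesOn X)).card :=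
    Finset.card_le_card <| Finset.biUnion_mono fun h _ P hP => by
      simp at hP ⊢; exact ⟨hP.1.2.2, hP.2⟩
  have h2 : (S \ S').card ≤ n - (S ∩ S').card := by
    have := Finset.card_sdiff_add_card_inter S S'
    have := hS.card_le
    omega
  have h3 : (S' \ S).card ≤ n - (S ∩ S').card := by
    have := Finset.card_sdiff_add_card_inter S' S
    rw [Finset.inter_comm] at this
    have := hS'.card_le
    omega
  have h4 := Nat.mul_le_mul h2 h3
  have h5 := Finset.pred_card_le_card_erase (s := X) (a := A)
  have h6 := Finset.pred_card_le_card_erase (s := X.erase A) (a := B)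
  omega

theorem IsCover.card_le_of_ne {n : ℕ} {X : Finset Plane} {A B : Plane} {S S' : Finset (Set Plane)}
    (hS : IsCover n X A S) (hS' : IsCover n X B S') :
    X.card ≤ ∑ h ∈ S ∩ S', (nodesOn X h).card +
      (n - (S ∩ S').card) * (n - (S ∩ S').card) + 2 := by
  have h1 := hS.card_le_biUnion hS'
  have h2 : ((S ∩ S').biUnion (nodesOn X)).card ≤ ∑ h ∈ S ∩ S', (nodesOn X h).card :=
    Finset.card_biUnion_le
  omega

theorem IsCover.ne_of_ne {n : ℕ} {X : Finset Plane} {A B : Plane} {S S' : Finset (Set Plane)}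
    (hS : IsCover n X A S) (hS' : IsCover n X B S') (hA : A ∈ X) (hAB : A ≠ B) : S ≠ S' := by
  rintro rfl
  obtain ⟨h, hh, hAh⟩ := hS'.covers A hA hAB
  exact hS.notMem h hh hAh

theorem IsCover.card_inter_lt {n : ℕ} {X : Finset Plane} {A B : Plane} {S S' : Finset (Set Plane)}
    (hS : IsCover n X A S) (hS' : IsCover n X B S') (hA : A ∈ X) (hAB : A ≠ B) :
    (S ∩ S').card < n := by
  by_contra! hc
  apply hS.ne_of_ne hS' hA hAB
  rw [← Finset.eq_of_subset_of_card_le Finset.inter_subset_left (hS.card_le.trans hc)]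
  exact Finset.eq_of_subset_of_card_le Finset.inter_subset_right (hS'.card_le.trans hc)

/-- Two lines cover five nodes, so one of them has three. -/
theorem LineGC.exists_isMax_notMem {X : Finset Plane} (hX : LineGC 2 X) {A : Plane} (hA : A ∈ X) :
    ∃ h, IsMax 2 X h ∧ A ∉ h := by
  obtain ⟨S, hS⟩ := hX.exists_cover A hA
  by_contra! hc
  have h1 := hS.card_le_sum
  have h2 : ∀ h ∈ S, (nodesOn X h).card ≤ 2 := by
    intro h hh
    have h3 := hX.card_nodesOn_le (hS.isLine h hh)
    by_contra! h4
    exact hS.notMem h hh (hc h ⟨hS.isLine h hh, by omega⟩)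
  have h3 := Finset.sum_le_card_nsmul _ _ _ h2
  have := hX.card_eq
  have := hS.card_le
  simp only [smul_eq_mul] at h3
  omega

/-- Each new line is chosen to avoid a node of the earlier ones: first a node of h₁, then the common
node of h₁ and h₂. -/
theorem LineGC.exists_three_of_two {X : Finset Plane} (hX : LineGC 2 X) :
    ∃ h₁ h₂ h₃, IsMax 2 X h₁ ∧ IsMax 2 X h₂ ∧ IsMax 2 X h₃ ∧ h₁ ≠ h₂ ∧ h₁ ≠ h₃ ∧ h₂ ≠ h₃ := by
  obtain ⟨A, hA⟩ : X.Nonempty := Finset.card_pos.1 (by have := hX.card_eq; omega)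
  obtain ⟨h₁, H₁, -⟩ := hX.exists_isMax_notMem hA
  obtain ⟨B, hB⟩ : (nodesOn X h₁).Nonempty := Finset.card_pos.1 (by have := H₁.2; omega)
  simp only [mem_nodesOn] at hB
  obtain ⟨h₂, H₂, hB₂⟩ := hX.exists_isMax_notMem hB.1
  obtain ⟨C, hC, hC₁, hC₂⟩ := hX.exists_mem_inter H₁ H₂
  obtain ⟨h₃, H₃, hC₃⟩ := hX.exists_isMax_notMem hC
  exact ⟨h₁, h₂, h₃, H₁, H₂, H₃, fun e => hB₂ (e ▸ hB.2), fun e => hC₃ (e ▸ hC₁),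
    fun e => hC₃ (e ▸ hC₂)⟩

/-- Without four-node lines every line of a cover has exactly three nodes, and two covers share no
line, since 3k + (3 - k)² + 2 = 9 < 10 for k = 1, 2. The nine other nodes then provide nine
different lines through a fixed node A, with 18 nodes besides A. -/
theorem LineGC.exists_isMax_three {X : Finset Plane} (hX : LineGC 3 X) : ∃ h, IsMax 3 X h := by
  by_contra! hmax
  have hX10 : X.card = 10 := by have := hX.card_eq; omega
  have hle : ∀ h, IsLine h → (nodesOn X h).card ≤ 3 := fun h hh => by
    have h1 := hX.card_nodesOn_le hh
    have h2 : (nodesOn X h).card ≠ 4 := fun e => hmax h ⟨hh, e⟩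
    omega
  choose! c hc using hX.exists_cover
  have heq : ∀ B ∈ X, ∀ h ∈ c B, (nodesOn X h).card = 3 := by
    intro B hB h hh
    have h1 := (hc B hB).card_le_sum
    rw [← Finset.add_sum_erase _ _ hh] at h1
    have h2 := Finset.sum_le_card_nsmul ((c B).erase h) (fun h => (nodesOn X h).card) 3
      (fun k hk => hle k ((hc B hB).isLine k (Finset.mem_of_mem_erase hk)))
    rw [Finset.card_erase_of_mem hh] at h2
    have h3 := (hc B hB).card_le
    have h4 := hle h ((hc B hB).isLine h hh)
    simp only [smul_eq_mul] at h2
    omega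
  obtain ⟨A, hA⟩ : X.Nonempty := Finset.card_pos.1 (by omega)
  have hthrough : ∀ B ∈ X.erase A, ∃ h ∈ c B, A ∈ h := fun B hB => by
    simp at hB
    exact (hc B hB.2).covers A hA (Ne.symm hB.1)
  choose! g hg using hthrough
  have hinj : Set.InjOn g (X.erase A) := by
    intro B hB C hC hBC
    by_contra hne
    have hBX := Finset.mem_of_mem_erase hB
    have hCX := Finset.mem_of_mem_erase hC
    have h1 := (hc B hBX).card_le_of_ne (hc C hCX)
    have h2 := (hc B hBX).card_inter_lt (hc C hCX) hBX hne
    have h3 : 0 < (c B ∩ c C).card := Finset.card_pos.2 ⟨g B, Finset.mem_inter.2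
      ⟨(hg B hB).1, hBC ▸ (hg C hC).1⟩⟩
    have h4 := Finset.sum_le_card_nsmul (c B ∩ c C) (fun h => (nodesOn X h).card) 3
      (fun k hk => hle k ((hc B hBX).isLine k (Finset.mem_inter.1 hk).1))
    simp only [smul_eq_mul] at h4
    obtain h5 | h5 : (c B ∩ c C).card = 1 ∨ (c B ∩ c C).card = 2 := by omega
    all_goals rw [h5] at h1 h4; omega
  have hI : ∀ h ∈ (X.erase A).image g, IsLine h ∧ A ∈ h := by
    intro h hh
    obtain ⟨B, hB, rfl⟩ := Finset.mem_image.1 hh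
    exact ⟨(hc B (Finset.mem_of_mem_erase hB)).isLine _ (hg B hB).1, (hg B hB).2⟩
  obtain ⟨h1, h2⟩ := sum_card_pencil_le (X := X) hI
  have h3 := Finset.card_le_card h2
  rw [← h1, Finset.sum_image hinj] at h3
  have h4 : ∀ B ∈ X.erase A, ((nodesOn X (g B)).erase A).card = 2 := by
    intro B hB
    rw [Finset.card_erase_of_mem (by simp [hA, (hg B hB).2]),
      heq B (Finset.mem_of_mem_erase hB) _ (hg B hB).1]
  rw [Finset.sum_congr rfl h4, Finset.sum_const, Finset.card_erase_of_mem hA, hX10] at h3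
  simp at h3

/-- The cover of a node of a maximal line `M` does not contain a line that is maximal in the
remainder and misses the nodes of `M`. -/
theorem IsMax.notMem_cover {n : ℕ} {Y : Finset Plane} {M m : Set Plane}
    (hM : IsMax (n + 1) Y M) (hdis : ∀ A ∈ Y, A ∈ M → A ∉ m) {D : Plane} (hD : D ∈ Y)
    (hDM : D ∈ M) {S : Finset (Set Plane)} (hS : IsCover (n + 1) Y D S) : m ∉ S := by
  intro hm
  -- The lines other than m number at most n and still cover the n + 1 nodes of M other than D.
  have hM' : M ∈ S.erase m := by
    refine mem_of_card_lt (T := (nodesOn Y M).erase D)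
      (fun k hk => hS.isLine k (Finset.mem_of_mem_erase hk)) hM.1 (fun A hA => ?_) (fun A hA => ?_) ?_
    · simp at hA; exact hA.2.2
    · simp at hA
      obtain ⟨k, hk, hAk⟩ := hS.covers A hA.2.1 hA.1
      exact ⟨k, Finset.mem_erase.2 ⟨fun e => hdis A hA.2.1 hA.2.2 (e ▸ hAk), hk⟩, hAk⟩
    · rw [Finset.card_erase_of_mem hm, Finset.card_erase_of_mem (by simp [hD, hDM]), hM.2]
      have := hS.card_le
      omega
  exact hS.notMem M (Finset.mem_of_mem_erase hM') hDM

theorem IsMax.disjoint_of_not_isMax {n : ℕ} {Y : Finset Plane} {M m : Set Plane}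
    (hM : IsMax (n + 1) Y M) (hm : IsMax n (nodesOff Y M) m) (hnot : ¬ IsMax (n + 1) Y m) :
    ∀ A ∈ Y, A ∈ M → A ∉ m := fun _ hA hAM hAm =>
  hnot (isMax_of_isMax_nodesOff hM.1 hm hm.ne_of_nodesOff hA hAm hAM)

end GCSets

/-! ### Three maximal lines in degree three. -/

namespace GCSets

open scoped Classical

/-- The line m has n + 1 nodes and is not in the cover, so the at most n + 1 lines of the cover meet
these nodes one by one. -/
theorem IsMax.exists_matching_of_disjoint {n : ℕ} {Y : Finset Plane} {M m : Set Plane}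
    (hM : IsMax (n + 1) Y M) (hm : IsMax n (nodesOff Y M) m) (hdis : ∀ A ∈ Y, A ∈ M → A ∉ m)
    {D : Plane} (hD : D ∈ Y) (hDM : D ∈ M) {S : Finset (Set Plane)} (hS : IsCover (n + 1) Y D S) :
    ∃ f : Set Plane → Plane, (∀ k ∈ S, f k ∈ nodesOn Y m ∧ f k ∈ k) ∧ Set.InjOn f S ∧
      S.image f = nodesOn Y m ∧ ∀ k ∈ S, ∀ A ∈ nodesOn Y m, A ∈ k → A = f k := by
  refine exists_matching hS.isLine hm.1 (fun A hA => (mem_nodesOn.1 hA).2)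
    (hM.notMem_cover hdis hD hDM hS) (fun A hA => ?_) ?_
  · rw [mem_nodesOn] at hA
    exact hS.covers A hA.1 fun e => hdis D hD hDM (e ▸ hA.2)
  · rw [← nodesOn_nodesOff_of_disjoint (fun A hA h1 h2 => hdis A hA h2 h1), hm.2]
    exact hS.card_le

theorem IsMax.exists_matching_self {n : ℕ} {Y : Finset Plane} {M : Set Plane}
    (hM : IsMax (n + 1) Y M) {D : Plane} (hD : D ∈ Y) (hDM : D ∈ M) {S : Finset (Set Plane)}
    (hS : IsCover (n + 1) Y D S) :
    ∃ f : Set Plane → Plane, (∀ k ∈ S, f k ∈ (nodesOn Y M).erase D ∧ f k ∈ k) ∧ Set.InjOn f S ∧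
      S.image f = (nodesOn Y M).erase D ∧
      ∀ k ∈ S, ∀ A ∈ (nodesOn Y M).erase D, A ∈ k → A = f k := by
  refine exists_matching hS.isLine hM.1 (fun A hA => (mem_nodesOn.1 (Finset.mem_of_mem_erase hA)).2)
    (fun h => hS.notMem M h hDM) (fun A hA => ?_) ?_
  · simp at hA
    exact hS.covers A hA.2.1 hA.1
  · rw [Finset.card_erase_of_mem (by simp [hD, hDM]), hM.2]
    exact hS.card_le

/-- The cover of a node of M consists of a line through the common node Q of m₁ and m₂ and of two
lines that join the other nodes of m₁ to those of m₂, in one of two pairings. A pairing occurs for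
at most two of the four nodes of M, since its lines pass through two of them. A pairing that misses
the sixth node R of the remainder occurs at most once, because R then fixes the line through Q. One
of the pairings misses R, and 1 + 2 < 4. -/
theorem LineGC.not_two_disjoint_three {Y : Finset Plane} (hY : LineGC 3 Y) {M m₁ m₂ : Set Plane}
    (hM : IsMax 3 Y M) (h₁ : IsMax 2 (nodesOff Y M) m₁) (h₂ : IsMax 2 (nodesOff Y M) m₂)
    (hne : m₁ ≠ m₂) (hn₁ : ¬ IsMax 3 Y m₁) (hn₂ : ¬ IsMax 3 Y m₂) : False := by
  have hd₁ := hM.disjoint_of_not_isMax h₁ hn₁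
  have hd₂ := hM.disjoint_of_not_isMax h₂ hn₂
  have c₁ := h₁.2
  have c₂ := h₂.2
  rw [nodesOn_nodesOff_of_disjoint (fun A hA a b => hd₁ A hA b a)] at c₁
  rw [nodesOn_nodesOff_of_disjoint (fun A hA a b => hd₂ A hA b a)] at c₂
  obtain ⟨Q, hQ, hQ₁, hQ₂⟩ := (hY.remove hM).exists_mem_inter h₁ h₂
  rw [mem_nodesOff] at hQ
  choose! c hc using hY.exists_cover
  -- the sixth node of the remainder
  obtain ⟨R, hRY, hRM, hR₁, hR₂⟩ : ∃ R ∈ Y, R ∉ M ∧ R ∉ m₁ ∧ R ∉ m₂ := by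
    by_contra! hcon
    have hsub : nodesOff Y M ⊆ nodesOn Y m₁ ∪ (nodesOn Y m₂).erase Q := by
      intro P hP
      simp only [mem_nodesOff, Finset.mem_union, mem_nodesOn, Finset.mem_erase] at hP ⊢
      by_cases hP₁ : P ∈ m₁
      · exact Or.inl ⟨hP.1, hP₁⟩
      · exact Or.inr ⟨fun e => hP₁ (e ▸ hQ₁), hP.1, hcon P hP.1 hP.2 hP₁⟩
    have h3 := (Finset.card_le_card hsub).trans (Finset.card_union_le _ _)
    rw [Finset.card_erase_of_mem (by simp [hQ.1, hQ₂]), c₁, c₂] at h3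
    have := (hY.remove hM).card_eq
    omega
  obtain ⟨x₁, x₂, hx, hxe⟩ := Finset.card_eq_two.1
    (show ((nodesOn Y m₁).erase Q).card = 2 by
      rw [Finset.card_erase_of_mem (by simp [hQ.1, hQ₁]), c₁])
  obtain ⟨y₁, y₂, hy, hye⟩ := Finset.card_eq_two.1
    (show ((nodesOn Y m₂).erase Q).card = 2 by
      rw [Finset.card_erase_of_mem (by simp [hQ.1, hQ₂]), c₂])
  have mx : ∀ P, P ∈ Y → P ∈ m₁ → P = Q ∨ P = x₁ ∨ P = x₂ := by
    intro P hP hPm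
    by_cases e : P = Q
    · exact Or.inl e
    · have : P ∈ (nodesOn Y m₁).erase Q := by simp [hP, hPm, e]
      rw [hxe] at this
      simpa [e] using this
  have my : ∀ P, P ∈ Y → P ∈ m₂ → P = Q ∨ P = y₁ ∨ P = y₂ := by
    intro P hP hPm
    by_cases e : P = Q
    · exact Or.inl e
    · have : P ∈ (nodesOn Y m₂).erase Q := by simp [hP, hPm, e]
      rw [hye] at this
      simpa [e] using this
  have hx₁ : x₁ ≠ Q ∧ x₁ ∈ Y ∧ x₁ ∈ m₁ := by
    have : x₁ ∈ (nodesOn Y m₁).erase Q := by rw [hxe]; simp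
    simpa using this
  have hx₂ : x₂ ≠ Q ∧ x₂ ∈ Y ∧ x₂ ∈ m₁ := by
    have : x₂ ∈ (nodesOn Y m₁).erase Q := by rw [hxe]; simp
    simpa using this
  have hy₁ : y₁ ≠ Q ∧ y₁ ∈ Y ∧ y₁ ∈ m₂ := by
    have : y₁ ∈ (nodesOn Y m₂).erase Q := by rw [hye]; simp
    simpa using this
  have hy₂ : y₂ ≠ Q ∧ y₂ ∈ Y ∧ y₂ ∈ m₂ := by
    have : y₂ ∈ (nodesOn Y m₂).erase Q := by rw [hye]; simp
    simpa using this
  obtain ⟨k₁₁, l₁₁, a₁₁, b₁₁⟩ := exists_line x₁ y₁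
  obtain ⟨k₂₂, l₂₂, a₂₂, b₂₂⟩ := exists_line x₂ y₂
  obtain ⟨k₁₂, l₁₂, a₁₂, b₁₂⟩ := exists_line x₁ y₂
  obtain ⟨k₂₁, l₂₁, a₂₁, b₂₁⟩ := exists_line x₂ y₁
  have hxy : ∀ x y, x ∈ m₁ → y ∈ m₂ → y ≠ Q → x ≠ y := by
    rintro x y hx hy hyQ rfl
    exact hyQ (h₁.1.point_eq h₂.1 hne hx hQ₁ hy hQ₂)
  -- every cover joins the remaining nodes of the two lines in one of the two ways
  have hform : ∀ D ∈ nodesOn Y M, ∃ h₀, h₀ ∈ c D ∧ Q ∈ h₀ ∧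
      ((k₁₁ ≠ k₂₂ ∧ c D = {h₀, k₁₁, k₂₂}) ∨ (k₁₂ ≠ k₂₁ ∧ c D = {h₀, k₁₂, k₂₁})) := by
    intro D hD
    rw [mem_nodesOn] at hD
    have hcD := hc D hD.1
    obtain ⟨f₁, F₁, I₁, -, u₁⟩ := hM.exists_matching_of_disjoint h₁ hd₁ hD.1 hD.2 hcD
    obtain ⟨f₂, F₂, I₂, -, u₂⟩ := hM.exists_matching_of_disjoint h₂ hd₂ hD.1 hD.2 hcD
    have ne : ∀ P ∈ Y, P ∈ m₁ ∨ P ∈ m₂ → P ≠ D := by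
      rintro P hP (h | h) rfl
      · exact hd₁ _ hP hD.2 h
      · exact hd₂ _ hP hD.2 h
    obtain ⟨g₀, hg₀, Qg₀⟩ := hcD.covers Q hQ.1 (ne Q hQ.1 (Or.inl hQ₁))
    obtain ⟨g₁, hg₁, xg₁⟩ := hcD.covers x₁ hx₁.2.1 (ne _ hx₁.2.1 (Or.inl hx₁.2.2))
    obtain ⟨g₂, hg₂, xg₂⟩ := hcD.covers x₂ hx₂.2.1 (ne _ hx₂.2.1 (Or.inl hx₂.2.2))
    have e₀ : Q = f₁ g₀ := u₁ _ hg₀ Q (by simp [hQ.1, hQ₁]) Qg₀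
    have e₁ : x₁ = f₁ g₁ := u₁ _ hg₁ x₁ (by simp [hx₁]) xg₁
    have e₂ : x₂ = f₁ g₂ := u₁ _ hg₂ x₂ (by simp [hx₂]) xg₂
    have n01 : g₀ ≠ g₁ := fun e => hx₁.1 (by rw [e₁, e₀, e])
    have n02 : g₀ ≠ g₂ := fun e => hx₂.1 (by rw [e₂, e₀, e])
    have n12 : g₁ ≠ g₂ := fun e => hx (by rw [e₁, e₂, e])
    have hset : c D = {g₀, g₁, g₂} := by
      symm
      apply Finset.eq_of_subset_of_card_le
      · intro k hk
        simp only [Finset.mem_insert, Finset.mem_singleton] at hk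
        rcases hk with rfl | rfl | rfl <;> assumption
      · rw [Finset.card_eq_three.2 ⟨_, _, _, n01, n02, n12, rfl⟩]
        exact hcD.card_le
    have q₀ : Q = f₂ g₀ := u₂ _ hg₀ Q (by simp [hQ.1, hQ₂]) Qg₀
    have m1 := F₂ g₁ hg₁
    have m2 := F₂ g₂ hg₂
    simp only [mem_nodesOn] at m1 m2
    have r1 := (my _ m1.1.1 m1.1.2).resolve_left fun e => n01 (I₂ hg₀ hg₁ (by rw [← q₀, e]))
    have r2 := (my _ m2.1.1 m2.1.2).resolve_left fun e => n02 (I₂ hg₀ hg₂ (by rw [← q₀, e]))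
    have r12 : f₂ g₁ ≠ f₂ g₂ := fun e => n12 (I₂ hg₁ hg₂ e)
    refine ⟨g₀, hg₀, Qg₀, ?_⟩
    rcases r1 with r1 | r1 <;> rcases r2 with r2 | r2
    · exact absurd (r1.trans r2.symm) r12
    · left
      have E1 : g₁ = k₁₁ := (hcD.isLine _ hg₁).eq_of_mem l₁₁ (hxy _ _ hx₁.2.2 hy₁.2.2 hy₁.1)
        xg₁ (r1 ▸ m1.2) a₁₁ b₁₁
      have E2 : g₂ = k₂₂ := (hcD.isLine _ hg₂).eq_of_mem l₂₂ (hxy _ _ hx₂.2.2 hy₂.2.2 hy₂.1)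
        xg₂ (r2 ▸ m2.2) a₂₂ b₂₂
      subst E1 E2
      exact ⟨n12, hset⟩
    · right
      have E1 : g₁ = k₁₂ := (hcD.isLine _ hg₁).eq_of_mem l₁₂ (hxy _ _ hx₁.2.2 hy₂.2.2 hy₂.1)
        xg₁ (r1 ▸ m1.2) a₁₂ b₁₂
      have E2 : g₂ = k₂₁ := (hcD.isLine _ hg₂).eq_of_mem l₂₁ (hxy _ _ hx₂.2.2 hy₁.2.2 hy₁.1)
        xg₂ (r2 ▸ m2.2) a₂₁ b₂₁
      subst E1 E2
      exact ⟨n12, hset⟩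
    · exact absurd (r1.trans r2.symm) r12
  have cM : (nodesOn Y M).card = 4 := hM.2
  -- a pair of lines occurs in at most two covers
  have htwo : ∀ k k' : Set Plane, k ≠ k' →
      ((nodesOn Y M).filter fun D => k ∈ c D ∧ k' ∈ c D).card ≤ 2 := by
    intro k k' hkk
    by_contra! hcon
    obtain ⟨D, hD⟩ : ((nodesOn Y M).filter fun D => k ∈ c D ∧ k' ∈ c D).Nonempty :=
      Finset.card_pos.1 (by omega)
    simp only [Finset.mem_filter, mem_nodesOn] at hD
    obtain ⟨f, F, I, -, -⟩ := hM.exists_matching_self hD.1.1 hD.1.2 (hc D hD.1.1)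
    have hf : f k ≠ f k' := fun e => hkk (I hD.2.1 hD.2.2 e)
    have A1 := F k hD.2.1
    have A2 := F k' hD.2.2
    simp only [Finset.mem_erase, mem_nodesOn] at A1 A2
    have hsub : ((nodesOn Y M).filter fun D => k ∈ c D ∧ k' ∈ c D) ⊆
        ((nodesOn Y M).erase (f k)).erase (f k') := by
      intro D' hD'
      simp only [Finset.mem_filter, mem_nodesOn, Finset.mem_erase] at hD' ⊢
      refine ⟨?_, ?_, hD'.1⟩
      · rintro rfl
        exact (hc _ hD'.1.1).notMem _ hD'.2.2 A2.2
      · rintro rfl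
        exact (hc _ hD'.1.1).notMem _ hD'.2.1 A1.2
    have := Finset.card_le_card hsub
    rw [Finset.card_erase_of_mem (by simp [A2.1.2, hf.symm]),
      Finset.card_erase_of_mem (by simp [A1.1.2])] at this
    omega
  have hRQ : R ≠ Q := fun e => hR₁ (e ▸ hQ₁)
  -- a pair of lines missing the sixth node occurs in at most one cover
  have hone : ∀ k k' : Set Plane, R ∉ k → R ∉ k' →
      ((nodesOn Y M).filter fun D => ∃ h₀, h₀ ∈ c D ∧ Q ∈ h₀ ∧ c D = {h₀, k, k'}).card ≤ 1 := by
    intro k k' hk hk'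
    rw [Finset.card_le_one]
    intro D hD D' hD'
    simp only [Finset.mem_filter, mem_nodesOn] at hD hD'
    obtain ⟨⟨hDY, hDM⟩, g, hg, Qg, eg⟩ := hD
    obtain ⟨⟨hDY', hDM'⟩, g', hg', Qg', eg'⟩ := hD'
    by_contra hDD
    have key : ∀ D g, D ∈ Y → D ∈ M → c D = {g, k, k'} → R ∈ g := by
      intro D g hDY hDM eg
      obtain ⟨h, hh, Rh⟩ := (hc D hDY).covers R hRY (fun e => hRM (e ▸ hDM))
      rw [eg] at hh
      simp only [Finset.mem_insert, Finset.mem_singleton] at hh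
      rcases hh with rfl | rfl | rfl
      · exact Rh
      · exact absurd Rh hk
      · exact absurd Rh hk'
    have E : g = g' := ((hc D hDY).isLine g hg).eq_of_mem ((hc D' hDY').isLine g' hg') hRQ
      (key D g hDY hDM eg) Qg (key D' g' hDY' hDM' eg') Qg'
    exact (hc D hDY).ne_of_ne (hc D' hDY') hDY hDD (by rw [eg, eg', E])
  have hfinal : ∀ k k' l l' : Set Plane, R ∉ k → R ∉ k' →
      (∀ D ∈ nodesOn Y M, ∃ h₀, h₀ ∈ c D ∧ Q ∈ h₀ ∧
        (c D = {h₀, k, k'} ∨ (l ≠ l' ∧ c D = {h₀, l, l'}))) → False := by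
    intro k k' l l' hk hk' hall
    have h1 := hone k k' hk hk'
    by_cases hll : l = l'
    · have hsub : nodesOn Y M ⊆
          ((nodesOn Y M).filter fun D => ∃ h₀, h₀ ∈ c D ∧ Q ∈ h₀ ∧ c D = {h₀, k, k'}) := by
        intro D hD
        obtain ⟨h₀, a, b, e⟩ := hall D hD
        rcases e with e | e
        · exact Finset.mem_filter.2 ⟨hD, h₀, a, b, e⟩
        · exact absurd hll e.1
      have := Finset.card_le_card hsub
      omega
    · have hsub : nodesOn Y M ⊆
          ((nodesOn Y M).filter fun D => ∃ h₀, h₀ ∈ c D ∧ Q ∈ h₀ ∧ c D = {h₀, k, k'}) ∪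
          ((nodesOn Y M).filter fun D => l ∈ c D ∧ l' ∈ c D) := by
        intro D hD
        obtain ⟨h₀, a, b, e⟩ := hall D hD
        rcases e with e | e
        · exact Finset.mem_union_left _ (Finset.mem_filter.2 ⟨hD, h₀, a, b, e⟩)
        · exact Finset.mem_union_right _ (Finset.mem_filter.2 ⟨hD, by simp [e.2]⟩)
      have := (Finset.card_le_card hsub).trans (Finset.card_union_le _ _)
      have := htwo l l' hll
      omega
  have hRx : ∀ x, x ∈ m₁ → R ≠ x := fun x hx e => hR₁ (e ▸ hx)
  have hRy : ∀ y, y ∈ m₂ → R ≠ y := fun y hy e => hR₂ (e ▸ hy)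
  -- a line joining `x₁` or `x₂` to `y₁` meets a line joining it to `y₂` only there
  have hns : ∀ k k' P, IsLine k → IsLine k' → P ∈ k → P ∈ k' → R ≠ P → R ∈ k → R ∈ k' → k = k' :=
    fun k k' P hk hk' a b hRP a' b' => hk.eq_of_mem hk' hRP a' a b' b
  have q1 : k₁₁ ≠ k₁₂ := fun e => by
    have : k₁₁ = m₂ := l₁₁.eq_of_mem h₂.1 hy b₁₁ (e ▸ b₁₂) hy₁.2.2 hy₂.2.2
    exact hxy x₁ x₁ hx₁.2.2 (this ▸ a₁₁) hx₁.1 rfl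
  have q2 : k₂₂ ≠ k₂₁ := fun e => by
    have : k₂₂ = m₂ := l₂₂.eq_of_mem h₂.1 hy (e ▸ b₂₁) b₂₂ hy₁.2.2 hy₂.2.2
    exact hxy x₂ x₂ hx₂.2.2 (this ▸ a₂₂) hx₂.1 rfl
  have q3 : k₁₁ ≠ k₂₁ := fun e => by
    have : k₁₁ = m₁ := l₁₁.eq_of_mem h₁.1 hx a₁₁ (e ▸ a₂₁) hx₁.2.2 hx₂.2.2
    exact hxy y₁ y₁ (this ▸ b₁₁) hy₁.2.2 hy₁.1 rfl
  have q4 : k₂₂ ≠ k₁₂ := fun e => by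
    have : k₂₂ = m₁ := l₂₂.eq_of_mem h₁.1 hx (e ▸ a₁₂) a₂₂ hx₁.2.2 hx₂.2.2
    exact hxy y₂ y₂ (this ▸ b₂₂) hy₂.2.2 hy₂.1 rfl
  by_cases hcase : R ∉ k₁₁ ∧ R ∉ k₂₂
  · refine hfinal k₁₁ k₂₂ k₁₂ k₂₁ hcase.1 hcase.2 fun D hD => ?_
    obtain ⟨h₀, a, b, e⟩ := hform D hD
    exact ⟨h₀, a, b, e.imp (fun e => e.2) id⟩
  -- Lines from different pairings meet only in one of the four joined nodes, so R cannot lie on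
  -- lines of both pairings.
  · have hcase' : R ∉ k₁₂ ∧ R ∉ k₂₁ := by
      rw [not_and_or, not_not, not_not] at hcase
      rcases hcase with h | h
      · exact ⟨fun h' => q1 (hns _ _ _ l₁₁ l₁₂ a₁₁ a₁₂ (hRx _ hx₁.2.2) h h'),
          fun h' => q3 (hns _ _ _ l₁₁ l₂₁ b₁₁ b₂₁ (hRy _ hy₁.2.2) h h')⟩
      · exact ⟨fun h' => q4 (hns _ _ _ l₂₂ l₁₂ b₂₂ b₁₂ (hRy _ hy₂.2.2) h h'),
          fun h' => q2 (hns _ _ _ l₂₂ l₂₁ a₂₂ a₂₁ (hRx _ hx₂.2.2) h h')⟩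
    refine hfinal k₁₂ k₂₁ k₁₁ k₂₂ hcase'.1 hcase'.2 fun D hD => ?_
    obtain ⟨h₀, a, b, e⟩ := hform D hD
    exact ⟨h₀, a, b, e.symm.imp (fun e => e.2) id⟩

/-- If at most one of three maximal lines of the remainder fails to be maximal, there are at least
three maximal lines. -/
theorem exists_three_isMax {n : ℕ} {Y : Finset Plane} {M : Set Plane} (hM : IsMax (n + 1) Y M)
    (h3 : ∃ h₁ h₂ h₃, IsMax n (nodesOff Y M) h₁ ∧ IsMax n (nodesOff Y M) h₂ ∧
      IsMax n (nodesOff Y M) h₃ ∧ h₁ ≠ h₂ ∧ h₁ ≠ h₃ ∧ h₂ ≠ h₃)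
    (hone : ∀ m₁ m₂, IsMax n (nodesOff Y M) m₁ → IsMax n (nodesOff Y M) m₂ → m₁ ≠ m₂ →
      IsMax (n + 1) Y m₁ ∨ IsMax (n + 1) Y m₂) :
    ∃ h₁ h₂ h₃, IsMax (n + 1) Y h₁ ∧ IsMax (n + 1) Y h₂ ∧ IsMax (n + 1) Y h₃ ∧
      h₁ ≠ h₂ ∧ h₁ ≠ h₃ ∧ h₂ ≠ h₃ := by
  obtain ⟨h₁, h₂, h₃, H₁, H₂, H₃, n12, n13, n23⟩ := h3
  have e₁ := H₁.ne_of_nodesOff.symm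
  have e₂ := H₂.ne_of_nodesOff.symm
  have e₃ := H₃.ne_of_nodesOff.symm
  rcases hone h₁ h₂ H₁ H₂ n12 with a | a
  · rcases hone h₂ h₃ H₂ H₃ n23 with b | b
    · exact ⟨M, h₁, h₂, hM, a, b, e₁, e₂, n12⟩
    · exact ⟨M, h₁, h₃, hM, a, b, e₁, e₃, n13⟩
  · rcases hone h₁ h₃ H₁ H₃ n13 with b | b
    · exact ⟨M, h₁, h₂, hM, b, a, e₁, e₂, n12⟩
    · exact ⟨M, h₂, h₃, hM, a, b, e₂, e₃, n23⟩

theorem LineGC.exists_three_of_three {Y : Finset Plane} (hY : LineGC 3 Y) :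
    ∃ h₁ h₂ h₃, IsMax 3 Y h₁ ∧ IsMax 3 Y h₂ ∧ IsMax 3 Y h₃ ∧ h₁ ≠ h₂ ∧ h₁ ≠ h₃ ∧ h₂ ≠ h₃ := by
  obtain ⟨M, hM⟩ := hY.exists_isMax_three
  refine exists_three_isMax hM (hY.remove hM).exists_three_of_two fun m₁ m₂ h₁ h₂ hne => ?_
  by_contra! hcon
  exact hY.not_two_disjoint_three hM h₁ h₂ hne hcon.1 hcon.2

end GCSets

/-! ### Three maximal lines in degree four. -/

namespace GCSets

open scoped Classical

theorem exists_param_of_collinear {h : Set Plane} (hh : IsLine h) {A B D : Plane} (hAB : A ≠ B)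
    (hA : A ∈ h) (hB : B ∈ h) (hD : D ∈ h) :
    ∃ t : ℝ, ∀ i, D i = (1 - t) * A i + t * B i := by
  have hdet := hh.collinearDet_eq_zero hA hB hD
  unfold collinearDet at hdet
  by_cases h0 : B 0 - A 0 = 0
  · have h1 : B 1 - A 1 ≠ 0 := fun h1 => hAB (plane_ext (by linarith) (by linarith))
    refine ⟨(D 1 - A 1) / (B 1 - A 1), fun i => ?_⟩
    fin_cases i
    · have : D 0 - A 0 = 0 := by
        apply mul_left_cancel₀ h1
        rw [h0] at hdet
        linarith
      simp only [Fin.zero_eta]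
      have e : B 0 = A 0 := by linarith
      rw [e]; linarith
    · simp only [Fin.mk_one]
      field_simp
      ring
  · refine ⟨(D 0 - A 0) / (B 0 - A 0), fun i => ?_⟩
    fin_cases i
    · simp only [Fin.zero_eta]
      field_simp
      ring
    · simp only [Fin.mk_one]
      field_simp
      linarith

theorem affine_param {A B D : Plane} {t : ℝ} (ht : ∀ i, D i = (1 - t) * A i + t * B i)
    (a b c : ℝ) : a * D 0 + b * D 1 + c =
      (1 - t) * (a * A 0 + b * A 1 + c) + t * (a * B 0 + b * B 1 + c) := by
  rw [ht 0, ht 1]; ring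

/-- Let u, v, w be equations of m₁, m₂, M and r = u / v. Menelaus' theorem gives r at the node of M
on a transversal in terms of its nodes on m₁ and m₂. Over the cover of D every node of m₁ and m₂
occurs once, so the product of these relations is r D * r D' * κ = ∏ r, where κ does not depend on D
and D' is the node of M on the line of the cover through Q. As r is injective on the nodes of M, D ↦
D' is an involution without fixed points on five nodes. The parity argument says nothing about the
four nodes in degree three. -/
theorem LineGC.not_two_disjoint_four {Y : Finset Plane} (hY : LineGC 4 Y) {M m₁ m₂ : Set Plane}
    (hM : IsMax 4 Y M) (h₁ : IsMax 3 (nodesOff Y M) m₁) (h₂ : IsMax 3 (nodesOff Y M) m₂)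
    (hne : m₁ ≠ m₂) (hn₁ : ¬ IsMax 4 Y m₁) (hn₂ : ¬ IsMax 4 Y m₂) : False := by
  have hd₁ := hM.disjoint_of_not_isMax h₁ hn₁
  have hd₂ := hM.disjoint_of_not_isMax h₂ hn₂
  obtain ⟨Q, hQ, hQ₁, hQ₂⟩ := (hY.remove hM).exists_mem_inter h₁ h₂
  rw [mem_nodesOff] at hQ
  choose! c hc using hY.exists_cover
  obtain ⟨ua, ub, uc, -, hu⟩ := isLine_iff.1 h₁.1
  obtain ⟨va, vb, vc, -, hv⟩ := isLine_iff.1 h₂.1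
  obtain ⟨wa, wb, wc, -, hw⟩ := isLine_iff.1 hM.1
  set u : Plane → ℝ := fun A => ua * A 0 + ub * A 1 + uc with hudef
  set v : Plane → ℝ := fun A => va * A 0 + vb * A 1 + vc with hvdef
  set w : Plane → ℝ := fun A => wa * A 0 + wb * A 1 + wc with hwdef
  change ∀ A, A ∈ m₁ ↔ u A = 0 at hu
  change ∀ A, A ∈ m₂ ↔ v A = 0 at hv
  change ∀ A, A ∈ M ↔ w A = 0 at hw
  have hxy : ∀ x, x ∈ m₁ → x ∈ m₂ → x = Q := fun x a b => h₁.1.point_eq h₂.1 hne a hQ₁ b hQ₂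
  set N := nodesOn Y M with hN
  have cN : N.card = 5 := hM.2
  have memN : ∀ D, D ∈ N → D ∈ Y ∧ D ∈ M := fun D hD => mem_nodesOn.1 hD
  set r : Plane → ℝ := fun D => u D / v D with hr
  have uN : ∀ D ∈ N, u D ≠ 0 := fun D hD h => hd₁ D (memN D hD).1 (memN D hD).2 ((hu D).2 h)
  have vN : ∀ D ∈ N, v D ≠ 0 := fun D hD h => hd₂ D (memN D hD).1 (memN D hD).2 ((hv D).2 h)
  have rN : ∀ D ∈ N, r D ≠ 0 := fun D hD => div_ne_zero (uN D hD) (vN D hD)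
  have uQ := (hu Q).1 hQ₁
  have vQ := (hv Q).1 hQ₂
  -- another node of `m₂`
  obtain ⟨b, hb⟩ : ((nodesOn (nodesOff Y M) m₂).erase Q).Nonempty := by
    apply Finset.card_pos.1
    rw [Finset.card_erase_of_mem (by simp [hQ, hQ₂]), h₂.2]
    norm_num
  simp only [Finset.mem_erase, mem_nodesOn] at hb
  have ub0 : u b ≠ 0 := fun h => hb.1 (hxy b ((hu b).2 h) hb.2.2)
  have vb0 : v b = 0 := (hv b).1 hb.2.2
  -- The points with the same ratio as D lie on a line through Q; if it contained another node of M
  -- it would be M, which avoids Q.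
  have rinj : ∀ D ∈ N, ∀ D' ∈ N, r D = r D' → D = D' := by
    intro D hD D' hD' hrr
    by_contra hDD
    rw [hr] at hrr
    simp only at hrr
    rw [div_eq_div_iff (vN D hD) (vN D' hD')] at hrr
    have hk : IsLine {P : Plane | v D * u P - u D * v P = 0} := by
      refine isLine_iff.2 ⟨v D * ua - u D * va, v D * ub - u D * vb, v D * uc - u D * vc, ?_,
        fun P => ?_⟩
      · by_contra! hab
        have e1 : v D * u Q - u D * v Q = v D * uc - u D * vc := by
          simp only [hudef, hvdef] at hab ⊢
          linear_combination Q 0 * hab.1 + Q 1 * hab.2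
        have e2 : v D * u b - u D * v b = v D * uc - u D * vc := by
          simp only [hudef, hvdef] at hab ⊢
          linear_combination b 0 * hab.1 + b 1 * hab.2
        rw [uQ, vQ] at e1
        rw [vb0] at e2
        exact mul_ne_zero (vN D hD) ub0 (by linarith)
      · simp only [Set.mem_ofPred_eq, hudef, hvdef]
        constructor <;> intro h <;> linear_combination h
    have hMk : M = {P : Plane | v D * u P - u D * v P = 0} :=
      hM.1.eq_of_mem hk hDD (memN D hD).2 (memN D' hD').2
        (by simp only [Set.mem_ofPred_eq]; ring) (by simp only [Set.mem_ofPred_eq]; linarith)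
    apply hQ.2
    rw [hMk]
    simp [uQ, vQ]
  -- the product relation for a cover
  set G₁ : Plane → ℝ := fun A => if A = Q then 1 else -(w A / v A) with hG₁
  set G₂ : Plane → ℝ := fun B => if B = Q then 1 else u B / w B with hG₂
  set κ : ℝ := (∏ A ∈ nodesOn Y m₁, G₁ A) * ∏ B ∈ nodesOn Y m₂, G₂ B with hκ
  have hφ : ∀ D ∈ N, ∃ D' ∈ N, D' ≠ D ∧ r D * (r D' * κ) = ∏ E ∈ N, r E := by
    intro D hD
    have hDY := (memN D hD).1
    have hDM := (memN D hD).2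
    have hcD := hc D hDY
    obtain ⟨f₁, F₁, I₁, J₁, u₁⟩ := hM.exists_matching_of_disjoint h₁ hd₁ hDY hDM hcD
    obtain ⟨f₂, F₂, I₂, J₂, u₂⟩ := hM.exists_matching_of_disjoint h₂ hd₂ hDY hDM hcD
    obtain ⟨f, F, I, J, -⟩ := hM.exists_matching_self hDY hDM hcD
    have hQn : Q ∈ nodesOn Y m₁ := by simp [hQ.1, hQ₁]
    obtain ⟨h₀, hh₀, e₀⟩ := Finset.mem_image.1 (J₁ ▸ hQn)
    have Qh₀ : Q ∈ h₀ := e₀ ▸ (F₁ h₀ hh₀).2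
    have q₀ : Q = f₂ h₀ := u₂ _ hh₀ Q (by simp [hQ.1, hQ₂]) Qh₀
    have F0 := Finset.mem_erase.1 (F h₀ hh₀).1
    refine ⟨f h₀, F0.2, F0.1, ?_⟩
    -- Menelaus for h. The line h₀ meets m₁ and m₂ in Q, where both factors are 1 by convention, so
    -- its own ratio is kept.
    have hstep : ∀ h ∈ c D, r (f h) = (if h = h₀ then r (f h₀) else 1) * (G₁ (f₁ h) * G₂ (f₂ h)) := by
      intro h hh
      by_cases e : h = h₀
      · subst e
        simp [hG₁, hG₂, e₀, ← q₀]
      · have n₁ : f₁ h ≠ Q := fun e' => e (I₁ hh hh₀ (e'.trans e₀.symm))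
        have n₂ : f₂ h ≠ Q := fun e' => e (I₂ hh hh₀ (e'.trans q₀))
        simp only [hG₁, hG₂, if_neg e, if_neg n₁, if_neg n₂, one_mul]
        obtain ⟨A1, A2⟩ := F₁ h hh
        obtain ⟨B1, B2⟩ := F₂ h hh
        obtain ⟨C1, C2⟩ := F h hh
        rw [mem_nodesOn] at A1 B1
        rw [Finset.mem_erase] at C1
        have hAB : f₁ h ≠ f₂ h := fun e' => n₁ (hxy _ A1.2 (e' ▸ B1.2))
        obtain ⟨t, ht⟩ := exists_param_of_collinear (hcD.isLine h hh) hAB A2 B2 C2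
        have eu : u (f h) = (1 - t) * u (f₁ h) + t * u (f₂ h) := affine_param ht ua ub uc
        have ev : v (f h) = (1 - t) * v (f₁ h) + t * v (f₂ h) := affine_param ht va vb vc
        have ew : w (f h) = (1 - t) * w (f₁ h) + t * w (f₂ h) := affine_param ht wa wb wc
        rw [(hu _).1 A1.2] at eu
        rw [(hv _).1 B1.2] at ev
        rw [(hw _).1 (memN _ C1.2).2] at ew
        have v0 := vN _ C1.2
        have va0 : v (f₁ h) ≠ 0 := fun e' => n₁ (hxy _ A1.2 ((hv _).2 e'))
        have wb0 : w (f₂ h) ≠ 0 := fun e' => hd₂ _ B1.1 ((hw _).2 e') B1.2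
        simp only [hr]
        field_simp
        rw [eu, ev]
        linear_combination -(v (f₁ h) * u (f₂ h) * ew)
    have hprod : ∏ E ∈ N.erase D, r E = r (f h₀) * κ := by
      rw [← J, Finset.prod_image I, Finset.prod_congr rfl hstep, Finset.prod_mul_distrib,
        Finset.prod_mul_distrib, Finset.prod_ite_eq' , if_pos hh₀, hκ, ← J₁, ← J₂,
        Finset.prod_image I₁, Finset.prod_image I₂]
    rw [← hprod, Finset.mul_prod_erase N r hD]
  choose! φ hφ using hφ
  have hpos : ∏ E ∈ N, r E ≠ 0 := Finset.prod_ne_zero_iff.2 rN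
  have hinv : ∀ D ∈ N, φ (φ D) = D := by
    intro D hD
    obtain ⟨a, -, e⟩ := hφ D hD
    obtain ⟨a', -, e'⟩ := hφ (φ D) a
    apply rinj _ a' _ hD
    have hκ0 : κ ≠ 0 := by
      intro h0
      rw [h0] at e
      exact hpos (by rw [← e]; ring)
    have : r (φ D) * κ ≠ 0 := mul_ne_zero (rN _ a) hκ0
    apply mul_right_cancel₀ this
    rw [e, ← e']
    ring
  -- The involution cancels the terms in pairs modulo 2, yet there are five of them.
  have hsum : ∑ _D ∈ N, (1 : ZMod 2) = 0 :=
    Finset.sum_involution (fun D _ => φ D) (fun _ _ => by decide) (fun D hD _ => (hφ D hD).2.1)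
      (fun D hD => (hφ D hD).1) (fun D hD => hinv D hD)
  rw [Finset.sum_const, cN] at hsum
  exact absurd hsum (by decide)

theorem LineGC.exists_three_of_four {Y : Finset Plane} (hY : LineGC 4 Y) {M : Set Plane}
    (hM : IsMax 4 Y M) :
    ∃ h₁ h₂ h₃, IsMax 4 Y h₁ ∧ IsMax 4 Y h₂ ∧ IsMax 4 Y h₃ ∧ h₁ ≠ h₂ ∧ h₁ ≠ h₃ ∧ h₂ ≠ h₃ := by
  refine exists_three_isMax hM (hY.remove hM).exists_three_of_three fun m₁ m₂ h₁ h₂ hne => ?_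
  by_contra! hcon
  exact hY.not_two_disjoint_four hM h₁ h₂ hne hcon.1 hcon.2

end GCSets

/-! ### Cayley–Bacharach for grids and collinearity of perspectivity centres. -/

namespace GCSets

open scoped Classical

open MvPolynomial in
/-- A product of equations of the lines of a finite family. -/
theorem exists_poly_of_lines (S : Finset (Set Plane)) (hS : ∀ h ∈ S, IsLine h) :
    ∃ p : Poly, p.totalDegree ≤ S.card ∧ ∀ A : Plane, eval A p = 0 ↔ ∃ h ∈ S, A ∈ h := by
  choose! L hL using hS
  refine ⟨∏ h ∈ S, L h, ?_, fun A => ?_⟩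
  · refine (totalDegree_finsetProd _ _).trans ?_
    rw [Finset.card_eq_sum_ones]
    exact Finset.sum_le_sum fun h hh => (hL h hh).1.le
  · rw [map_prod, Finset.prod_eq_zero_iff]
    refine exists_congr fun h => and_congr_right fun hh => ?_
    conv_rhs => rw [← (hL h hh).2]
    rfl

open MvPolynomial in
/-- The Cayley–Bacharach property of a grid of three by three lines. -/
theorem eval_eq_zero_of_grid {a₁ a₂ a₃ : Set Plane} (h₁ : IsLine a₁) (h₂ : IsLine a₂)
    (h₃ : IsLine a₃) {T₁ T₂ T₃ : Finset Plane} (c₁ : T₁.card = 2) (c₂ : T₂.card = 3)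
    (c₃ : T₃.card = 3) (m₁ : ∀ A ∈ T₁, A ∈ a₁ ∧ A ∉ a₂ ∧ A ∉ a₃) (m₂ : ∀ A ∈ T₂, A ∈ a₂)
    (m₃ : ∀ A ∈ T₃, A ∈ a₃ ∧ A ∉ a₂) {f g : Poly} (hf : f.totalDegree ≤ 3)
    (hg : g.totalDegree ≤ 3) (hfT : ∀ A ∈ T₁ ∪ T₂ ∪ T₃, eval A f = 0)
    (hgT : ∀ A ∈ T₁ ∪ T₂ ∪ T₃, eval A g = 0) {C : Plane} (hC : C ∈ a₁) (hgC : eval C g = 0)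
    {G : Plane} (hG : G ∈ a₂) (hgG : eval G g ≠ 0) : eval C f = 0 := by
  obtain ⟨L₁, -, z₁, d₁⟩ := exists_eq_mul_of_zeros h₁
  obtain ⟨L₂, -, z₂, d₂⟩ := exists_eq_mul_of_zeros h₂
  obtain ⟨L₃, -, z₃, d₃⟩ := exists_eq_mul_of_zeros h₃
  have e₁ : ∀ A, A ∈ a₁ ↔ eval A L₁ = 0 := fun A => by rw [← z₁]; rfl
  have e₂ : ∀ A, A ∈ a₂ ↔ eval A L₂ = 0 := fun A => by rw [← z₂]; rfl
  have e₃ : ∀ A, A ∈ a₃ ↔ eval A L₃ = 0 := fun A => by rw [← z₃]; rfl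
  -- With this constant f - r g also vanishes at the extra point G of a₂. Four zeros on a₂, three on
  -- a₃ and two on a₁ then split off the three lines in turn.
  set r := eval G f / eval G g with hr
  have hF : ∀ A ∈ T₁ ∪ T₂ ∪ T₃, eval A (f - MvPolynomial.C r * g) = 0 := fun A hA => by
    simp [hfT A hA, hgT A hA]
  have hGT : G ∉ T₂ := fun h => hgG (hgT G (by simp [h]))
  obtain ⟨F₂, hF₂, dF₂⟩ := d₂ 2 (f - MvPolynomial.C r * g) (insert G T₂)
    ((totalDegree_sub _ _).trans (max_le hf ((totalDegree_mul _ _).trans (by simpa using hg))))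
    (fun A hA => by
      rcases Finset.mem_insert.1 hA with rfl | hA
      · refine ⟨hG, ?_⟩
        simp only [map_sub, map_mul, eval_C, hr]
        field_simp
        ring
      · exact ⟨m₂ A hA, hF A (by simp [hA])⟩)
    (by rw [Finset.card_insert_of_notMem hGT]; omega)
  obtain ⟨F₃, hF₃, dF₃⟩ := d₃ 1 F₂ T₃ dF₂
    (fun A hA => by
      refine ⟨(m₃ A hA).1, ?_⟩
      have := hF A (by simp [hA])
      rw [hF₂, map_mul] at this
      exact (mul_eq_zero.1 this).resolve_left fun h => (m₃ A hA).2 ((e₂ A).2 h))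
    (by omega)
  obtain ⟨F₁, hF₁, -⟩ := d₁ 0 F₃ T₁ dF₃
    (fun A hA => by
      refine ⟨(m₁ A hA).1, ?_⟩
      have := hF A (by simp [hA])
      rw [hF₂, hF₃, map_mul, map_mul] at this
      exact ((mul_eq_zero.1 this).resolve_left fun h => (m₁ A hA).2.1 ((e₂ A).2 h)) |>
        fun h => (mul_eq_zero.1 h).resolve_left fun h => (m₁ A hA).2.2 ((e₃ A).2 h))
    (by omega)
  have := congrArg (eval C) hF₂
  rw [hF₃, hF₁] at this
  simpa [hgC, (e₁ C).1 hC] using this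

/-- With u and v equations of l₁ and l₂, a point W on the line through P ∈ l₁ and P' ∈ l₂ satisfies
W = (v W / v P) P + (u W / u P') P', and the coefficients sum to 1. Summing over P, while P' runs
once through T₂, puts the vector (W, 1) into the span of (p, s) and (q, t), which do not depend on
W. -/
theorem mul_eq_of_perspectivity {l₁ l₂ : Set Plane} (h₁ : IsLine l₁) (h₂ : IsLine l₂)
    {T₁ T₂ : Finset Plane} (m₁ : ∀ P ∈ T₁, P ∈ l₁ ∧ P ∉ l₂) (m₂ : ∀ P ∈ T₂, P ∈ l₂ ∧ P ∉ l₁)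
    (hcard : T₁.card = T₂.card) :
    ∃ (p q : Plane) (s t : ℝ), ∀ W : Plane, W ∉ l₁ → W ∉ l₂ →
      (∀ P ∈ T₁, ∃ h, IsLine h ∧ W ∈ h ∧ P ∈ h ∧ ∃ P' ∈ T₂, P' ∈ h) →
      ∃ x y : ℝ, (∀ i, (T₁.card : ℝ) * W i = x * p i + y * q i) ∧
        (T₁.card : ℝ) = x * s + y * t := by
  obtain ⟨ua, ub, uc, -, hu⟩ := isLine_iff.1 h₁
  obtain ⟨va, vb, vc, -, hv⟩ := isLine_iff.1 h₂
  set u : Plane → ℝ := fun A => ua * A 0 + ub * A 1 + uc with hudef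
  set v : Plane → ℝ := fun A => va * A 0 + vb * A 1 + vc with hvdef
  change ∀ A, A ∈ l₁ ↔ u A = 0 at hu
  change ∀ A, A ∈ l₂ ↔ v A = 0 at hv
  refine ⟨fun i => ∑ P ∈ T₁, P i / v P, fun i => ∑ P ∈ T₂, P i / u P, ∑ P ∈ T₁, 1 / v P,
    ∑ P ∈ T₂, 1 / u P, fun W hW₁ hW₂ hW => ⟨v W, u W, ?_⟩⟩
  choose! h q₁ q₂ q₃ f hfT hf using hW
  have hinj : Set.InjOn f (T₁ : Set Plane) := by
    intro P hP P' hP' e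
    by_contra hne
    have hWf : W ≠ f P := fun e' => hW₂ (e' ▸ (m₂ _ (hfT P hP)).1)
    have e1 : h P = h P' := (q₁ P hP).eq_of_mem (q₁ P' hP') hWf (q₂ P hP) (hf P hP)
      (q₂ P' hP') (e ▸ hf P' hP')
    have e2 : h P = l₁ := (q₁ P hP).eq_of_mem h₁ hne (q₃ P hP) (e1 ▸ (q₃ P' hP'))
      (m₁ P hP).1 (m₁ P' hP').1
    exact hW₁ (e2 ▸ (q₂ P hP))
  have himg : T₁.image f = T₂ := by
    apply Finset.eq_of_subset_of_card_le
    · intro P hP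
      obtain ⟨P', hP', rfl⟩ := Finset.mem_image.1 hP
      exact hfT P' hP'
    · rw [Finset.card_image_of_injOn hinj, hcard]
  have key : ∀ P ∈ T₁, (∀ i, W i = v W * (P i / v P) + u W * (f P i / u (f P))) ∧
      1 = v W * (1 / v P) + u W * (1 / u (f P)) := by
    intro P hP
    have hne : P ≠ f P := fun e => (m₁ P hP).2 (e ▸ (m₂ _ (hfT P hP)).1)
    obtain ⟨t, ht⟩ := exists_param_of_collinear (q₁ P hP) hne (q₃ P hP) (hf P hP)
      (q₂ P hP)
    have eu : u W = (1 - t) * u P + t * u (f P) := affine_param ht ua ub uc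
    have ev : v W = (1 - t) * v P + t * v (f P) := affine_param ht va vb vc
    rw [(hu _).1 (m₁ P hP).1] at eu
    rw [(hv _).1 (m₂ _ (hfT P hP)).1] at ev
    have u0 : u (f P) ≠ 0 := fun e => (m₂ _ (hfT P hP)).2 ((hu _).2 e)
    have v0 : v P ≠ 0 := fun e => (m₁ P hP).2 ((hv _).2 e)
    constructor
    · intro i
      rw [eu, ev, ht i]
      field_simp
      ring
    · rw [eu, ev]
      field_simp
      ring
  constructor
  · intro i
    beta_reduce
    rw [← himg, Finset.sum_image hinj, Finset.mul_sum, Finset.mul_sum, ← Finset.sum_add_distrib,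
      ← Finset.sum_congr rfl fun P hP => (key P hP).1 i]
    simp
  · rw [← himg, Finset.sum_image hinj, Finset.mul_sum, Finset.mul_sum, ← Finset.sum_add_distrib,
      ← Finset.sum_congr rfl fun P hP => (key P hP).2]
    simp

/-- The centres of the perspectivities between two given equinumerous sets of points of two lines
are collinear. -/
theorem collinearDet_eq_zero_of_perspectivity {l₁ l₂ : Set Plane} (h₁ : IsLine l₁)
    (h₂ : IsLine l₂) {T₁ T₂ : Finset Plane} (m₁ : ∀ P ∈ T₁, P ∈ l₁ ∧ P ∉ l₂)
    (m₂ : ∀ P ∈ T₂, P ∈ l₂ ∧ P ∉ l₁) (hcard : T₁.card = T₂.card) (hpos : T₁.card ≠ 0)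
    {A B C : Plane}
    (hW : ∀ W, W = A ∨ W = B ∨ W = C → W ∉ l₁ ∧ W ∉ l₂ ∧
      ∀ P ∈ T₁, ∃ h, IsLine h ∧ W ∈ h ∧ P ∈ h ∧ ∃ P' ∈ T₂, P' ∈ h) :
    collinearDet A B C = 0 := by
  obtain ⟨p, q, s, t, H⟩ := mul_eq_of_perspectivity h₁ h₂ m₁ m₂ hcard
  obtain ⟨a1, a2, a3⟩ := hW A (by simp)
  obtain ⟨b1, b2, b3⟩ := hW B (by simp)
  obtain ⟨c1, c2, c3⟩ := hW C (by simp)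
  obtain ⟨x, y, hA, hA'⟩ := H A a1 a2 a3
  obtain ⟨x', y', hB, hB'⟩ := H B b1 b2 b3
  obtain ⟨x'', y'', hC, hC'⟩ := H C c1 c2 c3
  have hn : (T₁.card : ℝ) ≠ 0 := by exact_mod_cast hpos
  set n : ℝ := (T₁.card : ℝ)
  have e : n * n * n * collinearDet A B C =
      n * ((n * B 0) * (n * C 1) - (n * B 1) * (n * C 0)) -
      n * ((n * A 0) * (n * C 1) - (n * A 1) * (n * C 0)) +
      n * ((n * A 0) * (n * B 1) - (n * A 1) * (n * B 0)) := by
    unfold collinearDet; ring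
  -- The determinant of the three vectors (W, 1), up to scaling; it vanishes because they lie in a
  -- common two-dimensional span.
  have e' : (x * s + y * t) * ((n * B 0) * (n * C 1) - (n * B 1) * (n * C 0)) -
      (x' * s + y' * t) * ((n * A 0) * (n * C 1) - (n * A 1) * (n * C 0)) +
      (x'' * s + y'' * t) * ((n * A 0) * (n * B 1) - (n * A 1) * (n * B 0)) = 0 := by
    rw [hA, hA, hB, hB, hC, hC]; ring
  rw [← hA', ← hB', ← hC', ← e] at e'
  exact (mul_eq_zero.1 e').resolve_left (mul_ne_zero (mul_ne_zero hn hn) hn)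

end GCSets

/-! ### Configurations without five-node lines: common lines of covers. -/

namespace GCSets

open scoped Classical

/-- A `GC_4` configuration `X` without lines through five nodes, with a choice `c` of covers. -/
structure FlatGC (X : Finset Plane) (c : Plane → Finset (Set Plane)) : Prop where
  card_eq : X.card = 15
  card_le : ∀ h, IsLine h → (nodesOn X h).card ≤ 4
  cover : ∀ A ∈ X, IsCover 4 X A (c A)

/-- The nodes whose cover contains `h`. -/
noncomputable def users (X : Finset Plane) (c : Plane → Finset (Set Plane)) (h : Set Plane) :
    Finset Plane := X.filter (h ∈ c ·)

/-- Three lines through four nodes each, contained in the covers of the three remaining nodes. -/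
structure Triad (X : Finset Plane) (c : Plane → Finset (Set Plane)) (I : Finset (Set Plane))
    (A B C : Plane) : Prop where
  card_eq : I.card = 3
  mem : ∀ h ∈ I, h ∈ c A ∧ h ∈ c B ∧ h ∈ c C
  four : ∀ h ∈ I, (nodesOn X h).card = 4
  disj : ∀ P ∈ X, ∀ h ∈ I, ∀ k ∈ I, P ∈ h → P ∈ k → h = k
  rest : ∀ P ∈ X, (∃ h ∈ I, P ∈ h) ∨ P = A ∨ P = B ∨ P = C
  mems : A ∈ X ∧ B ∈ X ∧ C ∈ X
  ne : A ≠ B ∧ A ≠ C ∧ B ≠ C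

variable {X : Finset Plane} {c : Plane → Finset (Set Plane)}

@[simp] theorem mem_users {h : Set Plane} {A : Plane} : A ∈ users X c h ↔ A ∈ X ∧ h ∈ c A := by
  simp [users]

theorem Triad.swap {I : Finset (Set Plane)} {A B C : Plane} (h : Triad X c I A B C) :
    Triad X c I B A C where
  card_eq := h.card_eq
  mem k hk := ⟨(h.mem k hk).2.1, (h.mem k hk).1, (h.mem k hk).2.2⟩
  four := h.four
  disj := h.disj
  rest P hP := by have := h.rest P hP; grind
  mems := ⟨h.mems.2.1, h.mems.1, h.mems.2.2⟩
  ne := ⟨h.ne.1.symm, h.ne.2.2, h.ne.2.1⟩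

theorem Triad.rotate {I : Finset (Set Plane)} {A B C : Plane} (h : Triad X c I A B C) :
    Triad X c I B C A where
  card_eq := h.card_eq
  mem k hk := ⟨(h.mem k hk).2.1, (h.mem k hk).2.2, (h.mem k hk).1⟩
  four := h.four
  disj := h.disj
  rest P hP := by have := h.rest P hP; grind
  mems := ⟨h.mems.2.1, h.mems.2.2, h.mems.1⟩
  ne := ⟨h.ne.2.2, h.ne.1.symm, h.ne.2.1.symm⟩

namespace FlatGC

/-- For k common lines the bound 15 ≤ 4k + (4 - k)² + 2 is an equality if k = 1 or k = 3 and fails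
if k = 2; equality forces four nodes on l. Four common lines are impossible for A ≠ B. -/
theorem inter_card (H : FlatGC X c) {A B : Plane} (hA : A ∈ X) (hB : B ∈ X) (hAB : A ≠ B)
    {l : Set Plane} (hlA : l ∈ c A) (hlB : l ∈ c B) :
    (nodesOn X l).card = 4 ∧ ((c A ∩ c B).card = 1 ∨ (c A ∩ c B).card = 3) := by
  have h1 := (H.cover A hA).card_le_of_ne (H.cover B hB)
  have h2 := (H.cover A hA).card_inter_lt (H.cover B hB) hA hAB
  have hl : l ∈ c A ∩ c B := Finset.mem_inter.2 ⟨hlA, hlB⟩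
  rw [← Finset.add_sum_erase _ _ hl] at h1
  have h4 := Finset.sum_le_card_nsmul ((c A ∩ c B).erase l) (fun h => (nodesOn X h).card) 4
    (fun k hk => H.card_le k ((H.cover A hA).isLine k
      (Finset.mem_inter.1 (Finset.mem_of_mem_erase hk)).1))
  rw [Finset.card_erase_of_mem hl] at h4
  simp only [smul_eq_mul] at h4
  have h5 := H.card_le l ((H.cover A hA).isLine l hlA)
  have h6 : 0 < (c A ∩ c B).card := Finset.card_pos.2 ⟨l, hl⟩
  have h7 := H.card_eq
  obtain h | h | h : (c A ∩ c B).card = 1 ∨ (c A ∩ c B).card = 2 ∨ (c A ∩ c B).card = 3 := by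
    omega
  all_goals rw [h] at h1 h4 ⊢; omega

/-- The other three lines cover at most twelve of the fourteen nodes. -/
theorem two_le_card (H : FlatGC X c) {A : Plane} (hA : A ∈ X) {l : Set Plane} (hl : l ∈ c A) :
    2 ≤ (nodesOn X l).card := by
  have h1 := (H.cover A hA).card_le_sum
  rw [← Finset.add_sum_erase _ _ hl] at h1
  have h2 := Finset.sum_le_card_nsmul ((c A).erase l) (fun h => (nodesOn X h).card) 4
      (fun k hk => H.card_le k ((H.cover A hA).isLine k (Finset.mem_of_mem_erase hk)))
  rw [Finset.card_erase_of_mem hl] at h2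
  have h3 := (H.cover A hA).card_le
  have := H.card_eq
  simp only [smul_eq_mul] at h2
  omega

/-- A line with four nodes that is disjoint from a line `l` of a cover belongs to this cover. -/
theorem mem_of_disjoint (H : FlatGC X c) {C : Plane} (hC : C ∈ X) {l a : Set Plane}
    (hl : l ∈ c C) (ha : IsLine a) (h4 : (nodesOn X a).card = 4) (hCa : C ∉ a)
    (hd : ∀ P ∈ X, P ∈ a → P ∉ l) : a ∈ c C := by
  have hcC := H.cover C hC
  refine Finset.mem_of_mem_erase (a := l) (mem_of_card_lt (T := nodesOn X a)
    (fun k hk => hcC.isLine k (Finset.mem_of_mem_erase hk)) ha (fun A hA => (mem_nodesOn.1 hA).2)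
    (fun A hA => ?_) ?_)
  · rw [mem_nodesOn] at hA
    obtain ⟨k, hk, hAk⟩ := hcC.covers A hA.1 fun e => hCa (e ▸ hA.2)
    exact ⟨k, Finset.mem_erase.2 ⟨fun e => hd A hA.1 hA.2 (e ▸ hAk), hk⟩, hAk⟩
  · rw [Finset.card_erase_of_mem hl]
    have := hcC.card_le
    omega

/-- The count is sharp for three common lines: they cover twelve nodes, so no node lies on two of
them, and besides A and B exactly one node Z is left. -/
theorem exists_triad_of_inter (H : FlatGC X c) {A B : Plane} (hA : A ∈ X) (hB : B ∈ X)
    (hAB : A ≠ B) (h3 : (c A ∩ c B).card = 3) :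
    (∀ h ∈ c A ∩ c B, (nodesOn X h).card = 4) ∧
    (∀ P ∈ X, ∀ h ∈ c A ∩ c B, ∀ k ∈ c A ∩ c B, P ∈ h → P ∈ k → h = k) ∧
    ∃ Z ∈ X, Z ≠ A ∧ Z ≠ B ∧ (∀ h ∈ c A ∩ c B, Z ∉ h) ∧
      ∀ P ∈ X, (∃ h ∈ c A ∩ c B, P ∈ h) ∨ P = A ∨ P = B ∨ P = Z := by
  have hmem : ∀ h ∈ c A ∩ c B, h ∈ c A ∧ h ∈ c B := fun h hh => Finset.mem_inter.1 hh
  have hfour : ∀ h ∈ c A ∩ c B, (nodesOn X h).card = 4 := fun h hh =>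
    (H.inter_card hA hB hAB (hmem h hh).1 (hmem h hh).2).1
  have h1 := (H.cover A hA).card_le_biUnion (H.cover B hB)
  rw [h3] at h1
  set I := c A ∩ c B with hI
  set U := I.biUnion (nodesOn X) with hU
  have hUX : U ⊆ X := Finset.biUnion_subset.2 fun h _ P hP => (mem_nodesOn.1 hP).1
  have hX := H.card_eq
  have hsum : ∑ h ∈ I, (nodesOn X h).card = 12 := by
    rw [Finset.sum_congr rfl hfour, Finset.sum_const, h3]
    rfl
  have hU12 : U.card ≤ 12 := hsum ▸ Finset.card_biUnion_le
  have hUeq : U.card = 12 := by omega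
  have hdisj : ∀ P ∈ X, ∀ h ∈ I, ∀ k ∈ I, P ∈ h → P ∈ k → h = k := by
    intro P hP h hh k hk hPh hPk
    by_contra hhk
    have hsub : U ⊆ (nodesOn X h).erase P ∪ (I.erase h).biUnion (nodesOn X) := by
      intro R hR
      obtain ⟨g, hg, hRg⟩ := Finset.mem_biUnion.1 hR
      by_cases hgh : g = h
      · subst hgh
        by_cases hRP : R = P
        · subst hRP
          exact Finset.mem_union_right _ (Finset.mem_biUnion.2
            ⟨k, Finset.mem_erase.2 ⟨fun e => hhk e.symm, hk⟩, by simp [hP, hPk]⟩)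
        · exact Finset.mem_union_left _ (Finset.mem_erase.2 ⟨hRP, hRg⟩)
      · exact Finset.mem_union_right _ (Finset.mem_biUnion.2
            ⟨g, Finset.mem_erase.2 ⟨hgh, hg⟩, hRg⟩)
    have e1 := (Finset.card_le_card hsub).trans (Finset.card_union_le _ _)
    have e2 : ((I.erase h).biUnion (nodesOn X)).card ≤ ∑ g ∈ I.erase h, (nodesOn X g).card :=
      Finset.card_biUnion_le
    rw [← Finset.add_sum_erase _ _ hh, hfour h hh] at hsum
    rw [Finset.card_erase_of_mem (by simp [hP, hPh]), hfour h hh] at e1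
    omega
  refine ⟨hfour, hdisj, ?_⟩
  have hAU : A ∉ U := fun h => by
    obtain ⟨g, hg, hAg⟩ := Finset.mem_biUnion.1 h
    exact (H.cover A hA).notMem g (hmem g hg).1 (mem_nodesOn.1 hAg).2
  have hBU : B ∉ U := fun h => by
    obtain ⟨g, hg, hBg⟩ := Finset.mem_biUnion.1 h
    exact (H.cover B hB).notMem g (hmem g hg).2 (mem_nodesOn.1 hBg).2
  have hW : (((X \ U).erase A).erase B).card = 1 := by
    rw [Finset.card_erase_of_mem (by simp [hB, hBU, hAB.symm]),
      Finset.card_erase_of_mem (by simp [hA, hAU]), Finset.card_sdiff_of_subset hUX]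
    omega
  obtain ⟨Z, hZ⟩ := Finset.card_eq_one.1 hW
  have hZm : Z ∈ ((X \ U).erase A).erase B := by rw [hZ]; simp
  simp only [Finset.mem_erase, Finset.mem_sdiff] at hZm
  refine ⟨Z, hZm.2.2.1, hZm.2.1, hZm.1, fun h hh hZh => hZm.2.2.2
    (Finset.mem_biUnion.2 ⟨h, hh, mem_nodesOn.2 ⟨hZm.2.2.1, hZh⟩⟩), fun P hP => ?_⟩
  by_cases hPU : P ∈ U
  · obtain ⟨g, hg, hPg⟩ := Finset.mem_biUnion.1 hPU
    exact Or.inl ⟨g, hg, (mem_nodesOn.1 hPg).2⟩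
  · right
    by_cases e1 : P = A
    · exact Or.inl e1
    by_cases e2 : P = B
    · exact Or.inr (Or.inl e2)
    have : P ∈ ((X \ U).erase A).erase B := by simp [hP, hPU, e1, e2]
    rw [hZ] at this
    exact Or.inr (Or.inr (by simpa using this))

/-- If C were not the remaining node Z, it would lie on one common line a, and the two others would
belong to the cover of C. The covers of A and C would then share a third line a₃ whose four nodes
avoid those two lines, so they would lie on a, at most once, or among B and Z. -/
theorem triad_of_inter (H : FlatGC X c) {A B C : Plane} (hA : A ∈ X) (hB : B ∈ X) (hC : C ∈ X)
    (hAB : A ≠ B) (hAC : A ≠ C) (hBC : B ≠ C) (h3 : (c A ∩ c B).card = 3) {l : Set Plane}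
    (hlA : l ∈ c A) (hlB : l ∈ c B) (hlC : l ∈ c C) : Triad X c (c A ∩ c B) A B C := by
  obtain ⟨hfour, hdisj, Z, hZ, hZA, hZB, hZI, hrest⟩ := H.exists_triad_of_inter hA hB hAB h3
  have hl : l ∈ c A ∩ c B := Finset.mem_inter.2 ⟨hlA, hlB⟩
  have hlineI : ∀ h ∈ c A ∩ c B, IsLine h := fun h hh =>
    (H.cover A hA).isLine h (Finset.mem_inter.1 hh).1
  have hmem : ∀ h ∈ c A ∩ c B, C ∉ h → h ∈ c C := by
    intro h hh hCh
    by_cases e : h = l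
    · exact e ▸ hlC
    · exact H.mem_of_disjoint hC hlC (hlineI h hh) (hfour h hh) hCh
        fun P hP hPh hPl => e (hdisj P hP h hh l hl hPh hPl)
  have hCZ : C = Z := by
    by_contra hCZ
    obtain ⟨a, ha, hCa⟩ : ∃ h ∈ c A ∩ c B, C ∈ h := by
      rcases hrest C hC with h | h | h | h
      · exact h
      · exact absurd h.symm hAC
      · exact absurd h.symm hBC
      · exact absurd h hCZ
    have haC : a ∉ c C := fun h => (H.cover C hC).notMem a h hCa
    have hsub : (c A ∩ c B).erase a ⊆ c A ∩ c C := by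
      intro h hh
      obtain ⟨hha, hhI⟩ := Finset.mem_erase.1 hh
      exact Finset.mem_inter.2 ⟨(Finset.mem_inter.1 hhI).1,
        hmem h hhI fun hCh => hha (hdisj C hC h hhI a ha hCh hCa)⟩
    have hc2 := Finset.card_le_card hsub
    rw [Finset.card_erase_of_mem ha, h3] at hc2
    have h3' : (c A ∩ c C).card = 3 := by
      rcases (H.inter_card hA hC hAC hlA hlC).2 with h | h <;> omega
    obtain ⟨hfour', hdisj', -⟩ := H.exists_triad_of_inter hA hC hAC h3'
    obtain ⟨a₃, ha₃, ha₃'⟩ : ∃ k ∈ c A ∩ c C, k ∉ (c A ∩ c B).erase a := by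
      by_contra! hcon
      have := Finset.card_le_card (show c A ∩ c C ⊆ (c A ∩ c B).erase a from hcon)
      rw [h3', Finset.card_erase_of_mem ha] at this
      omega
    have ha₃a : a₃ ≠ a := fun e => haC (e ▸ (Finset.mem_inter.1 ha₃).2)
    have hl₃ := (H.cover A hA).isLine a₃ (Finset.mem_inter.1 ha₃).1
    have hsub3 : nodesOn X a₃ ⊆ nodesOn (nodesOn X a₃) a ∪ {B, Z} := by
      intro P hP
      obtain ⟨hPX, hP₃⟩ := mem_nodesOn.1 hP
      by_cases hPa : P ∈ a
      · exact Finset.mem_union_left _ (mem_nodesOn.2 ⟨hP, hPa⟩)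
      · apply Finset.mem_union_right
        rcases hrest P hPX with ⟨h, hh, hPh⟩ | rfl | h | h
        · exfalso
          have hhe : h ∈ (c A ∩ c B).erase a := Finset.mem_erase.2 ⟨fun e => hPa (e ▸ hPh), hh⟩
          exact ha₃' (hdisj' P hPX a₃ ha₃ h (hsub hhe) hP₃ hPh ▸ hhe)
        · exact absurd hP₃ ((H.cover P hA).notMem a₃ (Finset.mem_inter.1 ha₃).1)
        · simp [h]
        · simp [h]
    have e1 := (Finset.card_le_card hsub3).trans (Finset.card_union_le _ _)
    have e2 : (nodesOn (nodesOn X a₃) a).card ≤ 1 :=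
      card_inter_le_one hl₃ (hlineI a ha) ha₃a (fun P hP => by simp at hP; exact hP.1.2)
        (fun P hP => by simp at hP; exact hP.2)
    have e3 : ({B, Z} : Finset Plane).card ≤ 2 := Finset.card_le_two
    rw [hfour' a₃ ha₃] at e1
    omega
  subst hCZ
  exact ⟨h3, fun h hh => ⟨(Finset.mem_inter.1 hh).1, (Finset.mem_inter.1 hh).2,
    hmem h hh (hZI h hh)⟩, hfour, hdisj, hrest, ⟨hA, hB, hC⟩, hAB, hAC, hBC⟩

/-- Among three covers with a common line, two have three lines in common. -/
theorem exists_inter_card_eq_three (H : FlatGC X c) {A B C : Plane} (hA : A ∈ X) (hB : B ∈ X)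
    (hC : C ∈ X) (hAB : A ≠ B) (hAC : A ≠ C) (hBC : B ≠ C) {l : Set Plane}
    (hlA : l ∈ c A) (hlB : l ∈ c B) (hlC : l ∈ c C) :
    (c A ∩ c B).card = 3 ∨ (c A ∩ c C).card = 3 ∨ (c B ∩ c C).card = 3 := by
  obtain ⟨hl4, h1⟩ := H.inter_card hA hB hAB hlA hlB
  -- It remains to exclude that the covers of A and B share only l. The nine nodes off l other than
  -- A and B would then form a three by three grid cut out by these covers. The lines of the cover
  -- of C other than l form a curve of degree at most three through all of them except C, against
  -- Cayley–Bacharach.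
  refine h1.symm.imp_right fun h1 => ?_
  have hcA := H.cover A hA
  have hcB := H.cover B hB
  have hcC := H.cover C hC
  exfalso
  have hinter : c A ∩ c B = {l} := by
    obtain ⟨k, hk⟩ := Finset.card_eq_one.1 h1
    have : l ∈ c A ∩ c B := Finset.mem_inter.2 ⟨hlA, hlB⟩
    rw [hk] at this ⊢
    simp at this
    rw [this]
  set T := ((nodesOff X l).erase A).erase B with hT
  have hll := hcA.isLine l hlA
  have hTcard : T.card = 9 := by
    rw [hT, Finset.card_erase_of_mem (by simp [hB, hAB.symm, hcB.notMem l hlB]),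
      Finset.card_erase_of_mem (by simp [hA, hcA.notMem l hlA])]
    have := card_nodesOn_add_card_nodesOff X l
    have := H.card_eq
    omega
  have memT : ∀ P, P ∈ T ↔ P ≠ B ∧ P ≠ A ∧ P ∈ X ∧ P ∉ l := fun P => by simp [hT]
  -- Four of these nodes on a would be covered by the at most three lines of B other than l, making
  -- a a second common line.
  have hthree : ∀ a ∈ (c A).erase l, (nodesOn T a).card ≤ 3 := by
    intro a ha
    obtain ⟨hal, haA⟩ := Finset.mem_erase.1 ha
    by_contra! hcon
    have : a ∈ (c B).erase l := by
      refine mem_of_card_lt (T := nodesOn T a)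
        (fun k hk => hcB.isLine k (Finset.mem_of_mem_erase hk)) (hcA.isLine a haA)
        (fun P hP => (mem_nodesOn.1 hP).2) (fun P hP => ?_) ?_
      · have := (memT P).1 (mem_nodesOn.1 hP).1
        obtain ⟨k, hk, hPk⟩ := hcB.covers P this.2.2.1 this.1
        exact ⟨k, Finset.mem_erase.2 ⟨fun e => this.2.2.2 (e ▸ hPk), hk⟩, hPk⟩
      · rw [Finset.card_erase_of_mem hlB]
        have := hcB.card_le
        omega
    have : a ∈ c A ∩ c B := Finset.mem_inter.2 ⟨haA, Finset.mem_of_mem_erase this⟩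
    rw [hinter] at this
    exact hal (by simpa using this)
  have hTsub : T ⊆ ((c A).erase l).biUnion (nodesOn T) := by
    intro P hP
    have hPm := (memT P).1 hP
    obtain ⟨k, hk, hPk⟩ := hcA.covers P hPm.2.2.1 hPm.2.1
    exact Finset.mem_biUnion.2 ⟨k, Finset.mem_erase.2 ⟨fun e => hPm.2.2.2 (e ▸ hPk), hk⟩,
      mem_nodesOn.2 ⟨hP, hPk⟩⟩
  have hcardA : ((c A).erase l).card = 3 := by
    have e1 := (Finset.card_le_card hTsub).trans
      (Finset.card_biUnion_le.trans (Finset.sum_le_card_nsmul _ _ _ hthree))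
    have e2 := Finset.card_erase_of_mem hlA
    have := hcA.card_le
    simp only [smul_eq_mul] at e1
    omega
  have hCT : C ∈ T := (memT C).2 ⟨hBC.symm, hAC.symm, hC, hcC.notMem l hlC⟩
  obtain ⟨a₁, ha₁, hCa₁⟩ := Finset.mem_biUnion.1 (hTsub hCT)
  obtain ⟨a₂, a₃, h23, he⟩ := Finset.card_eq_two.1
    (show (((c A).erase l).erase a₁).card = 2 by rw [Finset.card_erase_of_mem ha₁, hcardA])
  have ha₂ : a₂ ∈ ((c A).erase l).erase a₁ := by rw [he]; simp
  have ha₃ : a₃ ∈ ((c A).erase l).erase a₁ := by rw [he]; simp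
  have hcov : T ⊆ nodesOn T a₁ ∪ (nodesOn T a₂ ∪ nodesOn T a₃) := by
    intro P hP
    obtain ⟨k, hk, hPk⟩ := Finset.mem_biUnion.1 (hTsub hP)
    by_cases e : k = a₁
    · exact Finset.mem_union_left _ (e ▸ hPk)
    · have : k ∈ ((c A).erase l).erase a₁ := Finset.mem_erase.2 ⟨e, hk⟩
      rw [he] at this
      rcases Finset.mem_insert.1 this with rfl | h
      · exact Finset.mem_union_right _ (Finset.mem_union_left _ hPk)
      · rw [Finset.mem_singleton] at h
        exact Finset.mem_union_right _ (Finset.mem_union_right _ (h ▸ hPk))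
  have t1 := hthree a₁ ha₁
  have t2 := hthree a₂ (Finset.mem_of_mem_erase ha₂)
  have t3 := hthree a₃ (Finset.mem_of_mem_erase ha₃)
  have b1 := Finset.card_le_card hcov
  have b2 := Finset.card_union_add_card_inter (nodesOn T a₁) (nodesOn T a₂ ∪ nodesOn T a₃)
  have b3 := Finset.card_union_add_card_inter (nodesOn T a₂) (nodesOn T a₃)
  have i1 : nodesOn T a₁ ∩ (nodesOn T a₂ ∪ nodesOn T a₃) = ∅ := Finset.card_eq_zero.1 (by omega)
  have i2 : nodesOn T a₂ ∩ nodesOn T a₃ = ∅ := Finset.card_eq_zero.1 (by omega)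
  have d1 : ∀ P ∈ T, P ∈ a₁ → P ∉ a₂ ∧ P ∉ a₃ := by
    intro P hP hP₁
    constructor <;> intro hP₂
    · have : P ∈ nodesOn T a₁ ∩ (nodesOn T a₂ ∪ nodesOn T a₃) :=
        Finset.mem_inter.2 ⟨mem_nodesOn.2 ⟨hP, hP₁⟩,
          Finset.mem_union_left _ (mem_nodesOn.2 ⟨hP, hP₂⟩)⟩
      simp [i1] at this
    · have : P ∈ nodesOn T a₁ ∩ (nodesOn T a₂ ∪ nodesOn T a₃) :=
        Finset.mem_inter.2 ⟨mem_nodesOn.2 ⟨hP, hP₁⟩,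
          Finset.mem_union_right _ (mem_nodesOn.2 ⟨hP, hP₂⟩)⟩
      simp [i1] at this
  have d2 : ∀ P ∈ T, P ∈ a₃ → P ∉ a₂ := by
    intro P hP hP₃ hP₂
    have : P ∈ nodesOn T a₂ ∩ nodesOn T a₃ :=
      Finset.mem_inter.2 ⟨mem_nodesOn.2 ⟨hP, hP₂⟩, mem_nodesOn.2 ⟨hP, hP₃⟩⟩
    simp [i2] at this
  obtain ⟨f, fdeg, hf⟩ := exists_poly_of_lines ((c C).erase l)
    fun h hh => hcC.isLine h (Finset.mem_of_mem_erase hh)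
  obtain ⟨g, gdeg, hg⟩ := exists_poly_of_lines ((c B).erase l)
    fun h hh => hcB.isLine h (Finset.mem_of_mem_erase hh)
  rw [Finset.card_erase_of_mem hlC] at fdeg
  rw [Finset.card_erase_of_mem hlB] at gdeg
  have hcC4 := hcC.card_le
  have hcB4 := hcB.card_le
  have gT : ∀ P ∈ T, MvPolynomial.eval P g = 0 := by
    intro P hP
    have hPm := (memT P).1 hP
    obtain ⟨k, hk, hPk⟩ := hcB.covers P hPm.2.2.1 hPm.1
    exact (hg P).2 ⟨k, Finset.mem_erase.2 ⟨fun e => hPm.2.2.2 (e ▸ hPk), hk⟩, hPk⟩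
  have fT : ∀ P ∈ T, P ≠ C → MvPolynomial.eval P f = 0 := by
    intro P hP hPC
    have hPm := (memT P).1 hP
    obtain ⟨k, hk, hPk⟩ := hcC.covers P hPm.2.2.1 hPC
    exact (hf P).2 ⟨k, Finset.mem_erase.2 ⟨fun e => hPm.2.2.2 (e ▸ hPk), hk⟩, hPk⟩
  have hla : ∀ a ∈ (c A).erase l, IsLine a := fun a ha => hcA.isLine a (Finset.mem_of_mem_erase ha)
  have hla₂ := hla a₂ (Finset.mem_of_mem_erase ha₂)
  -- If g vanished on all of a₂, this line would belong to both covers.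
  obtain ⟨G, hG, hgG⟩ : ∃ G ∈ a₂, MvPolynomial.eval G g ≠ 0 := by
    by_contra! hcon
    obtain ⟨V, hV, hVc⟩ := hla₂.infinite.exists_subset_card_eq (((c B).erase l).card + 1)
    have : a₂ ∈ (c B).erase l := mem_of_card_lt
      (fun k hk => hcB.isLine k (Finset.mem_of_mem_erase hk)) hla₂ (T := V)
      (fun P hP => hV hP) (fun P hP => (hg P).1 (hcon P (hV hP))) (by omega)
    have h2 : a₂ ∈ c A ∩ c B := Finset.mem_inter.2 ⟨Finset.mem_of_mem_erase
      (Finset.mem_of_mem_erase ha₂), Finset.mem_of_mem_erase this⟩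
    rw [hinter, Finset.mem_singleton] at h2
    exact (Finset.mem_erase.1 this).1 h2
  have hCC := hCa₁
  rw [mem_nodesOn] at hCC
  have hfin : MvPolynomial.eval C f = 0 := by
    refine eval_eq_zero_of_grid (hla a₁ ha₁) hla₂ (hla a₃ (Finset.mem_of_mem_erase ha₃))
      (T₁ := (nodesOn T a₁).erase C) (T₂ := nodesOn T a₂) (T₃ := nodesOn T a₃)
      (by rw [Finset.card_erase_of_mem hCa₁]; omega) (by omega) (by omega) (fun P hP => ?_)
      (fun P hP => (mem_nodesOn.1 hP).2) (fun P hP => ?_) (by omega) (by omega) (fun P hP => ?_)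
      (fun P hP => ?_) hCC.2 (gT C hCT) hG hgG
    · obtain ⟨-, hP⟩ := Finset.mem_erase.1 hP
      rw [mem_nodesOn] at hP
      exact ⟨hP.2, d1 P hP.1 hP.2⟩
    · rw [mem_nodesOn] at hP
      exact ⟨hP.2, d2 P hP.1 hP.2⟩
    · simp only [Finset.mem_union, Finset.mem_erase, mem_nodesOn] at hP
      rcases hP with (hP | hP) | hP
      · exact fT P hP.2.1 hP.1
      · exact fT P hP.1 fun e => (d1 C hCT hCC.2).1 (e ▸ hP.2)
      · exact fT P hP.1 fun e => (d1 C hCT hCC.2).2 (e ▸ hP.2)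
    · simp only [Finset.mem_union, Finset.mem_erase, mem_nodesOn] at hP
      rcases hP with (hP | hP) | hP
      · exact gT P hP.2.1
      · exact gT P hP.1
      · exact gT P hP.1
  obtain ⟨k, hk, hCk⟩ := (hf C).1 hfin
  exact hcC.notMem k (Finset.mem_of_mem_erase hk) hCk

theorem exists_triad (H : FlatGC X c) {A B C : Plane} (hA : A ∈ X) (hB : B ∈ X)
    (hC : C ∈ X) (hAB : A ≠ B) (hAC : A ≠ C) (hBC : B ≠ C) {l : Set Plane}
    (hlA : l ∈ c A) (hlB : l ∈ c B) (hlC : l ∈ c C) : ∃ I, l ∈ I ∧ Triad X c I A B C := by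
  rcases H.exists_inter_card_eq_three hA hB hC hAB hAC hBC hlA hlB hlC with h | h | h
  · exact ⟨_, Finset.mem_inter.2 ⟨hlA, hlB⟩,
      H.triad_of_inter hA hB hC hAB hAC hBC h hlA hlB hlC⟩
  · exact ⟨_, Finset.mem_inter.2 ⟨hlA, hlC⟩,
      (H.triad_of_inter hA hC hB hAC hAB hBC.symm h hlA hlC hlB).swap.rotate⟩
  · exact ⟨_, Finset.mem_inter.2 ⟨hlB, hlC⟩,
      (H.triad_of_inter hB hC hA hBC hAB.symm hAC.symm h hlB hlC hlA).rotate.rotate⟩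

end FlatGC

end GCSets

/-! ### Configurations without five-node lines: the contradiction. -/

namespace GCSets

open scoped Classical

variable {X : Finset Plane} {c : Plane → Finset (Set Plane)}

namespace FlatGC

theorem notMem_of_triad (H : FlatGC X c) {I : Finset (Set Plane)} {A B C : Plane}
    (t : Triad X c I A B C) {h : Set Plane} (hh : h ∈ I) : A ∉ h ∧ B ∉ h ∧ C ∉ h :=
  ⟨(H.cover A t.mems.1).notMem h (t.mem h hh).1, (H.cover B t.mems.2.1).notMem h (t.mem h hh).2.1,
    (H.cover C t.mems.2.2).notMem h (t.mem h hh).2.2⟩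

/-- With a further user D in place of C the covers of A and B would again form a triad, so D would
be off all lines of I; only A, B and C are. -/
theorem eq_of_mem_users (H : FlatGC X c) {I : Finset (Set Plane)} {A B C D : Plane}
    (t : Triad X c I A B C) {h : Set Plane} (hh : h ∈ I) (hD : D ∈ X) (hDh : h ∈ c D) :
    D = A ∨ D = B ∨ D = C := by
  by_contra! hcon
  have hsub : I ⊆ c A ∩ c B := fun k hk => Finset.mem_inter.2 ⟨(t.mem k hk).1, (t.mem k hk).2.1⟩
  have h3 : (c A ∩ c B).card = 3 := by
    have h1 := Finset.card_le_card hsub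
    rw [t.card_eq] at h1
    rcases (H.inter_card t.mems.1 t.mems.2.1 t.ne.1 (t.mem h hh).1 (t.mem h hh).2.1).2 with h | h
    all_goals omega
  have t' := H.triad_of_inter t.mems.1 t.mems.2.1 hD t.ne.1 hcon.1.symm hcon.2.1.symm h3
    (t.mem h hh).1 (t.mem h hh).2.1 hDh
  rcases t.rest D hD with ⟨k, hk, hDk⟩ | h | h | h
  · exact (H.notMem_of_triad t' (hsub hk)).2.2 hDk
  · exact hcon.1 h
  · exact hcon.2.1 h
  · exact hcon.2.2 h

theorem card_users_le_one (H : FlatGC X c) {h : Set Plane} (h4 : (nodesOn X h).card ≠ 4) :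
    (users X c h).card ≤ 1 := by
  rw [Finset.card_le_one]
  intro A hA B hB
  rw [mem_users] at hA hB
  by_contra hAB
  exact h4 (H.inter_card hA.1 hB.1 hAB hA.2 hB.2).1

theorem exists_triad_of_card_users (H : FlatGC X c) {h : Set Plane} {A : Plane} (hA : A ∈ X)
    (hAh : h ∈ c A) (h3 : 3 ≤ (users X c h).card) :
    ∃ I B C, h ∈ I ∧ Triad X c I A B C := by
  obtain ⟨B, C, hBC, he⟩ : ∃ B C, B ≠ C ∧ {B, C} ⊆ (users X c h).erase A := by
    have : 1 < ((users X c h).erase A).card := by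
      rw [Finset.card_erase_of_mem (by simp [hA, hAh])]; omega
    obtain ⟨B, hB, C, hC, hBC⟩ := Finset.one_lt_card.1 this
    exact ⟨B, C, hBC, fun P hP => by
      simp only [Finset.mem_insert, Finset.mem_singleton] at hP
      rcases hP with rfl | rfl <;> assumption⟩
  have hB := he (show B ∈ {B, C} by simp)
  have hC := he (show C ∈ {B, C} by simp)
  simp only [Finset.mem_erase, mem_users] at hB hC
  obtain ⟨I, hI, t⟩ := H.exists_triad hA hB.2.1 hC.2.1 hB.1.symm hC.1.symm hBC hAh hB.2.2 hC.2.2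
  exact ⟨I, B, C, hI, t⟩

/-- A four-node line is used at most by the three nodes of a triad. Any other line has at most one
user, and a line of a cover has at least two nodes. -/
theorem card_users_le (H : FlatGC X c) {h : Set Plane} {A : Plane} (hA : A ∈ X) (hAh : h ∈ c A) :
    (users X c h).card + 1 ≤ (nodesOn X h).card := by
  have h2 := H.two_le_card hA hAh
  by_cases h4 : (nodesOn X h).card = 4
  · by_contra! hcon
    obtain ⟨I, B, C, hI, t⟩ := H.exists_triad_of_card_users hA hAh (by omega)
    have hsub : users X c h ⊆ {A, B, C} := fun D hD => by
      rw [mem_users] at hD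
      simpa using H.eq_of_mem_users t hI hD.1 hD.2
    have := (Finset.card_le_card hsub).trans Finset.card_le_three
    omega
  · have := H.card_users_le_one h4
    omega

/-- Any two nodes are joined by a line with two or four nodes, used one time less than it has
nodes. -/
theorem exists_line_users (H : FlatGC X c) {A D : Plane} (hA : A ∈ X) (hD : D ∈ X)
    (hAD : A ≠ D) : ∃ h, IsLine h ∧ A ∈ h ∧ D ∈ h ∧
      (users X c h).card + 1 = (nodesOn X h).card ∧
      ((nodesOn X h).card = 2 ∨ (nodesOn X h).card = 4) := by
  have hthrough : ∀ B ∈ X.erase A, ∃ h ∈ c B, A ∈ h := fun B hB => by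
    obtain ⟨hBA, hB⟩ := Finset.mem_erase.1 hB
    exact (H.cover B hB).covers A hA hBA.symm
  choose! g hg using hthrough
  set I := (X.erase A).image g with hI
  have hIm : ∀ h ∈ I, ∃ B ∈ X, h ∈ c B ∧ A ∈ h := by
    intro h hh
    obtain ⟨B, hB, rfl⟩ := Finset.mem_image.1 hh
    exact ⟨B, Finset.mem_of_mem_erase hB, hg B hB⟩
  have hIl : ∀ h ∈ I, IsLine h ∧ A ∈ h := fun h hh => by
    obtain ⟨B, hB, hhB, hAh⟩ := hIm h hh
    exact ⟨(H.cover B hB).isLine h hhB, hAh⟩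
  obtain ⟨h1, h2⟩ := sum_card_pencil_le (X := X) hIl
  have hle : ∀ h ∈ I, (users X c h).card ≤ ((nodesOn X h).erase A).card := by
    intro h hh
    obtain ⟨B, hB, hhB, hAh⟩ := hIm h hh
    rw [Finset.card_erase_of_mem (by simp [hA, hAh])]
    have := H.card_users_le hB hhB
    omega
  have hcov : X.erase A ⊆ I.biUnion (users X c) := by
    intro B hB
    exact Finset.mem_biUnion.2 ⟨g B, Finset.mem_image_of_mem g hB,
      mem_users.2 ⟨Finset.mem_of_mem_erase hB, (hg B hB).1⟩⟩
  have h3 := (Finset.card_le_card hcov).trans Finset.card_biUnion_le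
  have h4 := Finset.sum_le_sum hle
  have h5 := Finset.card_le_card h2
  -- Each of the fourteen nodes other than A uses a line of the pencil, so 14 ≤ ∑ users ≤ ∑ (nodes -
  -- 1) ≤ 14 with equality throughout.
  have h6 : ∑ h ∈ I, (users X c h).card = ∑ h ∈ I, ((nodesOn X h).erase A).card := by omega
  have h7 := (Finset.sum_eq_sum_iff_of_le hle).1 h6
  have h8 := Finset.eq_of_subset_of_card_le h2 (by omega)
  have hDm : D ∈ I.biUnion fun h => (nodesOn X h).erase A := by
    rw [h8]; simp [hD, hAD.symm]
  obtain ⟨h, hh, hDh⟩ := Finset.mem_biUnion.1 hDm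
  obtain ⟨B, hB, hhB, hAh⟩ := hIm h hh
  have h9 := h7 h hh
  rw [Finset.card_erase_of_mem (by simp [hA, hAh])] at h9
  have h10 := H.two_le_card hB hhB
  refine ⟨h, (hIl h hh).1, hAh, (mem_nodesOn.1 (Finset.mem_of_mem_erase hDh)).2, by omega, ?_⟩
  have h11 := H.card_le h (hIl h hh).1
  by_cases e : (nodesOn X h).card = 4
  · exact Or.inr e
  · have := H.card_users_le_one e
    omega

theorem card_users_eq (H : FlatGC X c) {h : Set Plane} (hh : IsLine h)
    (h2 : 2 ≤ (nodesOn X h).card) : (users X c h).card + 1 = (nodesOn X h).card ∧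
      ((nodesOn X h).card = 2 ∨ (nodesOn X h).card = 4) := by
  obtain ⟨A, hA, D, hD, hAD⟩ := Finset.one_lt_card.1 h2
  rw [mem_nodesOn] at hA hD
  obtain ⟨k, hk, hAk, hDk, hres⟩ := H.exists_line_users hA.1 hD.1 hAD
  rwa [← hh.eq_of_mem hk hAD hA.2 hD.2 hAk hDk] at hres

/-- The cover of a node of a triad consists of the three lines of the triad and a line through the
two other nodes, which contains no further nodes. -/
theorem exists_side (H : FlatGC X c) {I : Finset (Set Plane)} {A B C : Plane}
    (t : Triad X c I A B C) : ∃ k, IsLine k ∧ B ∈ k ∧ C ∈ k ∧ (nodesOn X k).card = 2 ∧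
      ∀ h ∈ c A, h ∈ I ∨ h = k := by
  obtain ⟨hA, hB, hC⟩ := t.mems
  have hcA := H.cover A hA
  have hsub : I ⊆ c A := fun h hh => (t.mem h hh).1
  obtain ⟨k, hk, hBk⟩ := hcA.covers B hB t.ne.1.symm
  have hkI : k ∉ I := fun h => (H.notMem_of_triad t h).2.1 hBk
  have hins : insert k I = c A := by
    apply Finset.eq_of_subset_of_card_le
    · exact Finset.insert_subset hk hsub
    · rw [Finset.card_insert_of_notMem hkI, t.card_eq]
      exact hcA.card_le
  have hall : ∀ h ∈ c A, h ∈ I ∨ h = k := fun h hh => by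
    rw [← hins] at hh
    exact (Finset.mem_insert.1 hh).symm
  have hCk : C ∈ k := by
    obtain ⟨k', hk', hCk'⟩ := hcA.covers C hC t.ne.2.1.symm
    rcases hall k' hk' with h | rfl
    · exact absurd hCk' (H.notMem_of_triad t h).2.2
    · exact hCk'
  have hkl := hcA.isLine k hk
  refine ⟨k, hkl, hBk, hCk, ?_, hall⟩
  obtain ⟨h1, h2⟩ := H.card_users_eq hkl (H.two_le_card hA hk)
  -- A four-node line k would lie in a second triad inside the same cover. The two triads share a
  -- line and hence its users, so B would use k.
  refine h2.resolve_right fun h4 => ?_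
  obtain ⟨I', B', C', hkI', t'⟩ := H.exists_triad_of_card_users hA hk (by omega)
  have hsub' : I' ⊆ c A := fun h hh => (t'.mem h hh).1
  obtain ⟨h, hh⟩ : (I ∩ I').Nonempty := by
    apply Finset.card_pos.1
    have e1 := Finset.card_union_add_card_inter I I'
    have e2 := Finset.card_le_card (Finset.union_subset hsub hsub')
    have := hcA.card_le
    rw [t.card_eq, t'.card_eq] at e1
    omega
  rw [Finset.mem_inter] at hh
  have hkB : k ∈ c B := by
    rcases H.eq_of_mem_users t' hh.2 hB (t.mem h hh.1).2.1 with e | e | e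
    · rw [e]; exact hk
    · rw [e]; exact (t'.mem k hkI').2.1
    · rw [e]; exact (t'.mem k hkI').2.2
  exact (H.cover B hB).notMem k hkB hBk

/-- Both triads are three-element subsets of the cover of A, which has at most four lines. -/
theorem two_triads (H : FlatGC X c) {I I' : Finset (Set Plane)} {A B C B' C' : Plane}
    (t : Triad X c I A B C) (t' : Triad X c I' A B' C') : ∃ h, h ∈ I ∧ h ∈ I' := by
  have hsub : I ⊆ c A := fun h hh => (t.mem h hh).1
  have hsub' : I' ⊆ c A := fun h hh => (t'.mem h hh).1
  obtain ⟨h, hh⟩ : (I ∩ I').Nonempty := by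
    apply Finset.card_pos.1
    have e1 := Finset.card_union_add_card_inter I I'
    have e2 := Finset.card_le_card (Finset.union_subset hsub hsub')
    have := (H.cover A t.mems.1).card_le
    rw [t.card_eq, t'.card_eq] at e1
    omega
  exact ⟨h, Finset.mem_inter.1 hh⟩

/-- Each node of a triad induces a perspectivity between any two lines of the triad. -/
theorem exists_perspective (H : FlatGC X c) {I : Finset (Set Plane)} {A B C P : Plane}
    (t : Triad X c I A B C) {l a : Set Plane} (hl : l ∈ I) (ha : a ∈ I) (hP : P ∈ X)
    (hPl : P ∈ l) : ∃ h, IsLine h ∧ A ∈ h ∧ P ∈ h ∧ ∃ P' ∈ nodesOn X a, P' ∈ h := by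
  obtain ⟨hA, hB, hC⟩ := t.mems
  have hAP : A ≠ P := fun e => (H.notMem_of_triad t hl).1 (e ▸ hPl)
  obtain ⟨h, hh, hAh, hPh, hu, h24⟩ := H.exists_line_users hA hP hAP
  refine ⟨h, hh, hAh, hPh, ?_⟩
  rcases h24 with h2 | h4
  -- If A and P are the only nodes of h, the user D of h belongs to a triad whose side opposite D is
  -- h, so A and P are its other nodes. It shares a line with the given triad, which makes P one of
  -- A, B, C.
  · exfalso
    have hnodes : ∀ Q ∈ X, Q ∈ h → Q = A ∨ Q = P := by
      intro Q hQ hQh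
      have hsub : ({A, P} : Finset Plane) ⊆ nodesOn X h := by
        intro R hR
        simp only [Finset.mem_insert, Finset.mem_singleton] at hR
        rcases hR with rfl | rfl <;> simp [*]
      have := Finset.eq_of_subset_of_card_le hsub (by rw [h2, Finset.card_pair hAP])
      have hQm : Q ∈ ({A, P} : Finset Plane) := by rw [this]; simp [hQ, hQh]
      simpa using hQm
    obtain ⟨D, hD⟩ : (users X c h).Nonempty := Finset.card_pos.1 (by omega)
    rw [mem_users] at hD
    obtain ⟨hDX, hhD⟩ := hD
    have hcD := H.cover D hDX
    obtain ⟨k, hkD, hk4⟩ : ∃ k ∈ c D, (nodesOn X k).card = 4 := by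
      by_contra! hcon
      have e1 := hcD.card_le_sum
      have e2 := Finset.sum_le_card_nsmul (c D) (fun h => (nodesOn X h).card) 3 (fun k hk => by
        have := H.card_le k (hcD.isLine k hk)
        have := hcon k hk
        omega)
      have := H.card_eq
      have := hcD.card_le
      simp only [smul_eq_mul] at e2
      omega
    have hk3 := (H.card_users_eq (hcD.isLine k hkD) (by omega)).1
    obtain ⟨I', D', D'', hkI', t'⟩ := H.exists_triad_of_card_users hDX hkD (by omega)
    obtain ⟨s, -, hs1, hs2, hs3, hs4⟩ := H.exists_side t'
    have hhs : h = s := (hs4 h hhD).resolve_left fun e => by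
      have := t'.four h e
      omega
    subst hhs
    have hAr : A = D' ∨ A = D'' := by
      rcases hnodes D' t'.mems.2.1 hs1 with e | e
      · exact Or.inl e.symm
      · rcases hnodes D'' t'.mems.2.2 hs2 with e' | e'
        · exact Or.inr e'.symm
        · exact absurd (e.trans e'.symm) t'.ne.2.2
    have hPr : P = D' ∨ P = D'' := by
      rcases hnodes D' t'.mems.2.1 hs1 with e | e
      · rcases hnodes D'' t'.mems.2.2 hs2 with e' | e'
        · exact absurd (e.trans e'.symm) t'.ne.2.2
        · exact Or.inr e'.symm
      · exact Or.inl e.symm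
    have tA : ∃ E F, Triad X c I' A E F := by
      rcases hAr with rfl | rfl
      · exact ⟨_, _, t'.rotate⟩
      · exact ⟨_, _, t'.rotate.rotate⟩
    obtain ⟨E, F, tA⟩ := tA
    obtain ⟨m, hmI, hmI'⟩ := H.two_triads t tA
    have hmP : m ∈ c P := by
      rcases hPr with rfl | rfl
      · exact (t'.mem m hmI').2.1
      · exact (t'.mem m hmI').2.2
    rcases H.eq_of_mem_users t hmI hP hmP with rfl | rfl | rfl
    · exact (H.notMem_of_triad t hl).1 hPl
    · exact (H.notMem_of_triad t hl).2.1 hPl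
    · exact (H.notMem_of_triad t hl).2.2 hPl
  -- Sides have only two nodes, so B and C are off h. If h missed the nodes of a, its three nodes
  -- other than A would lie on the two other lines of the triad, and h would be one of these, but A
  -- is not on them.
  · by_contra! hcon
    have hside : ∀ {B C : Plane}, Triad X c I A B C → B ∉ h := by
      intro B C t hBh
      obtain ⟨s, hs, hs1, hs2, hs3, -⟩ := H.exists_side t.rotate.rotate
      have := hh.eq_of_mem hs t.ne.1 hAh hBh hs1 hs2
      rw [this, hs3] at h4
      omega
    have hBh := hside t
    have hCh := hside t.swap.rotate
    have : h ∈ I.erase a := by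
      refine mem_of_card_lt (T := (nodesOn X h).erase A) (fun k hk => (H.cover A hA).isLine k
        (t.mem k (Finset.mem_of_mem_erase hk)).1) hh (fun Q hQ => ?_) (fun Q hQ => ?_) ?_
      · exact (mem_nodesOn.1 (Finset.mem_of_mem_erase hQ)).2
      · obtain ⟨hQA, hQ⟩ := Finset.mem_erase.1 hQ
        rw [mem_nodesOn] at hQ
        rcases t.rest Q hQ.1 with ⟨k, hk, hQk⟩ | e | e | e
        · exact ⟨k, Finset.mem_erase.2
            ⟨fun e => hcon Q (mem_nodesOn.2 ⟨hQ.1, e ▸ hQk⟩) hQ.2, hk⟩, hQk⟩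
        · exact absurd e hQA
        · exact absurd (e ▸ hQ.2) hBh
        · exact absurd (e ▸ hQ.2) hCh
      · rw [Finset.card_erase_of_mem ha, t.card_eq, Finset.card_erase_of_mem (by simp [hA, hAh]), h4]
        norm_num
    exact (H.notMem_of_triad t (Finset.mem_of_mem_erase this)).1 hAh

/-- The nodes A, B and C of a triad are centres of perspectivities between the nodes of two of its
lines, hence collinear; but the side through B and C has only two nodes. -/
theorem false (H : FlatGC X c) : False := by
  obtain ⟨A, hA⟩ : X.Nonempty := Finset.card_pos.1 (by rw [H.card_eq]; norm_num)
  have hcA := H.cover A hA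
  obtain ⟨l, hlA, hl4⟩ : ∃ k ∈ c A, (nodesOn X k).card = 4 := by
    by_contra! hcon
    have e1 := hcA.card_le_sum
    have e2 := Finset.sum_le_card_nsmul (c A) (fun h => (nodesOn X h).card) 3 (fun k hk => by
      have := H.card_le k (hcA.isLine k hk)
      have := hcon k hk
      omega)
    have := H.card_eq
    have := hcA.card_le
    simp only [smul_eq_mul] at e2
    omega
  have h3 := (H.card_users_eq (hcA.isLine l hlA) (by omega)).1
  obtain ⟨I, B, C, hlI, t⟩ := H.exists_triad_of_card_users hA hlA (by omega)
  obtain ⟨a, ha⟩ : (I.erase l).Nonempty := Finset.card_pos.1 (by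
    rw [Finset.card_erase_of_mem hlI, t.card_eq]; norm_num)
  obtain ⟨hal, haI⟩ := Finset.mem_erase.1 ha
  have hlines : ∀ h ∈ I, IsLine h := fun h hh => hcA.isLine h (t.mem h hh).1
  have hdet : collinearDet B C A = 0 := by
    refine collinearDet_eq_zero_of_perspectivity (hlines l hlI) (hlines a haI)
      (T₁ := nodesOn X l) (T₂ := nodesOn X a) (fun P hP => ?_) (fun P hP => ?_)
      (by rw [t.four l hlI, t.four a haI]) (by rw [t.four l hlI]; norm_num) ?_
    · rw [mem_nodesOn] at hP
      exact ⟨hP.2, fun h => hal (t.disj P hP.1 a haI l hlI h hP.2)⟩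
    · rw [mem_nodesOn] at hP
      exact ⟨hP.2, fun h => hal (t.disj P hP.1 a haI l hlI hP.2 h)⟩
    · have key : ∀ {A B C : Plane}, Triad X c I A B C → A ∉ l ∧ A ∉ a ∧
          ∀ P ∈ nodesOn X l, ∃ h, IsLine h ∧ A ∈ h ∧ P ∈ h ∧ ∃ P' ∈ nodesOn X a, P' ∈ h :=
        fun t => ⟨(H.notMem_of_triad t hlI).1, (H.notMem_of_triad t haI).1, fun P hP =>
          H.exists_perspective t hlI haI (mem_nodesOn.1 hP).1 (mem_nodesOn.1 hP).2⟩
      rintro W (rfl | rfl | rfl)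
      · exact key t.rotate
      · exact key t.rotate.rotate
      · exact key t
  obtain ⟨s, hs, hBs, hCs, hs2, -⟩ := H.exists_side t
  have hAs := hs.mem_of_collinearDet t.ne.2.2 hBs hCs hdet
  have hsub : ({A, B, C} : Finset Plane) ⊆ nodesOn X s := by
    intro P hP
    simp only [Finset.mem_insert, Finset.mem_singleton] at hP
    rcases hP with rfl | rfl | rfl
    · simp [t.mems, hAs]
    · simp [t.mems, hBs]
    · simp [t.mems, hCs]
  have := Finset.card_le_card hsub
  rw [hs2, Finset.card_eq_three.2 ⟨A, B, C, t.ne.1, t.ne.2.1, t.ne.2.2, rfl⟩] at this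
  omega

end FlatGC

/-- The Gasca–Maeztu conjecture for `n = 4`. -/
theorem LineGC.exists_isMax_four {X : Finset Plane} (hX : LineGC 4 X) : ∃ h, IsMax 4 X h := by
  by_contra! hmax
  choose! c hc using hX.exists_cover
  refine FlatGC.false (X := X) (c := c) ⟨by have := hX.card_eq; omega, fun h hh => ?_, hc⟩
  have h1 := hX.card_nodesOn_le hh
  have h2 : (nodesOn X h).card ≠ 5 := fun e => hmax h ⟨hh, e⟩
  omega

end GCSets

/-! ### Generic four-node lines: four maximal lines are impossible. -/

namespace GCSets

open scoped Classical

variable {X : Finset Plane} {l : Set Plane}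

/-- `l` is a line with four nodes that meets every maximal line in a node, and no two maximal
lines meet in a node of `l`. -/
structure Generic (X : Finset Plane) (l : Set Plane) : Prop where
  gc : LineGC 4 X
  line : IsLine l
  four : (nodesOn X l).card = 4
  meets : ∀ M, IsMax 4 X M → ∃ A ∈ X, A ∈ M ∧ A ∈ l
  distinct : ∀ M M', IsMax 4 X M → IsMax 4 X M' → M ≠ M' → ∀ A ∈ X, A ∈ M → A ∈ M' → A ∉ l

theorem Generic.ne (H : Generic X l) {M : Set Plane} (hM : IsMax 4 X M) : M ≠ l := by
  rintro rfl
  have := hM.2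
  rw [H.four] at this
  omega

/-- Two colours are forced on a complete graph with four vertices. -/
theorem all_eq_or_exists_eq {α : Type*} (f g : Fin 4 → α) (hg : Function.Injective g)
    (hfg : ∀ j, f j ≠ g j) (h : ∀ i j, i ≠ j → f i = f j ∨ g i = f j ∨ f i = g j) :
    (∀ i, f i = f 0) ∨ ∃ k, ∀ j, j ≠ k → f j = g k := by
  by_contra! hcon
  have g01 : g 0 ≠ g 1 := hg.ne (by decide)
  have g02 : g 0 ≠ g 2 := hg.ne (by decide)
  have g03 : g 0 ≠ g 3 := hg.ne (by decide)
  have g12 : g 1 ≠ g 2 := hg.ne (by decide)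
  have g13 : g 1 ≠ g 3 := hg.ne (by decide)
  have g23 : g 2 ≠ g 3 := hg.ne (by decide)
  have f0 := hfg 0
  have f1 := hfg 1
  have f2 := hfg 2
  have f3 := hfg 3
  have h01 := h 0 1 (by decide)
  have h02 := h 0 2 (by decide)
  have h03 := h 0 3 (by decide)
  have h12 := h 1 2 (by decide)
  have h13 := h 1 3 (by decide)
  have h23 := h 2 3 (by decide)
  have c : ¬ (f 1 = f 0 ∧ f 2 = f 0 ∧ f 3 = f 0) := by
    rintro ⟨a, b, d⟩
    obtain ⟨i, hi⟩ := hcon.1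
    fin_cases i <;> simp_all
  have k0 : ¬ (f 1 = g 0 ∧ f 2 = g 0 ∧ f 3 = g 0) := by
    rintro ⟨a, b, d⟩
    obtain ⟨i, hi, hi'⟩ := hcon.2 0
    fin_cases i <;> simp_all
  have k1 : ¬ (f 0 = g 1 ∧ f 2 = g 1 ∧ f 3 = g 1) := by
    rintro ⟨a, b, d⟩
    obtain ⟨i, hi, hi'⟩ := hcon.2 1
    fin_cases i <;> simp_all
  have k2 : ¬ (f 0 = g 2 ∧ f 1 = g 2 ∧ f 3 = g 2) := by
    rintro ⟨a, b, d⟩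
    obtain ⟨i, hi, hi'⟩ := hcon.2 2
    fin_cases i <;> simp_all
  have k3 : ¬ (f 0 = g 3 ∧ f 1 = g 3 ∧ f 2 = g 3) := by
    rintro ⟨a, b, d⟩
    obtain ⟨i, hi, hi'⟩ := hcon.2 3
    fin_cases i <;> simp_all
  clear hcon h hg hfg
  generalize f 0 = a0 at *
  generalize f 1 = a1 at *
  generalize f 2 = a2 at *
  generalize f 3 = a3 at *
  generalize g 0 = b0 at *
  generalize g 1 = b1 at *
  generalize g 2 = b2 at *
  generalize g 3 = b3 at *
  grind

/-- In the cover of the common node of M and M' every line passes through one further node of each,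
and some line contains G. -/
theorem LineGC.exists_line_through {Z : Finset Plane} (hZ : LineGC 2 Z) {M M' : Set Plane}
    (hM : IsMax 2 Z M) (hM' : IsMax 2 Z M') (hMM : M ≠ M') {G : Plane} (hG : G ∈ Z)
    (hGM : G ∉ M) : ∃ k, IsLine k ∧ G ∈ k ∧ (∃ A ∈ Z, A ∈ M ∧ A ∉ M' ∧ A ∈ k) ∧
      ∃ B ∈ Z, B ∈ M' ∧ B ∉ M ∧ B ∈ k := by
  obtain ⟨V, hV, hVM, hVM'⟩ := hZ.exists_mem_inter hM hM'
  obtain ⟨S, hS⟩ := hZ.exists_cover V hV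
  obtain ⟨f, F, -, -, -⟩ := hM.exists_matching_self hV hVM hS
  obtain ⟨f', F', -, -, -⟩ := hM'.exists_matching_self hV hVM' hS
  obtain ⟨k, hk, hGk⟩ := hS.covers G hG fun e => hGM (e ▸ hVM)
  have a := F k hk
  have b := F' k hk
  simp only [Finset.mem_erase, mem_nodesOn] at a b
  refine ⟨k, hS.isLine k hk, hGk, ⟨f k, a.1.2.1, a.1.2.2, fun h => a.1.1 ?_, a.2⟩,
    ⟨f' k, b.1.2.1, b.1.2.2, fun h => b.1.1 ?_, b.2⟩⟩
  · exact hM.1.point_eq hM'.1 hMM a.1.2.2 hVM h hVM'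
  · exact hM.1.point_eq hM'.1 hMM h hVM b.1.2.2 hVM'

section Remove

variable {a b d h : Set Plane}

theorem LineGC.remove_two (hX : LineGC 4 X) (ha : IsMax 4 X a) (hb : IsMax 4 X b) (hab : a ≠ b) :
    LineGC 2 (nodesOff (nodesOff X a) b) :=
  (hX.remove ha).remove (hX.isMax_nodesOff hb ha hab.symm)

theorem LineGC.isMax_remove_two (hX : LineGC 4 X) (ha : IsMax 4 X a) (hb : IsMax 4 X b)
    (hab : a ≠ b) (hh : IsMax 4 X h) (hha : h ≠ a) (hhb : h ≠ b) :
    IsMax 2 (nodesOff (nodesOff X a) b) h :=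
  (hX.remove ha).isMax_nodesOff (hX.isMax_nodesOff hh ha hha)
    (hX.isMax_nodesOff hb ha hab.symm) hhb

theorem LineGC.remove_three (hX : LineGC 4 X) (ha : IsMax 4 X a) (hb : IsMax 4 X b)
    (hd : IsMax 4 X d) (hab : a ≠ b) (had : a ≠ d) (hbd : b ≠ d) :
    LineGC 1 (nodesOff (nodesOff (nodesOff X a) b) d) :=
  (hX.remove_two ha hb hab).remove (hX.isMax_remove_two ha hb hab hd had.symm hbd.symm)

theorem LineGC.isMax_remove_three (hX : LineGC 4 X) (ha : IsMax 4 X a) (hb : IsMax 4 X b)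
    (hd : IsMax 4 X d) (hab : a ≠ b) (had : a ≠ d) (hbd : b ≠ d) (hh : IsMax 4 X h) (hha : h ≠ a)
    (hhb : h ≠ b) (hhd : h ≠ d) : IsMax 1 (nodesOff (nodesOff (nodesOff X a) b) d) h :=
  (hX.remove_two ha hb hab).isMax_nodesOff (hX.isMax_remove_two ha hb hab hh hha hhb)
    (hX.isMax_remove_two ha hb hab hd had.symm hbd.symm) hhd

theorem LineGC.remove_four (hX : LineGC 4 X) (ha : IsMax 4 X a) (hb : IsMax 4 X b)
    (hd : IsMax 4 X d) (hab : a ≠ b) (had : a ≠ d) (hbd : b ≠ d) (hh : IsMax 4 X h) (hha : h ≠ a)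
    (hhb : h ≠ b) (hhd : h ≠ d) :
    LineGC 0 (nodesOff (nodesOff (nodesOff (nodesOff X a) b) d) h) :=
  (hX.remove_three ha hb hd hab had hbd).remove
    (hX.isMax_remove_three ha hb hd hab had hbd hh hha hhb hhd)

end Remove

theorem isMax_four_of_card {X : Finset Plane} (hX : LineGC 4 X) {h : Set Plane} (hh : IsLine h)
    {T : Finset Plane} (hT : ∀ A ∈ T, A ∈ X ∧ A ∈ h) (hc : 5 ≤ T.card) : IsMax 4 X h := by
  refine ⟨hh, le_antisymm (hX.card_nodesOn_le hh) (hc.trans (Finset.card_le_card fun A hA => ?_))⟩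
  exact mem_nodesOn.2 (hT A hA)

/-- Each line has three intersection nodes and two private ones: P i on l, and W i. Let G be the
node off all four lines. For i ≠ j a line through G joins a private node of `M i` to one of `M j`,
and not both are on l since G is not. This forces the lines G W i all to coincide, or three of them
to coincide with G P k for the remaining k. Both lines would have five nodes. The first would meet l
in some P i and so equal `M i`, although G is off it; the second would meet `M k` in a node of l. -/
theorem Generic.not_four (H : Generic X l) (M : Fin 4 → Set Plane) (hinj : Function.Injective M)
    (hM : ∀ i, IsMax 4 X (M i)) : False := by
  have hX := H.gc
  have other : ∀ i j : Fin 4, i ≠ j → ∃ k m, i ≠ k ∧ i ≠ m ∧ j ≠ k ∧ j ≠ m ∧ k ≠ m ∧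
      ∀ x, x = i ∨ x = j ∨ x = k ∨ x = m := by decide
  have n : ∀ {i j}, i ≠ j → M i ≠ M j := fun h => hinj.ne h
  -- the node off all four lines
  obtain ⟨G, hGX, hGM⟩ : ∃ G ∈ X, ∀ i, G ∉ M i := by
    have h0 := (hX.remove_four (hM 0) (hM 1) (hM 2) (n (by decide)) (n (by decide))
      (n (by decide)) (hM 3) (n (by decide)) (n (by decide)) (n (by decide))).card_eq
    obtain ⟨G, hG⟩ := Finset.card_pos.1 (show 0 < (nodesOff (nodesOff (nodesOff (nodesOff X (M 0))
      (M 1)) (M 2)) (M 3)).card by omega)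
    simp only [mem_nodesOff] at hG
    refine ⟨G, hG.1.1.1.1, fun i => ?_⟩
    fin_cases i
    · exact hG.1.1.1.2
    · exact hG.1.1.2
    · exact hG.1.2
    · exact hG.2
  choose P hPX hPM hPl using fun i => H.meets (M i) (hM i)
  have hPinj : ∀ {i j}, i ≠ j → P i ≠ P j := fun {i j} hij e =>
    H.distinct _ _ (hM i) (hM j) (n hij) (P i) (hPX i) (hPM i) (e ▸ hPM j) (hPl i)
  have hPinj' : Function.Injective P := fun i j e => by_contra fun h => hPinj h e
  have hPo : ∀ {i j}, i ≠ j → P i ∉ M j := fun {i j} hij h =>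
    H.distinct _ _ (hM i) (hM j) (n hij) (P i) (hPX i) (hPM i) h (hPl i)
  have hlP : ∀ A ∈ X, A ∈ l → ∃ i, A = P i := by
    have : Finset.univ.image P = nodesOn X l := by
      apply Finset.eq_of_subset_of_card_le
      · intro A hA
        obtain ⟨i, -, rfl⟩ := Finset.mem_image.1 hA
        exact mem_nodesOn.2 ⟨hPX i, hPl i⟩
      · rw [Finset.card_image_of_injective _ hPinj', H.four]
        simp
    intro A hA hAl
    have hAm : A ∈ Finset.univ.image P := by rw [this]; simp [hA, hAl]
    obtain ⟨i, -, e⟩ := Finset.mem_image.1 hAm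
    exact ⟨i, e.symm⟩
  have hGl : G ∉ l := fun h => by
    obtain ⟨i, e⟩ := hlP G hGX h
    exact hGM i (e ▸ hPM i)
  -- the second private node of each line
  have hW : ∀ i, ∃ W ∈ X, W ∈ M i ∧ W ≠ P i ∧ (∀ j, j ≠ i → W ∉ M j) ∧
      ∀ A ∈ X, A ∈ M i → (∀ j, j ≠ i → A ∉ M j) → A = P i ∨ A = W := by
    intro i
    obtain ⟨j, hij⟩ : ∃ j : Fin 4, i ≠ j := ⟨i + 1, by revert i; decide⟩
    obtain ⟨k, m, hik, him, hjk, hjm, hkm, hall⟩ := other i j hij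
    have h2 := (hX.isMax_remove_three (hM j) (hM k) (hM m) (n hjk) (n hjm) (n hkm) (hM i) (n hij)
      (n hik) (n him)).2
    set Y := nodesOn (nodesOff (nodesOff (nodesOff X (M j)) (M k)) (M m)) (M i) with hY
    have memY : ∀ A, A ∈ Y ↔ A ∈ X ∧ A ∈ M i ∧ ∀ x, x ≠ i → A ∉ M x := by
      intro A
      simp only [hY, mem_nodesOn, mem_nodesOff]
      constructor
      · rintro ⟨⟨⟨⟨a, b⟩, c⟩, d⟩, e⟩
        refine ⟨a, e, fun x hx => ?_⟩
        rcases hall x with rfl | rfl | rfl | rfl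
        · exact absurd rfl hx
        all_goals assumption
      · rintro ⟨a, b, c⟩
        exact ⟨⟨⟨⟨a, c j hij.symm⟩, c k hik.symm⟩, c m him.symm⟩, b⟩
    have hPY : P i ∈ Y := (memY _).2 ⟨hPX i, hPM i, fun x hx => hPo hx.symm⟩
    obtain ⟨W, hWe⟩ := Finset.card_eq_one.1
      (show (Y.erase (P i)).card = 1 by rw [Finset.card_erase_of_mem hPY, h2])
    have hWm : W ∈ Y.erase (P i) := by rw [hWe]; simp
    obtain ⟨hWP, hWY⟩ := Finset.mem_erase.1 hWm
    have hWY' := (memY W).1 hWY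
    refine ⟨W, hWY'.1, hWY'.2.1, hWP, hWY'.2.2, fun A hA hAM hAo => ?_⟩
    by_cases e : A = P i
    · exact Or.inl e
    · have : A ∈ Y.erase (P i) := Finset.mem_erase.2 ⟨e, (memY A).2 ⟨hA, hAM, hAo⟩⟩
      rw [hWe] at this
      exact Or.inr (by simpa using this)
  choose W hWX hWM hWP hWo hWall using hW
  have hGW : ∀ i, G ≠ W i := fun i e => hGM i (e ▸ hWM i)
  have hGP : ∀ i, G ≠ P i := fun i e => hGM i (e ▸ hPM i)
  choose f hf hfG hfW using fun i => exists_line G (W i)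
  choose g hg hgG hgP using fun i => exists_line G (P i)
  have hginj : Function.Injective g := by
    intro i j e
    by_contra hij
    have : g i = l := (hg i).eq_of_mem H.line (hPinj hij) (hgP i) (e ▸ hgP j) (hPl i) (hPl j)
    exact hGl (this ▸ hgG i)
  have hfg : ∀ j, f j ≠ g j := by
    intro j e
    have : f j = M j := (hf j).eq_of_mem (hM j).1 (hWP j) (hfW j) (e ▸ hgP j) (hWM j) (hPM j)
    exact hGM j (this ▸ hfG j)
  have hpair : ∀ i j, i ≠ j → f i = f j ∨ g i = f j ∨ f i = g j := by
    intro i j hij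
    obtain ⟨k, m, hik, him, hjk, hjm, hkm, hall⟩ := other i j hij
    obtain ⟨h, hh, hGh, ⟨A, hA, hAi, hAj, hAh⟩, ⟨B, hB, hBj, hBi, hBh⟩⟩ :=
      (hX.remove_two (hM k) (hM m) (n hkm)).exists_line_through
        (hX.isMax_remove_two (hM k) (hM m) (n hkm) (hM i) (n hik) (n him))
        (hX.isMax_remove_two (hM k) (hM m) (n hkm) (hM j) (n hjk) (n hjm)) (n hij)
        (G := G) (by simp [hGX, hGM]) (hGM i)
    simp only [mem_nodesOff] at hA hB
    have cA := hWall i A hA.1.1 hAi fun x hx => by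
      rcases hall x with rfl | rfl | rfl | rfl
      · exact absurd rfl hx
      · exact hAj
      · exact hA.1.2
      · exact hA.2
    have cB := hWall j B hB.1.1 hBj fun x hx => by
      rcases hall x with rfl | rfl | rfl | rfl
      · exact hBi
      · exact absurd rfl hx
      · exact hB.1.2
      · exact hB.2
    have ef : ∀ i, W i ∈ h → h = f i := fun i hi =>
      hh.eq_of_mem (hf i) (hGW i) hGh hi (hfG i) (hfW i)
    have eg : ∀ i, P i ∈ h → h = g i := fun i hi =>
      hh.eq_of_mem (hg i) (hGP i) hGh hi (hgG i) (hgP i)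
    rcases cA with rfl | rfl <;> rcases cB with rfl | rfl
    · exact absurd (hginj ((eg i hAh).symm.trans (eg j hBh))) hij
    · exact Or.inr (Or.inl ((eg i hAh).symm.trans (ef j hBh)))
    · exact Or.inr (Or.inr ((ef i hAh).symm.trans (eg j hBh)))
    · exact Or.inl ((ef i hAh).symm.trans (ef j hBh))
  have hWinj : Function.Injective W := fun i j e => by
    by_contra hij
    exact hWo i j (Ne.symm hij) (e ▸ hWM j)
  rcases all_eq_or_exists_eq f g hginj hfg hpair with hall | ⟨k, hk⟩
  · have hmax : IsMax 4 X (f 0) := by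
      refine isMax_four_of_card hX (hf 0) (T := insert G (Finset.univ.image W)) (fun A hA => ?_) ?_
      · rcases Finset.mem_insert.1 hA with rfl | hA
        · exact ⟨hGX, hfG 0⟩
        · obtain ⟨i, -, rfl⟩ := Finset.mem_image.1 hA
          exact ⟨hWX i, hall i ▸ hfW i⟩
      · rw [Finset.card_insert_of_notMem, Finset.card_image_of_injective _ hWinj]
        · simp
        · simp only [Finset.mem_image, not_exists, not_and]
          exact fun i _ e => hGW i e.symm
    obtain ⟨A, hA, hAf, hAl⟩ := H.meets _ hmax
    obtain ⟨i, rfl⟩ := hlP A hA hAl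
    have : f 0 = M i := (hf 0).eq_of_mem (hM i).1 (hWP i) (hall i ▸ hfW i) hAf (hWM i) (hPM i)
    exact hGM i (this ▸ hfG 0)
  · have hmax : IsMax 4 X (g k) := by
      refine isMax_four_of_card hX (hg k)
        (T := insert G (insert (P k) ((Finset.univ.erase k).image W))) (fun A hA => ?_) ?_
      · rcases Finset.mem_insert.1 hA with rfl | hA
        · exact ⟨hGX, hgG k⟩
        rcases Finset.mem_insert.1 hA with rfl | hA
        · exact ⟨hPX k, hgP k⟩
        · obtain ⟨i, hi, rfl⟩ := Finset.mem_image.1 hA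
          exact ⟨hWX i, hk i (Finset.ne_of_mem_erase hi) ▸ hfW i⟩
      · rw [Finset.card_insert_of_notMem, Finset.card_insert_of_notMem,
          Finset.card_image_of_injective _ hWinj]
        · simp
        · simp only [Finset.mem_image, not_exists, not_and, Finset.mem_erase]
          exact fun i hi e => hPo (Ne.symm hi.1) (e ▸ hWM i)
        · simp only [Finset.mem_insert, Finset.mem_image, not_or, not_exists, not_and]
          exact ⟨hGP k, fun i _ e => hGW i e.symm⟩
    refine H.distinct _ _ hmax (hM k) (fun e => hGM k (e ▸ hgG k)) (P k) (hPX k) (hgP k) (hPM k)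
      (hPl k)

end GCSets

/-! ### Generic four-node lines: three maximal lines and a triangle. -/

namespace GCSets

open scoped Classical

/-- The line `s` passes through a node of `M₁` which is on neither `M₂` nor `M₃`. -/
def Hits (X : Finset Plane) (M₁ M₂ M₃ s : Set Plane) : Prop :=
  ∃ V ∈ X, V ∈ M₁ ∧ V ∉ M₂ ∧ V ∉ M₃ ∧ V ∈ s

/-- Three maximal lines, the remaining nodes `E`, `F`, `G`, and the sides of their triangle. -/
structure Config (X : Finset Plane) (l M₁ M₂ M₃ : Set Plane) (E F G : Plane)
    (e f g : Set Plane) : Prop where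
  gen : Generic X l
  max₁ : IsMax 4 X M₁
  max₂ : IsMax 4 X M₂
  max₃ : IsMax 4 X M₃
  ne₁₂ : M₁ ≠ M₂
  ne₁₃ : M₁ ≠ M₃
  ne₂₃ : M₂ ≠ M₃
  memE : E ∈ X ∧ E ∉ M₁ ∧ E ∉ M₂ ∧ E ∉ M₃
  memF : F ∈ X ∧ F ∉ M₁ ∧ F ∉ M₂ ∧ F ∉ M₃
  memG : G ∈ X ∧ G ∉ M₁ ∧ G ∉ M₂ ∧ G ∉ M₃
  rest : ∀ P ∈ X, P ∉ M₁ → P ∉ M₂ → P ∉ M₃ → P = E ∨ P = F ∨ P = G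
  El : E ∈ l
  Fl : F ∉ l
  Gl : G ∉ l
  le : IsLine e ∧ F ∈ e ∧ G ∈ e ∧ E ∉ e
  lf : IsLine f ∧ E ∈ f ∧ G ∈ f ∧ F ∉ f
  lg : IsLine g ∧ E ∈ g ∧ F ∈ g ∧ G ∉ g

variable {X : Finset Plane} {l M₁ M₂ M₃ : Set Plane} {E F G : Plane} {e f g : Set Plane}

theorem Hits.swap {s : Set Plane} (h : Hits X M₁ M₂ M₃ s) : Hits X M₁ M₃ M₂ s := by
  obtain ⟨V, a, b, c, d, i⟩ := h
  exact ⟨V, a, b, d, c, i⟩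

namespace Config

theorem swap₂₃ (H : Config X l M₁ M₂ M₃ E F G e f g) : Config X l M₁ M₃ M₂ E F G e f g where
  gen := H.gen
  max₁ := H.max₁
  max₂ := H.max₃
  max₃ := H.max₂
  ne₁₂ := H.ne₁₃
  ne₁₃ := H.ne₁₂
  ne₂₃ := H.ne₂₃.symm
  memE := ⟨H.memE.1, H.memE.2.1, H.memE.2.2.2, H.memE.2.2.1⟩
  memF := ⟨H.memF.1, H.memF.2.1, H.memF.2.2.2, H.memF.2.2.1⟩
  memG := ⟨H.memG.1, H.memG.2.1, H.memG.2.2.2, H.memG.2.2.1⟩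
  rest P hP h1 h2 h3 := H.rest P hP h1 h3 h2
  El := H.El
  Fl := H.Fl
  Gl := H.Gl
  le := H.le
  lf := H.lf
  lg := H.lg

theorem swap₁₂ (H : Config X l M₁ M₂ M₃ E F G e f g) : Config X l M₂ M₁ M₃ E F G e f g where
  gen := H.gen
  max₁ := H.max₂
  max₂ := H.max₁
  max₃ := H.max₃
  ne₁₂ := H.ne₁₂.symm
  ne₁₃ := H.ne₂₃
  ne₂₃ := H.ne₁₃
  memE := ⟨H.memE.1, H.memE.2.2.1, H.memE.2.1, H.memE.2.2.2⟩
  memF := ⟨H.memF.1, H.memF.2.2.1, H.memF.2.1, H.memF.2.2.2⟩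
  memG := ⟨H.memG.1, H.memG.2.2.1, H.memG.2.1, H.memG.2.2.2⟩
  rest P hP h1 h2 h3 := H.rest P hP h2 h1 h3
  El := H.El
  Fl := H.Fl
  Gl := H.Gl
  le := H.le
  lf := H.lf
  lg := H.lg

theorem swapFG (H : Config X l M₁ M₂ M₃ E F G e f g) : Config X l M₁ M₂ M₃ E G F e g f where
  gen := H.gen
  max₁ := H.max₁
  max₂ := H.max₂
  max₃ := H.max₃
  ne₁₂ := H.ne₁₂
  ne₁₃ := H.ne₁₃
  ne₂₃ := H.ne₂₃
  memE := H.memE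
  memF := H.memG
  memG := H.memF
  rest P hP h1 h2 h3 := (H.rest P hP h1 h2 h3).imp_right Or.symm
  El := H.El
  Fl := H.Gl
  Gl := H.Fl
  le := ⟨H.le.1, H.le.2.2.1, H.le.2.1, H.le.2.2.2⟩
  lf := H.lg
  lg := H.lf

theorem exists_node (H : Config X l M₁ M₂ M₃ E F G e f g) :
    ∃ P ∈ X, P ∈ M₁ ∧ P ∉ M₂ ∧ P ∉ M₃ ∧ P ∈ l := by
  obtain ⟨P, hP, hPM, hPl⟩ := H.gen.meets M₁ H.max₁
  exact ⟨P, hP, hPM, fun h => H.gen.distinct _ _ H.max₁ H.max₂ H.ne₁₂ P hP hPM h hPl,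
    fun h => H.gen.distinct _ _ H.max₁ H.max₃ H.ne₁₃ P hP hPM h hPl, hPl⟩

/-- A private node of `M₁` avoids some side that passes through another private node of `M₁`. -/
theorem exists_side_avoiding (H : Config X l M₁ M₂ M₃ E F G e f g) {W : Plane} (hW : W ∈ X)
    (hW₁ : W ∈ M₁) (hW₂ : W ∉ M₂) (hW₃ : W ∉ M₃) :
    ∃ s, (s = e ∨ s = f ∨ s = g) ∧ ∃ V ∈ X, V ∈ M₁ ∧ V ∉ M₂ ∧ V ∉ M₃ ∧ V ∈ s ∧ V ≠ W := by
  have hX := H.gen.gc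
  set Z := nodesOff (nodesOff X M₂) M₃ with hZ
  have gZ : LineGC 2 Z := hX.remove_two H.max₂ H.max₃ H.ne₂₃
  have mZ : IsMax 2 Z M₁ := hX.isMax_remove_two H.max₂ H.max₃ H.ne₂₃ H.max₁ H.ne₁₂ H.ne₁₃
  have memZ : ∀ A, A ∈ Z ↔ A ∈ X ∧ A ∉ M₂ ∧ A ∉ M₃ := fun A => by simp [hZ, and_assoc]
  obtain ⟨S, hS⟩ := gZ.exists_cover W ((memZ W).2 ⟨hW, hW₂, hW₃⟩)
  obtain ⟨φ, Φ, -⟩ := mZ.exists_matching_self ((memZ W).2 ⟨hW, hW₂, hW₃⟩) hW₁ hS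
  have key : ∀ s ∈ S, ∃ V ∈ X, V ∈ M₁ ∧ V ∉ M₂ ∧ V ∉ M₃ ∧ V ∈ s ∧ V ≠ W := by
    intro s hs
    obtain ⟨a, b⟩ := Φ s hs
    simp only [Finset.mem_erase, mem_nodesOn, memZ] at a
    exact ⟨φ s, a.2.1.1, a.2.2, a.2.1.2.1, a.2.1.2.2, b, a.1⟩
  have cov : ∀ P, P ∈ X ∧ P ∉ M₁ ∧ P ∉ M₂ ∧ P ∉ M₃ → ∃ s ∈ S, P ∈ s := fun P hP =>
    hS.covers P ((memZ P).2 ⟨hP.1, hP.2.2⟩) fun e => hP.2.1 (e ▸ hW₁)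
  obtain ⟨a, ha, Ea⟩ := cov E H.memE
  obtain ⟨b, hb, Fb⟩ := cov F H.memF
  obtain ⟨d, hd, Gd⟩ := cov G H.memG
  have hEF : E ≠ F := fun h => H.Fl (h ▸ H.El)
  have hEG : E ≠ G := fun h => H.Gl (h ▸ H.El)
  have hFG : F ≠ G := fun h => H.lg.2.2.2 (h ▸ H.lg.2.2.1)
  have h2 := hS.card_le
  -- Two lines cover E, F and G, so one of them is a side.
  have hsome : a = b ∨ a = d ∨ b = d := by
    by_contra! hcon
    have hsub : ({a, b, d} : Finset (Set Plane)) ⊆ S := by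
      intro k hk
      simp only [Finset.mem_insert, Finset.mem_singleton] at hk
      rcases hk with rfl | rfl | rfl <;> assumption
    have := Finset.card_le_card hsub
    rw [Finset.card_eq_three.2 ⟨a, b, d, hcon.1, hcon.2.1, hcon.2.2, rfl⟩] at this
    omega
  rcases hsome with rfl | rfl | rfl
  · exact ⟨a, Or.inr (Or.inr ((hS.isLine a ha).eq_of_mem H.lg.1 hEF Ea Fb H.lg.2.1 H.lg.2.2.1)),
      key a ha⟩
  · exact ⟨a, Or.inr (Or.inl ((hS.isLine a ha).eq_of_mem H.lf.1 hEG Ea Gd H.lf.2.1 H.lf.2.2.1)),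
      key a ha⟩
  · exact ⟨b, Or.inl ((hS.isLine b hb).eq_of_mem H.le.1 hFG Fb Gd H.le.2.1 H.le.2.2.1),
      key b hb⟩

/-- The previous lemma gives a side through a private node V and, applied to V, a side through a
private node V' ≠ V. They differ, since a side containing both would be M₁. -/
theorem two_hits (H : Config X l M₁ M₂ M₃ E F G e f g) :
    (Hits X M₁ M₂ M₃ e ∧ Hits X M₁ M₂ M₃ f) ∨ (Hits X M₁ M₂ M₃ e ∧ Hits X M₁ M₂ M₃ g) ∨
      (Hits X M₁ M₂ M₃ f ∧ Hits X M₁ M₂ M₃ g) := by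
  obtain ⟨P, hP, hP₁, hP₂, hP₃, -⟩ := H.exists_node
  obtain ⟨s, hs, V, hV, hV₁, hV₂, hV₃, hVs, -⟩ := H.exists_side_avoiding hP hP₁ hP₂ hP₃
  obtain ⟨s', hs', V', hV', hV₁', hV₂', hV₃', hVs', hVV⟩ := H.exists_side_avoiding hV hV₁ hV₂ hV₃
  have q : Hits X M₁ M₂ M₃ s := ⟨V, hV, hV₁, hV₂, hV₃, hVs⟩
  have q' : Hits X M₁ M₂ M₃ s' := ⟨V', hV', hV₁', hV₂', hV₃', hVs'⟩
  have hsM : s ≠ M₁ := by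
    rcases hs with rfl | rfl | rfl
    · exact fun h => H.memF.2.1 (h ▸ H.le.2.1)
    · exact fun h => H.memE.2.1 (h ▸ H.lf.2.1)
    · exact fun h => H.memE.2.1 (h ▸ H.lg.2.1)
  have hsl : IsLine s := by
    rcases hs with rfl | rfl | rfl
    · exact H.le.1
    · exact H.lf.1
    · exact H.lg.1
  have hss : s ≠ s' := fun h => hsM (hsl.eq_of_mem H.max₁.1 hVV.symm hVs (h ▸ hVs') hV₁ hV₁')
  rcases hs with rfl | rfl | rfl <;> rcases hs' with rfl | rfl | rfl
  · exact absurd rfl hss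
  · exact Or.inl ⟨q, q'⟩
  · exact Or.inr (Or.inl ⟨q, q'⟩)
  · exact Or.inl ⟨q', q⟩
  · exact absurd rfl hss
  · exact Or.inr (Or.inr ⟨q, q'⟩)
  · exact Or.inr (Or.inl ⟨q', q⟩)
  · exact Or.inr (Or.inr ⟨q', q⟩)
  · exact absurd rfl hss

/-- A side through private nodes of all three maximal lines would be a fourth maximal line. -/
theorem not_hits_three (H : Config X l M₁ M₂ M₃ E F G e f g) {s : Set Plane} (hs : IsLine s)
    {A B : Plane} (hA : A ∈ X ∧ A ∉ M₁ ∧ A ∉ M₂ ∧ A ∉ M₃) (hB : B ∈ X ∧ B ∉ M₁ ∧ B ∉ M₂ ∧ B ∉ M₃)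
    (hAB : A ≠ B) (hAs : A ∈ s) (hBs : B ∈ s) (h₁ : Hits X M₁ M₂ M₃ s) (h₂ : Hits X M₂ M₁ M₃ s)
    (h₃ : Hits X M₃ M₁ M₂ s) : False := by
  obtain ⟨V₁, a₁, b₁, c₁, d₁, e₁⟩ := h₁
  obtain ⟨V₂, a₂, b₂, c₂, d₂, e₂⟩ := h₂
  obtain ⟨V₃, a₃, b₃, c₃, d₃, e₃⟩ := h₃
  have hmax : IsMax 4 X s := by
    refine isMax_four_of_card H.gen.gc hs (T := {A, B, V₁, V₂, V₃}) (fun P hP => ?_) ?_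
    · simp only [Finset.mem_insert, Finset.mem_singleton] at hP
      rcases hP with rfl | rfl | rfl | rfl | rfl
      · exact ⟨hA.1, hAs⟩
      · exact ⟨hB.1, hBs⟩
      · exact ⟨a₁, e₁⟩
      · exact ⟨a₂, e₂⟩
      · exact ⟨a₃, e₃⟩
    · rw [Finset.card_insert_of_notMem, Finset.card_insert_of_notMem,
        Finset.card_insert_of_notMem, Finset.card_pair]
      · rintro rfl; exact d₂ b₃
      · simp only [Finset.mem_insert, Finset.mem_singleton, not_or]
        exact ⟨fun h => c₁ (h ▸ b₂), fun h => d₁ (h ▸ b₃)⟩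
      · simp only [Finset.mem_insert, Finset.mem_singleton, not_or]
        exact ⟨fun h => hB.2.1 (h ▸ b₁), fun h => hB.2.2.1 (h ▸ b₂), fun h => hB.2.2.2 (h ▸ b₃)⟩
      · simp only [Finset.mem_insert, Finset.mem_singleton, not_or]
        exact ⟨hAB, fun h => hA.2.1 (h ▸ b₁), fun h => hA.2.2.1 (h ▸ b₂),
          fun h => hA.2.2.2 (h ▸ b₃)⟩
  have n₁ : M₁ ≠ s := fun h => hA.2.1 (h ▸ hAs)
  have n₂ : M₂ ≠ s := fun h => hA.2.2.1 (h ▸ hAs)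
  have n₃ : M₃ ≠ s := fun h => hA.2.2.2 (h ▸ hAs)
  refine H.gen.not_four ![M₁, M₂, M₃, s] ?_ ?_
  · have := H.ne₁₂
    have := H.ne₁₃
    have := H.ne₂₃
    intro i j hij
    fin_cases i <;> fin_cases j <;> simp_all
  · intro i
    fin_cases i
    · exact H.max₁
    · exact H.max₂
    · exact H.max₃
    · exact hmax

/-- The node of `l` on `M₂` lies on the side `e`. -/
theorem exists_mem_side (H : Config X l M₁ M₂ M₃ E F G e f g) (g₁ : Hits X M₁ M₂ M₃ g)
    (f₁ : Hits X M₁ M₂ M₃ f) (e₁ : ¬ Hits X M₁ M₂ M₃ e) (g₂ : Hits X M₂ M₁ M₃ g)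
    (f₂ : ¬ Hits X M₂ M₁ M₃ f) (e₂ : Hits X M₂ M₁ M₃ e) :
    ∃ P ∈ X, P ∈ M₂ ∧ P ∈ l ∧ P ∈ e := by
  have hX := H.gen.gc
  obtain ⟨P₁, p₁, hP₁, p₁₂, p₁₃, p₁l⟩ := H.exists_node
  obtain ⟨P₂, p₂, hP₂, p₂₁, p₂₃, p₂l⟩ := H.swap₁₂.exists_node
  obtain ⟨u, hu, u₁, u₂, u₃, ug⟩ := g₁
  obtain ⟨u', hu', u₁', u₂', u₃', uf⟩ := f₁
  obtain ⟨v, hv, v₂, v₁, v₃, vg⟩ := g₂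
  obtain ⟨v', hv', v₂', v₁', v₃', ve⟩ := e₂
  refine ⟨P₂, p₂, hP₂, p₂l, ?_⟩
  -- Otherwise u, u', P₁ and v, v', P₂ are distinct and are all the private nodes of M₁ and M₂.
  -- Delete M₃ and take the cover of the common node V of M₁ and M₂. Its line through E is g or l
  -- and uses up u, v or P₁, P₂. Its line through G then takes the other pair and is l or g, but G
  -- is on neither.
  by_contra hPe
  have neM : ∀ {P Q : Plane}, P ∈ M₁ → Q ∉ M₁ → P ≠ Q := fun hP hQ h => hQ (h ▸ hP)
  have neM' : ∀ {P Q : Plane}, P ∈ M₂ → Q ∉ M₂ → P ≠ Q := fun hP hQ h => hQ (h ▸ hP)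
  have hfg : f ≠ g := fun h => H.lf.2.2.2 (h ▸ H.lg.2.2.1)
  have hgl : g ≠ l := fun h => H.Fl (h ▸ H.lg.2.2.1)
  have hfl : f ≠ l := fun h => H.Gl (h ▸ H.lf.2.2.1)
  have heg : e ≠ g := fun h => H.le.2.2.2 (h ▸ H.lg.2.1)
  have E₁ := H.memE.2.1
  have E₂ := H.memE.2.2.1
  have F₂ := H.memF.2.2.1
  have nuu : u ≠ u' := fun h => neM u₁ E₁ (H.lg.1.point_eq H.lf.1 hfg.symm ug H.lg.2.1 (h ▸ uf)
    H.lf.2.1)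
  have nuP : u ≠ P₁ := fun h => neM u₁ E₁ (H.lg.1.point_eq H.gen.line hgl ug H.lg.2.1 (h ▸ p₁l) H.El)
  have nuP' : u' ≠ P₁ := fun h =>
    neM u₁' E₁ (H.lf.1.point_eq H.gen.line hfl uf H.lf.2.1 (h ▸ p₁l) H.El)
  have nvv : v ≠ v' := fun h => neM' v₂ F₂ (H.lg.1.point_eq H.le.1 heg.symm vg H.lg.2.2.1 (h ▸ ve)
    H.le.2.1)
  have nvP : v ≠ P₂ := fun h => neM' v₂ E₂ (H.lg.1.point_eq H.gen.line hgl vg H.lg.2.1 (h ▸ p₂l) H.El)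
  have nvP' : v' ≠ P₂ := fun h => hPe (h ▸ ve)
  set Y := nodesOff X M₃ with hY
  have gY : LineGC 3 Y := hX.remove H.max₃
  have mY₁ : IsMax 3 Y M₁ := hX.isMax_nodesOff H.max₁ H.max₃ H.ne₁₃
  have mY₂ : IsMax 3 Y M₂ := hX.isMax_nodesOff H.max₂ H.max₃ H.ne₂₃
  have memY : ∀ {A}, A ∈ X → A ∉ M₃ → A ∈ Y := fun h h' => mem_nodesOff.2 ⟨h, h'⟩
  obtain ⟨V, hVY, hV₁, hV₂⟩ := gY.exists_mem_inter mY₁ mY₂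
  obtain ⟨S, hS⟩ := gY.exists_cover V hVY
  obtain ⟨φ, Φ, Iφ, -, Uφ⟩ := mY₁.exists_matching_self hVY hV₁ hS
  obtain ⟨ψ, Ψ, Iψ, -, Uψ⟩ := mY₂.exists_matching_self hVY hV₂ hS
  have T₁ : (nodesOn Y M₁).erase V = {u, u', P₁} := by
    symm
    apply Finset.eq_of_subset_of_card_le
    · intro A hA
      simp only [Finset.mem_insert, Finset.mem_singleton] at hA
      simp only [Finset.mem_erase, mem_nodesOn]
      rcases hA with rfl | rfl | rfl
      · exact ⟨(neM' hV₂ u₂).symm, memY hu u₃, u₁⟩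
      · exact ⟨(neM' hV₂ u₂').symm, memY hu' u₃', u₁'⟩
      · exact ⟨(neM' hV₂ p₁₂).symm, memY p₁ p₁₃, hP₁⟩
    · rw [Finset.card_erase_of_mem (by simp [hVY, hV₁]), mY₁.2,
        Finset.card_eq_three.2 ⟨u, u', P₁, nuu, nuP, nuP', rfl⟩]
  have T₂ : (nodesOn Y M₂).erase V = {v, v', P₂} := by
    symm
    apply Finset.eq_of_subset_of_card_le
    · intro A hA
      simp only [Finset.mem_insert, Finset.mem_singleton] at hA
      simp only [Finset.mem_erase, mem_nodesOn]
      rcases hA with rfl | rfl | rfl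
      · exact ⟨(neM hV₁ v₁).symm, memY hv v₃, v₂⟩
      · exact ⟨(neM hV₁ v₁').symm, memY hv' v₃', v₂'⟩
      · exact ⟨(neM hV₁ p₂₁).symm, memY p₂ p₂₃, hP₂⟩
    · rw [Finset.card_erase_of_mem (by simp [hVY, hV₂]), mY₂.2,
        Finset.card_eq_three.2 ⟨v, v', P₂, nvv, nvP, nvP', rfl⟩]
  have hφ : ∀ h ∈ S, φ h = u ∨ φ h = u' ∨ φ h = P₁ := fun h hh => by
    have := (Φ h hh).1
    rw [T₁] at this
    simpa using this
  have hψ : ∀ h ∈ S, ψ h = v ∨ ψ h = v' ∨ ψ h = P₂ := fun h hh => by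
    have := (Ψ h hh).1
    rw [T₂] at this
    simpa using this
  -- the sides `e` and `f` do not belong to the cover
  have hfS : f ∉ S := fun h => by
    have := (Ψ f h)
    simp only [Finset.mem_erase, mem_nodesOn, hY, mem_nodesOff] at this
    obtain ⟨⟨a, ⟨b, c⟩, d⟩, i⟩ := this
    exact f₂ ⟨ψ f, b, d, fun h => a (H.max₁.1.point_eq H.max₂.1 H.ne₁₂ h hV₁ d hV₂), c, i⟩
  have heS : e ∉ S := fun h => by
    have := (Φ e h)
    simp only [Finset.mem_erase, mem_nodesOn, hY, mem_nodesOff] at this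
    obtain ⟨⟨a, ⟨b, c⟩, d⟩, i⟩ := this
    exact e₁ ⟨φ e, b, d, fun h => a (H.max₁.1.point_eq H.max₂.1 H.ne₁₂ d hV₁ h hV₂), c, i⟩
  obtain ⟨k, hk, Ek⟩ := hS.covers E (memY H.memE.1 H.memE.2.2.2) (neM hV₁ H.memE.2.1).symm
  obtain ⟨m, hm, Gm⟩ := hS.covers G (memY H.memG.1 H.memG.2.2.2) (neM hV₁ H.memG.2.1).symm
  have lk := hS.isLine k hk
  have lm := hS.isLine m hm
  have mφ : φ m = u ∨ φ m = P₁ := by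
    rcases hφ m hm with h | h | h
    · exact Or.inl h
    · refine absurd ?_ hfS
      have : f = m := H.lf.1.eq_of_mem lm (neM u₁' H.memG.2.1) uf H.lf.2.2.1 (h ▸ (Φ m hm).2) Gm
      rwa [this]
    · exact Or.inr h
  have mψ : ψ m = v ∨ ψ m = P₂ := by
    rcases hψ m hm with h | h | h
    · exact Or.inl h
    · refine absurd ?_ heS
      have : e = m := H.le.1.eq_of_mem lm (neM' v₂' H.memG.2.2.1) ve H.le.2.2.1
        (h ▸ (Ψ m hm).2) Gm
      rwa [this]
    · exact Or.inr h
  have mφ' := (Φ m hm).2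
  have mψ' := (Ψ m hm).2
  have hmg : m ≠ g := fun h => H.lg.2.2.2 (h ▸ Gm)
  have hml : m ≠ l := fun h => H.Gl (h ▸ Gm)
  have nuv : u ≠ v := neM u₁ v₁
  have nPP : P₁ ≠ P₂ := neM hP₁ p₂₁
  have hkeq : k = g ∨ k = l := by
    rcases hφ k hk with h | h | h
    · exact Or.inl (lk.eq_of_mem H.lg.1 (neM u₁ E₁) (h ▸ (Φ k hk).2) Ek ug H.lg.2.1)
    · refine absurd ?_ hfS
      have : f = k := H.lf.1.eq_of_mem lk (neM u₁' E₁) uf H.lf.2.1 (h ▸ (Φ k hk).2) Ek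
      rwa [this]
    · exact Or.inr (lk.eq_of_mem H.gen.line (neM hP₁ E₁) (h ▸ (Φ k hk).2) Ek p₁l H.El)
  have in₁ : ∀ {A}, A ∈ ({u, u', P₁} : Finset Plane) → A ∈ k → A = φ k := fun hA hAk =>
    Uφ k hk _ (T₁ ▸ hA) hAk
  have in₂ : ∀ {A}, A ∈ ({v, v', P₂} : Finset Plane) → A ∈ k → A = ψ k := fun hA hAk =>
    Uψ k hk _ (T₂ ▸ hA) hAk
  rcases hkeq with hkg | hkl
  · have hkm : m ≠ k := fun h => hmg (h.trans hkg)
    have eu := in₁ (A := u) (by simp) (hkg ▸ ug)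
    have ev := in₂ (A := v) (by simp) (hkg ▸ vg)
    have a1 : φ m = P₁ := mφ.resolve_left fun h => hkm (Iφ hm hk (h.trans eu))
    have a2 : ψ m = P₂ := mψ.resolve_left fun h => hkm (Iψ hm hk (h.trans ev))
    exact hml (lm.eq_of_mem H.gen.line nPP (a1 ▸ mφ') (a2 ▸ mψ') p₁l p₂l)
  · have hkm : m ≠ k := fun h => hml (h.trans hkl)
    have eu := in₁ (A := P₁) (by simp) (hkl ▸ p₁l)
    have ev := in₂ (A := P₂) (by simp) (hkl ▸ p₂l)
    have a1 : φ m = u := mφ.resolve_right fun h => hkm (Iφ hm hk (h.trans eu))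
    have a2 : ψ m = v := mψ.resolve_right fun h => hkm (Iψ hm hk (h.trans ev))
    exact hmg (lm.eq_of_mem H.lg.1 nuv (a1 ▸ mφ') (a2 ▸ mψ') ug vg)

/-- The nodes of l on M₂ and on M₃ both lie on e, so e = l, but F is not on l. -/
theorem false_of_hits (H : Config X l M₁ M₂ M₃ E F G e f g) (g₁ : Hits X M₁ M₂ M₃ g)
    (f₁ : Hits X M₁ M₂ M₃ f) (e₁ : ¬ Hits X M₁ M₂ M₃ e) (g₂ : Hits X M₂ M₁ M₃ g)
    (f₂ : ¬ Hits X M₂ M₁ M₃ f) (e₂ : Hits X M₂ M₁ M₃ e) (f₃ : Hits X M₃ M₁ M₂ f)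
    (g₃ : ¬ Hits X M₃ M₁ M₂ g) (e₃ : Hits X M₃ M₁ M₂ e) : False := by
  obtain ⟨P, hP, hP₂, hPl, hPe⟩ := H.exists_mem_side g₁ f₁ e₁ g₂ f₂ e₂
  obtain ⟨Q, hQ, hQ₃, hQl, hQe⟩ := H.swap₂₃.swapFG.exists_mem_side f₁.swap g₁.swap
    (fun h => e₁ h.swap) f₃ g₃ e₃
  have hPQ : P ≠ Q := fun h =>
    H.gen.distinct _ _ H.max₂ H.max₃ H.ne₂₃ P hP hP₂ (h ▸ hQ₃) hPl
  exact H.Fl (H.le.1.eq_of_mem H.gen.line hPQ hPe hQe hPl hQl ▸ H.le.2.1)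

/-- Each maximal line hits at least two sides and each side is hit by at most two maximal lines. So
every maximal line misses exactly one side, and different ones miss different sides. Up to
exchanging M₂ and M₃ this is the pattern of `false_of_hits`. -/
theorem false_of_not_hits (H : Config X l M₁ M₂ M₃ E F G e f g) (e₁ : ¬ Hits X M₁ M₂ M₃ e) :
    False := by
  have hEF : E ≠ F := fun h => H.Fl (h ▸ H.El)
  have hEG : E ≠ G := fun h => H.Gl (h ▸ H.El)
  have hf := H.not_hits_three H.lf.1 H.memE H.memG hEG H.lf.2.1 H.lf.2.2.1
  have hg := H.not_hits_three H.lg.1 H.memE H.memF hEF H.lg.2.1 H.lg.2.2.1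
  have t₁ := H.two_hits
  have t₂ := H.swap₁₂.two_hits
  have t₃ := H.swap₂₃.swap₁₂.two_hits
  obtain ⟨f₁, g₁⟩ : Hits X M₁ M₂ M₃ f ∧ Hits X M₁ M₂ M₃ g :=
    (t₁.resolve_left fun h => e₁ h.1).resolve_left fun h => e₁ h.1
  by_cases f₂ : Hits X M₂ M₁ M₃ f
  · have f₃ : ¬ Hits X M₃ M₁ M₂ f := fun h => hf f₁ f₂ h
    obtain ⟨e₃, g₃⟩ : Hits X M₃ M₁ M₂ e ∧ Hits X M₃ M₁ M₂ g :=
      (t₃.resolve_left fun h => f₃ h.2).resolve_right fun h => f₃ h.1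
    have g₂ : ¬ Hits X M₂ M₁ M₃ g := fun h => hg g₁ h g₃
    have e₂ : Hits X M₂ M₁ M₃ e :=
      ((t₂.resolve_right fun h => h.elim (fun h => g₂ h.2) fun h => g₂ h.2)).1
    exact H.swap₂₃.false_of_hits g₁.swap f₁.swap (fun h => e₁ h.swap) g₃ f₃ e₃ f₂ g₂ e₂
  · have e₂ : Hits X M₂ M₁ M₃ e := by tauto
    have g₂ : Hits X M₂ M₁ M₃ g := by tauto
    have g₃ : ¬ Hits X M₃ M₁ M₂ g := fun h => hg g₁ g₂ h
    obtain ⟨e₃, f₃⟩ : Hits X M₃ M₁ M₂ e ∧ Hits X M₃ M₁ M₂ f :=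
      t₃.resolve_right fun h => h.elim (fun h => g₃ h.2) fun h => g₃ h.2
    exact H.false_of_hits g₁ f₁ e₁ g₂ f₂ e₂ f₃ g₃ e₃

/-- The side e is missed by some maximal line, and by symmetry this may be M₁. -/
theorem false (H : Config X l M₁ M₂ M₃ E F G e f g) : False := by
  have hFG : F ≠ G := fun h => H.lg.2.2.2 (h ▸ H.lg.2.2.1)
  by_cases e₁ : Hits X M₁ M₂ M₃ e
  · by_cases e₂ : Hits X M₂ M₁ M₃ e
    · by_cases e₃ : Hits X M₃ M₁ M₂ e
      · exact H.not_hits_three H.le.1 H.memF H.memG hFG H.le.2.1 H.le.2.2.1 e₁ e₂ e₃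
      · exact H.swap₂₃.swap₁₂.false_of_not_hits e₃
    · exact H.swap₁₂.false_of_not_hits e₂
  · exact H.false_of_not_hits e₁

end Config

/-- Three nodes of l lie on the three maximal lines, one on each; the fourth is one of the three
nodes off them. Those three form a configuration of degree one, so they are the vertices of a proper
triangle. -/
theorem Generic.false (H : Generic X l) : False := by
  have hX := H.gc
  obtain ⟨M, hM⟩ := hX.exists_isMax_four
  obtain ⟨M₁, M₂, M₃, m₁, m₂, m₃, n₁₂, n₁₃, n₂₃⟩ := hX.exists_three_of_four hM
  have gR := hX.remove_three m₁ m₂ m₃ n₁₂ n₁₃ n₂₃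
  set R := nodesOff (nodesOff (nodesOff X M₁) M₂) M₃ with hR
  have memR : ∀ A, A ∈ R ↔ A ∈ X ∧ A ∉ M₁ ∧ A ∉ M₂ ∧ A ∉ M₃ := fun A => by
    simp [hR, and_assoc]
  have cR : R.card = 3 := by have := gR.card_eq; omega
  obtain ⟨P₁, p₁, q₁, r₁⟩ := H.meets M₁ m₁
  obtain ⟨P₂, p₂, q₂, r₂⟩ := H.meets M₂ m₂
  obtain ⟨P₃, p₃, q₃, r₃⟩ := H.meets M₃ m₃
  have k₁₂ : P₁ ≠ P₂ := fun h => H.distinct _ _ m₁ m₂ n₁₂ P₁ p₁ q₁ (h ▸ q₂) r₁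
  have k₁₃ : P₁ ≠ P₃ := fun h => H.distinct _ _ m₁ m₃ n₁₃ P₁ p₁ q₁ (h ▸ q₃) r₁
  have k₂₃ : P₂ ≠ P₃ := fun h => H.distinct _ _ m₂ m₃ n₂₃ P₂ p₂ q₂ (h ▸ q₃) r₂
  have hsub : ({P₁, P₂, P₃} : Finset Plane) ⊆ nodesOn X l := by
    intro A hA
    simp only [Finset.mem_insert, Finset.mem_singleton] at hA
    rcases hA with rfl | rfl | rfl <;> simp [*]
  have c3 : ({P₁, P₂, P₃} : Finset Plane).card = 3 :=
    Finset.card_eq_three.2 ⟨_, _, _, k₁₂, k₁₃, k₂₃, rfl⟩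
  obtain ⟨E, hE⟩ := Finset.card_eq_one.1
    (show (nodesOn X l \ {P₁, P₂, P₃}).card = 1 by
      rw [Finset.card_sdiff_of_subset hsub, H.four, c3])
  have hEm : E ∈ nodesOn X l \ {P₁, P₂, P₃} := by rw [hE]; simp
  simp only [Finset.mem_sdiff, mem_nodesOn, Finset.mem_insert, Finset.mem_singleton, not_or] at hEm
  obtain ⟨⟨EX, El⟩, E₁, E₂, E₃⟩ := hEm
  have hER : E ∈ R := (memR E).2 ⟨EX,
    fun h => E₁ (m₁.1.point_eq H.line (H.ne m₁) h q₁ El r₁),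
    fun h => E₂ (m₂.1.point_eq H.line (H.ne m₂) h q₂ El r₂),
    fun h => E₃ (m₃.1.point_eq H.line (H.ne m₃) h q₃ El r₃)⟩
  have hlE : ∀ A ∈ R, A ∈ l → A = E := by
    intro A hA hAl
    obtain ⟨a, b, c, d⟩ := (memR A).1 hA
    have : A ∈ nodesOn X l \ {P₁, P₂, P₃} := by
      simp only [Finset.mem_sdiff, mem_nodesOn, Finset.mem_insert, Finset.mem_singleton, not_or]
      exact ⟨⟨a, hAl⟩, fun h => b (h ▸ q₁), fun h => c (h ▸ q₂), fun h => d (h ▸ q₃)⟩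
    rw [hE] at this
    simpa using this
  obtain ⟨F, G, hFG, he⟩ := Finset.card_eq_two.1
    (show (R.erase E).card = 2 by rw [Finset.card_erase_of_mem hER, cR])
  have hF : F ∈ R.erase E := by rw [he]; simp
  have hG : G ∈ R.erase E := by rw [he]; simp
  rw [Finset.mem_erase] at hF hG
  have noncol : ∀ {h A B C}, IsLine h → A ∈ R → B ∈ R → C ∈ R → A ≠ B → A ≠ C → B ≠ C →
      A ∈ h → B ∈ h → C ∉ h := by
    intro h A B C hh hA hB hC hAB hAC hBC a b c
    have h1 := gR.card_nodesOn_le hh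
    have hs : ({A, B, C} : Finset Plane) ⊆ nodesOn R h := by
      intro P hP
      simp only [Finset.mem_insert, Finset.mem_singleton] at hP
      rcases hP with rfl | rfl | rfl
      · exact mem_nodesOn.2 ⟨hA, a⟩
      · exact mem_nodesOn.2 ⟨hB, b⟩
      · exact mem_nodesOn.2 ⟨hC, c⟩
    have := Finset.card_le_card hs
    rw [Finset.card_eq_three.2 ⟨A, B, C, hAB, hAC, hBC, rfl⟩] at this
    omega
  obtain ⟨e, le, Fe, Ge⟩ := exists_line F G
  obtain ⟨f, lf, Ef, Gf⟩ := exists_line E G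
  obtain ⟨g, lg, Eg, Fg⟩ := exists_line E F
  refine Config.false (X := X) (l := l) (M₁ := M₁) (M₂ := M₂) (M₃ := M₃) (E := E) (F := F) (G := G)
    (e := e) (f := f) (g := g) ⟨H, m₁, m₂, m₃, n₁₂, n₁₃, n₂₃, (memR E).1 hER, (memR F).1 hF.2,
      (memR G).1 hG.2, fun P hP h1 h2 h3 => ?_, El, fun h => hF.1 (hlE F hF.2 h),
      fun h => hG.1 (hlE G hG.2 h), ⟨le, Fe, Ge, noncol le hF.2 hG.2 hER hFG hF.1 hG.1 Fe Ge⟩,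
      ⟨lf, Ef, Gf, noncol lf hER hG.2 hF.2 hG.1.symm hF.1.symm hFG.symm Ef Gf⟩,
      ⟨lg, Eg, Fg, noncol lg hER hF.2 hG.2 hF.1.symm hG.1.symm hFG Eg Fg⟩⟩
  by_cases hPE : P = E
  · exact Or.inl hPE
  · have : P ∈ R.erase E := Finset.mem_erase.2 ⟨hPE, (memR P).2 ⟨hP, h1, h2, h3⟩⟩
    rw [he] at this
    exact Or.inr (by simpa using this)

/-- A line with four nodes either misses the nodes of some maximal line, or it passes through the
common node of two maximal lines. -/
theorem LineGC.exists_maximal_lines (hX : LineGC 4 X) (hl : IsLine l)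
    (h4 : (nodesOn X l).card = 4) :
    (∃ M, IsMax 4 X M ∧ ∀ A ∈ X, A ∈ M → A ∉ l) ∨
      ∃ M M', IsMax 4 X M ∧ IsMax 4 X M' ∧ M ≠ M' ∧ ∃ A ∈ X, A ∈ M ∧ A ∈ M' ∧ A ∈ l := by
  by_contra! hcon
  exact Generic.false ⟨hX, hl, h4, hcon.1, hcon.2⟩

end GCSets

/-! ### Translation between polynomials and covers. -/

namespace GCSets

open scoped Classical
open MvPolynomial

theorem finrank_restrictTotalDegree_four :
    Module.finrank ℝ (restrictTotalDegree (Fin 2) ℝ 4) = 15 := by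
  have hb := Module.finrank_eq_nat_card_basis
    (basisRestrictSupport ℝ {n : Fin 2 →₀ ℕ | (n.sum fun _ e => e) ≤ 4})
  refine hb.trans ?_
  let T : Finset (ℕ × ℕ) := (Finset.range 5 ×ˢ Finset.range 5).filter fun p => p.1 + p.2 ≤ 4
  have hT : T.card = 15 := by decide
  have hsum : ∀ n : Fin 2 →₀ ℕ, (n.sum fun _ e => e) = n 0 + n 1 := fun n => by
    rw [Finsupp.sum_fintype _ _ (fun _ => rfl), Fin.sum_univ_two]
  have hmem : ∀ p : ℕ × ℕ, p ∈ T ↔ p.1 + p.2 ≤ 4 := fun p => by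
    simp only [T, Finset.mem_filter, Finset.mem_product, Finset.mem_range]
    omega
  refine (Nat.card_congr (((Finsupp.equivFunOnFinite (α := Fin 2) (M := ℕ)).trans
    (finTwoArrowEquiv ℕ)).subtypeEquiv (q := fun p => p ∈ T) fun n => ?_)).trans ?_
  · rw [hmem]
    exact (hsum n) ▸ Iff.rfl
  · rw [Nat.card_eq_fintype_card, Fintype.card_coe, hT]

theorem card_of_isPoised_four {X : Finset Plane} (hX : IsPoised 4 (X : Set Plane)) :
    X.card = 15 := by
  let ev : restrictTotalDegree (Fin 2) ℝ 4 →ₗ[ℝ] (X → ℝ) :=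
    LinearMap.pi fun A => ((aeval (A : Plane)).toLinearMap).comp (Submodule.subtype _)
  have hev : ∀ p A, ev p A = eval (A : Plane) (p : Poly) := fun p A => by
    simp [ev, aeval_eq_eval]
  have hbij : Function.Bijective ev := by
    constructor
    · rw [← LinearMap.ker_eq_bot, LinearMap.ker_eq_bot']
      intro p hp
      obtain ⟨q, -, hq⟩ := hX.2 0
      have h1 : (p : Poly) = q := hq p ⟨(mem_restrictTotalDegree _ _ _).1 p.2, fun A hA => by
        have := congrFun hp ⟨A, hA⟩
        rw [hev] at this
        simpa using this⟩
      have h2 : (0 : Poly) = q := hq 0 ⟨by simp, fun A hA => by simp⟩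
      exact Subtype.ext (h1.trans h2.symm)
    · intro c
      obtain ⟨p, ⟨hp, hpc⟩, -⟩ := hX.2 fun A => if h : A ∈ X then c ⟨A, h⟩ else 0
      refine ⟨⟨p, (mem_restrictTotalDegree _ _ _).2 hp⟩, ?_⟩
      ext A
      rw [hev]
      simpa using hpc A A.2
  have := (LinearEquiv.ofBijective ev hbij).finrank_eq
  rw [finrank_restrictTotalDegree_four] at this
  simpa using this.symm

theorem eq_zero_of_isPoised {n : ℕ} {X : Set Plane} (hX : IsPoised n X) {p : Poly}
    (hp : p.totalDegree ≤ n) (h0 : ∀ A ∈ X, eval A p = 0) : p = 0 := by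
  obtain ⟨q, -, hq⟩ := hX.2 0
  rw [hq p ⟨hp, by simpa using h0⟩, hq 0 ⟨by simp, by simp⟩]

theorem IsFundamental.eq {n : ℕ} {X : Set Plane} (hX : IsPoised n X) {A : Plane} {p q : Poly}
    (hp : IsFundamental n X A p) (hq : IsFundamental n X A q) : p = q := by
  refine sub_eq_zero.1 (eq_zero_of_isPoised hX
    ((totalDegree_sub _ _).trans (max_le hp.2.1 hq.2.1)) fun B hB => ?_)
  by_cases h : B = A
  · subst h
    simp [hp.2.2.1, hq.2.2.1]
  · simp [hp.2.2.2 B hB h, hq.2.2.2 B hB h]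

theorem isCover_of_prod {n : ℕ} {X : Finset Plane} {A : Plane} {L : Fin n → Poly}
    (hL : ∀ i, (L i).totalDegree = 1) (hp : IsFundamental n (X : Set Plane) A (∏ i, L i)) :
    IsCover n X A (Finset.univ.image fun i => zeroSet (L i)) where
  card_le := Finset.card_image_le.trans (by simp)
  isLine h hh := by
    obtain ⟨i, -, rfl⟩ := Finset.mem_image.1 hh
    exact ⟨L i, hL i, rfl⟩
  notMem h hh := by
    obtain ⟨i, -, rfl⟩ := Finset.mem_image.1 hh
    intro hA
    have := hp.2.2.1
    rw [map_prod, Finset.prod_eq_zero (Finset.mem_univ i)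
      (show eval A (L i) = 0 from hA)] at this
    exact zero_ne_one this
  covers B hB hBA := by
    have := hp.2.2.2 B hB hBA
    rw [map_prod, Finset.prod_eq_zero_iff] at this
    obtain ⟨i, -, hi⟩ := this
    exact ⟨zeroSet (L i), Finset.mem_image_of_mem _ (Finset.mem_univ i), hi⟩

theorem lineGC_of_isGC {X : Finset Plane} (hX : IsGC 4 (X : Set Plane)) : LineGC 4 X where
  card_eq := by rw [card_of_isPoised_four hX.1]
  exists_cover A hA := by
    obtain ⟨p, hp, L, hL, rfl⟩ := hX.2 A hA
    exact ⟨_, isCover_of_prod hL hp⟩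

/-- The cofactor q need not be given as a product. By uniqueness the fundamental polynomial is also
the product of n linear factors, so the n lines of these factors contain l and l is one of them. -/
theorem exists_cover_of_uses {n : ℕ} {X : Finset Plane} (hX : IsGC n (X : Set Plane)) {A : Plane}
    {l : Set Plane} (h : Uses n (X : Set Plane) A l) : ∃ S, IsCover n X A S ∧ l ∈ S := by
  obtain ⟨p, hp, M, q, hM, rfl, -, rfl⟩ := h
  obtain ⟨p', hp', L, hL, rfl⟩ := hX.2 A hp.1
  have hc := isCover_of_prod hL hp'
  refine ⟨_, hc, ?_⟩
  have heq := hp.eq hX.1 hp'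
  have hl : IsLine (zeroSet M) := ⟨M, hM, rfl⟩
  obtain ⟨T, hT, hTc⟩ := hl.infinite.exists_subset_card_eq (n + 1)
  refine mem_of_card_lt hc.isLine hl (T := T) (fun B hB => hT hB) (fun B hB => ?_)
    (by have := hc.card_le; omega)
  have h0 : eval B (∏ i, L i) = 0 := by
    rw [← heq, map_mul, show eval B M = 0 from hT hB, zero_mul]
  rw [map_prod, Finset.prod_eq_zero_iff] at h0
  obtain ⟨i, -, hi⟩ := h0
  exact ⟨zeroSet (L i), Finset.mem_image_of_mem _ (Finset.mem_univ i), hi⟩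

theorem IsCover.uses {n : ℕ} {X : Finset Plane} {A : Plane} {S : Finset (Set Plane)}
    (hS : IsCover n X A S) (hA : A ∈ X) {l : Set Plane} (hl : l ∈ S) :
    Uses n (X : Set Plane) A l := by
  obtain ⟨L, hL, rfl⟩ := hS.isLine l hl
  obtain ⟨q, hq, hq0⟩ := exists_poly_of_lines (S.erase (zeroSet L))
    fun h hh => hS.isLine h (Finset.mem_of_mem_erase hh)
  rw [Finset.card_erase_of_mem hl] at hq
  have hcard := hS.card_le
  have hpos : 0 < S.card := Finset.card_pos.2 ⟨_, hl⟩
  have hLA : eval A L ≠ 0 := hS.notMem _ hl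
  have hqA : eval A q ≠ 0 := fun h => by
    obtain ⟨k, hk, hAk⟩ := (hq0 A).1 h
    exact hS.notMem k (Finset.mem_of_mem_erase hk) hAk
  set r := (eval A L * eval A q)⁻¹ with hr
  have hdeg : (C r * q : Poly).totalDegree + 1 ≤ n := by
    have := totalDegree_mul (C r : Poly) q
    rw [totalDegree_C] at this
    omega
  refine ⟨L * (C r * q), ⟨hA, (totalDegree_mul _ _).trans (by omega), ?_, fun B hB hBA => ?_⟩,
    L, C r * q, hL, rfl, hdeg, rfl⟩
  · simp only [map_mul, eval_C, hr]
    field_simp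
  · obtain ⟨k, hk, hBk⟩ := hS.covers B hB hBA
    by_cases e : k = zeroSet L
    · rw [e] at hBk
      rw [map_mul, show eval B L = 0 from hBk, zero_mul]
    · rw [map_mul, map_mul, (hq0 B).2 ⟨k, Finset.mem_erase.2 ⟨e, hk⟩, hBk⟩, mul_zero, mul_zero]

theorem exists_line_notMem (A : Plane) : ∃ h, IsLine h ∧ A ∉ h :=
  ⟨{P | P 0 = A 0 + 1}, isLine_iff.2 ⟨1, 0, -(A 0 + 1), by simp, fun P => by
    simp only [Set.mem_ofPred_eq]; constructor <;> intro h <;> linarith⟩, by simp⟩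

/-- A cover may have fewer than n + 1 lines, so it is padded with a line missing A; the normalising
constant is absorbed by the factor of index 0. -/
theorem IsCover.exists_fundamental {n : ℕ} {X : Finset Plane} {A : Plane} {S : Finset (Set Plane)}
    (hS : IsCover (n + 1) X A S) (hA : A ∈ X) : ∃ p : Poly,
      IsFundamental (n + 1) (X : Set Plane) A p ∧
        ∃ L : Fin (n + 1) → Poly, (∀ i, (L i).totalDegree = 1) ∧ p = ∏ i, L i := by
  obtain ⟨h₀, hh₀, hA₀⟩ := exists_line_notMem A
  let e : Fin (n + 1) → Set Plane := fun i =>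
    if h : (i : ℕ) < S.card then (S.equivFin.symm ⟨i, h⟩ : Set Plane) else h₀
  have he : ∀ i, IsLine (e i) ∧ A ∉ e i := by
    intro i
    by_cases h : (i : ℕ) < S.card
    · simp only [e, h, dif_pos]
      exact ⟨hS.isLine _ (Finset.coe_mem _), hS.notMem _ (Finset.coe_mem _)⟩
    · simp only [e, h, dif_neg, not_false_eq_true]
      exact ⟨hh₀, hA₀⟩
  have hsurj : ∀ h ∈ S, ∃ i, e i = h := by
    intro h hh
    have hlt := (S.equivFin ⟨h, hh⟩).2
    refine ⟨⟨S.equivFin ⟨h, hh⟩, hlt.trans_le hS.card_le⟩, ?_⟩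
    simp [e]
  choose L hL hLe using fun i => (he i).1
  have hLA : ∀ i, eval A (L i) ≠ 0 := fun i h => (he i).2 (hLe i ▸ h)
  set r := (∏ i, eval A (L i))⁻¹ with hr
  have hr0 : r ≠ 0 := inv_ne_zero (Finset.prod_ne_zero_iff.2 fun i _ => hLA i)
  have hL0 : ∀ i, L i ≠ 0 := fun i h => by
    have := hL i
    rw [h] at this
    simp at this
  set L' : Fin (n + 1) → Poly := fun i => (if i = 0 then C r else 1) * L i with hL'
  have hdeg : ∀ i, (L' i).totalDegree = 1 := by
    intro i
    simp only [hL']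
    split_ifs
    · rw [totalDegree_mul_of_isDomain (by simpa using hr0) (hL0 i), totalDegree_C, hL i]
    · rw [one_mul, hL i]
  have hprod : ∏ i, L' i = C r * ∏ i, L i := by
    simp only [hL', Finset.prod_mul_distrib]
    congr 1
    simp
  refine ⟨∏ i, L' i, ⟨hA, ?_, ?_, fun B hB hBA => ?_⟩, L', hdeg, rfl⟩
  · refine (totalDegree_finsetProd _ _).trans ?_
    simp [hdeg]
  · rw [hprod, map_mul, eval_C, map_prod, hr]
    exact inv_mul_cancel₀ (Finset.prod_ne_zero_iff.2 fun i _ => hLA i)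
  · obtain ⟨h, hh, hBh⟩ := hS.covers B hB hBA
    obtain ⟨i, rfl⟩ := hsurj h hh
    rw [hprod, map_mul, map_prod, Finset.prod_eq_zero (Finset.mem_univ i), mul_zero]
    rw [← hLe i] at hBh
    exact hBh

/-- Covers give the fundamental polynomials and hence existence of interpolants. Uniqueness is a
hypothesis, supplied later by `Unisolvent.remove`. -/
theorem LineGC.isGC {n : ℕ} {Y : Finset Plane} (hY : LineGC (n + 1) Y)
    (huniq : ∀ p : Poly, p.totalDegree ≤ n + 1 → (∀ A ∈ Y, eval A p = 0) → p = 0) :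
    IsGC (n + 1) (Y : Set Plane) := by
  have hfund : ∀ A ∈ Y, ∃ p : Poly, IsFundamental (n + 1) (Y : Set Plane) A p ∧
      ∃ L : Fin (n + 1) → Poly, (∀ i, (L i).totalDegree = 1) ∧ p = ∏ i, L i := fun A hA => by
    obtain ⟨S, hS⟩ := hY.exists_cover A hA
    exact hS.exists_fundamental hA
  refine ⟨⟨Y.finite_toSet, fun c => ?_⟩, hfund⟩
  choose! p hp _ using hfund
  refine ⟨∑ A ∈ Y, C (c A) * p A, ⟨?_, fun B hB => ?_⟩, fun q hq => ?_⟩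
  · refine totalDegree_finsetSum_le fun A hA => (totalDegree_mul _ _).trans ?_
    rw [totalDegree_C, zero_add]
    exact (hp A hA).2.1
  · rw [map_sum, Finset.sum_eq_single_of_mem B hB]
    · rw [map_mul, eval_C, (hp B hB).2.2.1, mul_one]
    · intro A hA hAB
      rw [map_mul, (hp A hA).2.2.2 B hB hAB.symm, mul_zero]
  · refine sub_eq_zero.1 (huniq _ ((totalDegree_sub _ _).trans (max_le hq.1
      (totalDegree_finsetSum_le fun A hA => (totalDegree_mul _ _).trans ?_))) fun B hB => ?_)
    · rw [totalDegree_C, zero_add]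
      exact (hp A hA).2.1
    · rw [map_sub, hq.2 B hB, map_sum, Finset.sum_eq_single_of_mem B hB]
      · rw [map_mul, eval_C, (hp B hB).2.2.1, mul_one, sub_self]
      · intro A hA hAB
        rw [map_mul, (hp A hA).2.2.2 B hB hAB.symm, mul_zero]

end GCSets

/-! ### The nodes using a four-node line. -/

namespace GCSets

open scoped Classical
open MvPolynomial

/-- A polynomial of degree at most `n` vanishing on `X` is zero. -/
def Unisolvent (n : ℕ) (X : Finset Plane) : Prop :=
  ∀ p : Poly, p.totalDegree ≤ n → (∀ A ∈ X, eval A p = 0) → p = 0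

/-- Multiplying by the equation of M turns a polynomial that vanishes at the nodes off M into one
that vanishes on X. -/
theorem Unisolvent.remove {n : ℕ} {X : Finset Plane} (hX : Unisolvent (n + 1) X) {M : Set Plane}
    (hM : IsLine M) : Unisolvent n (nodesOff X M) := by
  obtain ⟨L, hL, rfl⟩ := hM
  intro p hp h0
  have hL0 : L ≠ 0 := fun h => by
    rw [h] at hL
    simp at hL
  refine (mul_eq_zero.1 (hX (L * p) ((totalDegree_mul _ _).trans (by omega))
    fun A hA => ?_)).resolve_left hL0
  by_cases hAL : eval A L = 0
  · rw [map_mul, hAL, zero_mul]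
  · rw [map_mul, h0 A (mem_nodesOff.2 ⟨hA, hAL⟩), mul_zero]

variable {X : Finset Plane} {l : Set Plane}

theorem mem_usingNodes_iff (hX : IsGC 4 (X : Set Plane)) {A : Plane} :
    A ∈ usingNodes 4 (X : Set Plane) l ↔ A ∈ X ∧ ∃ S, IsCover 4 X A S ∧ l ∈ S :=
  ⟨fun h => ⟨h.1, exists_cover_of_uses hX h.2⟩, fun ⟨hA, _, hS, hl⟩ => ⟨hA, hS.uses hA hl⟩⟩

theorem isNodeLine_iff {k : ℕ} :
    IsNodeLine k (X : Set Plane) l ↔ IsLine l ∧ (nodesOn X l).card = k := by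
  have : (X : Set Plane) ∩ l = (nodesOn X l : Set Plane) := by ext; simp
  rw [IsNodeLine, this, Set.ncard_coe_finset]

section OneMaximalLine

variable {M : Set Plane} (hX : IsGC 4 (X : Set Plane)) (hl : IsLine l)
  (h4 : (nodesOn X l).card = 4) (hM : IsMax 4 X M) (hd : ∀ A ∈ X, A ∈ M → A ∉ l)

include hl h4 hd in
theorem isMax_nodesOff_of_disjoint : IsMax 3 (nodesOff X M) l :=
  ⟨hl, by rw [nodesOn_nodesOff_of_disjoint fun A hA h1 h2 => hd A hA h2 h1, h4]⟩

include hX hl h4 hM hd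

/-- Nodes of M are excluded by `IsMax.notMem_cover`. The cover of a node off M and l contains M and,
once M is deleted, the then maximal line l. -/
theorem usingNodes_eq_of_disjoint :
    usingNodes 4 (X : Set Plane) l = (nodesOff (nodesOff X M) l : Finset Plane) := by
  have hmax := isMax_nodesOff_of_disjoint hl h4 hd
  ext A
  rw [mem_usingNodes_iff hX, Finset.mem_coe, mem_nodesOff, mem_nodesOff]
  constructor
  · rintro ⟨hA, S, hS, hlS⟩
    exact ⟨⟨hA, fun hAM => hM.notMem_cover hd hA hAM hS hlS⟩, hS.notMem l hlS⟩
  · rintro ⟨⟨hA, hAM⟩, hAl⟩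
    obtain ⟨S, hS⟩ := (lineGC_of_isGC hX).exists_cover A hA
    exact ⟨hA, S, hS, Finset.mem_of_mem_erase
      (hmax.mem_cover (hS.remove (hM.mem_cover hS hAM)) hAl)⟩

theorem lineGC_of_disjoint : LineGC 2 (nodesOff (nodesOff X M) l) :=
  ((lineGC_of_isGC hX).remove hM).remove (isMax_nodesOff_of_disjoint hl h4 hd)

theorem ncard_usingNodes_of_disjoint : (usingNodes 4 (X : Set Plane) l).ncard = 6 := by
  rw [usingNodes_eq_of_disjoint hX hl h4 hM hd, Set.ncard_coe_finset]
  have := (lineGC_of_disjoint hX hl h4 hM hd).card_eq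
  omega

theorem isGC_usingNodes_of_disjoint : IsGC 2 (usingNodes 4 (X : Set Plane) l) := by
  rw [usingNodes_eq_of_disjoint hX hl h4 hM hd]
  exact (lineGC_of_disjoint hX hl h4 hM hd).isGC
    ((Unisolvent.remove (n := 3) (fun p hp h0 => eq_zero_of_isPoised hX.1 hp h0) hM.1).remove hl)

end OneMaximalLine

section TwoMaximalLines

variable {M M' : Set Plane} {V : Plane} (hX : IsGC 4 (X : Set Plane)) (hl : IsLine l)
  (h4 : (nodesOn X l).card = 4) (hM : IsMax 4 X M) (hM' : IsMax 4 X M') (hne : M ≠ M')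
  (hV : V ∈ X) (hVM : V ∈ M) (hVM' : V ∈ M') (hVl : V ∈ l)

include h4 hM in
theorem IsMax.ne_of_card_eq_four : l ≠ M := fun e => by
  have := hM.2
  rw [← e] at this
  omega

include hl h4 hM hV hVM hVl in
theorem card_nodesOn_nodesOff_of_concurrent : (nodesOn (nodesOff X M) l).card = 3 := by
  rw [nodesOn_nodesOff_of_mem hl hM.1 (hM.ne_of_card_eq_four h4) hVl hVM,
    Finset.card_erase_of_mem (mem_nodesOn.2 ⟨hV, hVl⟩), h4]

include hl h4 hM' hVM hVM' hVl in
theorem notMem_of_concurrent : ∀ A ∈ nodesOff X M, A ∈ M' → A ∉ l := fun A hA hAM' hAl => by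
  rw [mem_nodesOff] at hA
  exact hA.2 (hl.point_eq hM'.1 (hM'.ne_of_card_eq_four h4) hVl hAl hVM' hAM' ▸ hVM)

include hl h4 hM hM' hV hVM hVM' hVl in
theorem isMax_nodesOff_of_concurrent : IsMax 2 (nodesOff (nodesOff X M) M') l :=
  ⟨hl, by rw [nodesOn_nodesOff_of_disjoint fun A hA h1 h2 =>
    notMem_of_concurrent hl h4 hM' hVM hVM' hVl A hA h2 h1,
    card_nodesOn_nodesOff_of_concurrent hl h4 hM hV hVM hVl]⟩

-- A user of l on M' would be off M, because M and M' meet on l. After deleting M the maximal line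
-- M' shares no node with l, so covers of its nodes do not contain l.
include hX hl h4 hM hM' hne hVM hVM' hVl in
theorem notMem_of_cover_of_concurrent {A : Plane} {S : Finset (Set Plane)} (hA : A ∈ X)
    (hS : IsCover 4 X A S) (hlS : l ∈ S) : A ∉ M' := fun hAM' => by
  have hAM : A ∉ M := fun hAM =>
    hS.notMem l hlS (hM.1.point_eq hM'.1 hne hVM hAM hVM' hAM' ▸ hVl)
  exact ((lineGC_of_isGC hX).isMax_nodesOff hM' hM hne.symm).notMem_cover
    (notMem_of_concurrent hl h4 hM' hVM hVM' hVl) (mem_nodesOff.2 ⟨hA, hAM⟩) hAM'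
    (hS.remove (hM.mem_cover hS hAM))
    (Finset.mem_erase.2 ⟨hM.ne_of_card_eq_four h4, hlS⟩)

include hX hl h4 hM hM' hne hV hVM hVM' hVl

theorem usingNodes_eq_of_concurrent : usingNodes 4 (X : Set Plane) l =
    (nodesOff (nodesOff (nodesOff X M) M') l : Finset Plane) := by
  have hmax := isMax_nodesOff_of_concurrent hl h4 hM hM' hV hVM hVM' hVl
  ext A
  rw [mem_usingNodes_iff hX, Finset.mem_coe, mem_nodesOff, mem_nodesOff, mem_nodesOff]
  constructor
  · rintro ⟨hA, S, hS, hlS⟩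
    exact ⟨⟨⟨hA, notMem_of_cover_of_concurrent hX hl h4 hM' hM hne.symm hVM' hVM hVl hA hS hlS⟩,
      notMem_of_cover_of_concurrent hX hl h4 hM hM' hne hVM hVM' hVl hA hS hlS⟩,
      hS.notMem l hlS⟩
  · rintro ⟨⟨⟨hA, hAM⟩, hAM'⟩, hAl⟩
    obtain ⟨S, hS⟩ := (lineGC_of_isGC hX).exists_cover A hA
    have hS₁ := hS.remove (hM.mem_cover hS hAM)
    have hS₂ := hS₁.remove
      (((lineGC_of_isGC hX).isMax_nodesOff hM' hM hne.symm).mem_cover hS₁ hAM')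
    exact ⟨hA, S, hS, Finset.mem_of_mem_erase (Finset.mem_of_mem_erase (hmax.mem_cover hS₂ hAl))⟩

theorem lineGC_of_concurrent : LineGC 1 (nodesOff (nodesOff (nodesOff X M) M') l) :=
  ((lineGC_of_isGC hX).remove_two hM hM' hne).remove
    (isMax_nodesOff_of_concurrent hl h4 hM hM' hV hVM hVM' hVl)

theorem ncard_usingNodes_of_concurrent : (usingNodes 4 (X : Set Plane) l).ncard = 3 := by
  rw [usingNodes_eq_of_concurrent hX hl h4 hM hM' hne hV hVM hVM' hVl, Set.ncard_coe_finset]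
  have := (lineGC_of_concurrent hX hl h4 hM hM' hne hV hVM hVM' hVl).card_eq
  omega

theorem isGC_usingNodes_of_concurrent : IsGC 1 (usingNodes 4 (X : Set Plane) l) := by
  rw [usingNodes_eq_of_concurrent hX hl h4 hM hM' hne hV hVM hVM' hVl]
  exact (lineGC_of_concurrent hX hl h4 hM hM' hne hV hVM hVM' hVl).isGC
    (((Unisolvent.remove (n := 3) (fun p hp h0 => eq_zero_of_isPoised hX.1 hp h0) hM.1).remove
      hM'.1).remove hl)

end TwoMaximalLines

end GCSets

/-! ### The theorem. -/

theorem proposition4p1 (X : Set GCSets.Plane) (hX : GCSets.IsGC 4 X)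
    (l : Set GCSets.Plane) (hl : GCSets.IsNodeLine 4 X l) :
    ((GCSets.usingNodes 4 X l).ncard = 6 ∨ (GCSets.usingNodes 4 X l).ncard = 3) ∧
    ((GCSets.usingNodes 4 X l).ncard = 6 ↔
      ∃ M₀ : Set GCSets.Plane, GCSets.IsMaximalLine 4 X M₀ ∧ M₀ ∩ l ∩ X = ∅) ∧
    (∀ M₀ : Set GCSets.Plane, GCSets.IsMaximalLine 4 X M₀ → M₀ ∩ l ∩ X = ∅ →
      GCSets.usingNodes 4 X l = X \ (l ∪ M₀) ∧ GCSets.IsGC 2 (GCSets.usingNodes 4 X l)) ∧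
    ((GCSets.usingNodes 4 X l).ncard = 3 ↔
      ∃ M' M'' : Set GCSets.Plane, GCSets.IsMaximalLine 4 X M' ∧ GCSets.IsMaximalLine 4 X M'' ∧
        M' ≠ M'' ∧ ∃ A ∈ X, M' ∩ M'' ∩ l = {A}) ∧
    (∀ M' M'' : Set GCSets.Plane, GCSets.IsMaximalLine 4 X M' → GCSets.IsMaximalLine 4 X M'' →
      M' ≠ M'' → (∃ A ∈ X, M' ∩ M'' ∩ l = {A}) →
      GCSets.usingNodes 4 X l = X \ (l ∪ M' ∪ M'') ∧
        GCSets.IsGC 1 (GCSets.usingNodes 4 X l)) := by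
  obtain ⟨Y, rfl⟩ := hX.1.1.exists_finset_coe
  obtain ⟨hll, h4⟩ := GCSets.isNodeLine_iff.1 hl
  have hmax : ∀ M, GCSets.IsMaximalLine 4 (Y : Set GCSets.Plane) M ↔ GCSets.IsMax 4 Y M :=
    fun M => GCSets.isNodeLine_iff
  have hdis : ∀ M : Set GCSets.Plane, M ∩ l ∩ Y = ∅ ↔ ∀ A ∈ Y, A ∈ M → A ∉ l := fun M => by
    rw [Set.eq_empty_iff_forall_notMem]
    exact forall_congr' fun A =>
      ⟨fun h hA hAM hAl => h ⟨⟨hAM, hAl⟩, hA⟩, fun h ⟨⟨hAM, hAl⟩, hA⟩ => h hA hAM hAl⟩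
  have hmem : ∀ (M M' : Set GCSets.Plane) (A), M ∩ M' ∩ l = {A} → A ∈ M ∧ A ∈ M' ∧ A ∈ l :=
    fun M M' A h => by
      have : A ∈ M ∩ M' ∩ l := h ▸ Set.mem_singleton A
      exact ⟨this.1.1, this.1.2, this.2⟩
  simp only [hmax, hdis]
  have h6 : ∀ M₀, GCSets.IsMax 4 Y M₀ → (∀ A ∈ Y, A ∈ M₀ → A ∉ l) →
      (GCSets.usingNodes 4 (Y : Set GCSets.Plane) l).ncard = 6 :=
    fun M₀ hM hd => GCSets.ncard_usingNodes_of_disjoint hX hll h4 hM hd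
  have h3 : ∀ M' M'', GCSets.IsMax 4 Y M' → GCSets.IsMax 4 Y M'' → M' ≠ M'' →
      (∃ A ∈ Y, A ∈ M' ∧ A ∈ M'' ∧ A ∈ l) →
      (GCSets.usingNodes 4 (Y : Set GCSets.Plane) l).ncard = 3 :=
    fun M' M'' hM' hM'' hne ⟨A, hA, h1, h2, h5⟩ =>
      GCSets.ncard_usingNodes_of_concurrent hX hll h4 hM' hM'' hne hA h1 h2 h5
  -- One of the two situations occurs, and they give different counts, so the count tells which one
  -- it is.
  have hcases := (GCSets.lineGC_of_isGC hX).exists_maximal_lines hll h4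
  refine ⟨?_, ⟨fun h => ?_, fun ⟨M₀, hM, hd⟩ => h6 M₀ hM hd⟩, fun M₀ hM hd => ⟨?_, ?_⟩,
    ⟨fun h => ?_, fun ⟨M', M'', hM', hM'', hne, A, hA, h⟩ =>
      h3 M' M'' hM' hM'' hne ⟨A, hA, hmem _ _ _ h⟩⟩,
    fun M' M'' hM' hM'' hne ⟨A, hA, h⟩ => ⟨?_, ?_⟩⟩
  · rcases hcases with ⟨M, hM, hd⟩ | ⟨M, M', hM, hM', hne, hA⟩
    · exact Or.inl (h6 M hM hd)
    · exact Or.inr (h3 M M' hM hM' hne hA)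
  · rcases hcases with h' | ⟨M, M', hM, hM', hne, hA⟩
    · exact h'
    · have := h3 M M' hM hM' hne hA
      omega
  · rw [GCSets.usingNodes_eq_of_disjoint hX hll h4 hM hd]
    ext A
    simp
    tauto
  · exact GCSets.isGC_usingNodes_of_disjoint hX hll h4 hM hd
  · rcases hcases with ⟨M, hM, hd⟩ | ⟨M, M', hM, hM', hne, A, hA, hAM, hAM', hAl⟩
    · have := h6 M hM hd
      omega
    · refine ⟨M, M', hM, hM', hne, A, hA, Set.eq_singleton_iff_unique_mem.2
        ⟨⟨⟨hAM, hAM'⟩, hAl⟩, fun B hB => ?_⟩⟩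
      exact hM.1.point_eq hM'.1 hne hB.1.1 hAM hB.1.2 hAM'
  · obtain ⟨h1, h2, h5⟩ := hmem _ _ _ h
    rw [GCSets.usingNodes_eq_of_concurrent hX hll h4 hM' hM'' hne hA h1 h2 h5]
    ext B
    simp
    tauto
  · obtain ⟨h1, h2, h5⟩ := hmem _ _ _ h
    exact GCSets.isGC_usingNodes_of_concurrent hX hll h4 hM' hM'' hne hA h1 h2 h5
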